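/- Let $d,m\ge 0$ and let $\psi_d(\mathbb{R}^m)$ be the set of subsets $W\subseteq\mathbb{R}^m$ that are smooth $d$-dimensional embedded submanifolds without boundary and are closed as subsets. *Plot topology.* Let $U$ be a finite-dimensional smooth manifold (without boundary). A map of sets $p:U\to\psi_d(\mathbb{R}^m)$ is a plot if its graph $\Gamma(p)=\{(u,w)\in U\times\mathbb{R}^m : w\in p(u)\}$ is a smooth submanifold of $U\times\mathbb{R}^m$ that is closed as a subset, and the projection $\Gamma(p)\to U$ is a submersion. A set $O\subseteq\psi_d(\mathbb{R}^m)$ is open in $\tau_{\mathrm{plot}}$ if and only if $p^{-1}(O)$ is open in $U$ for every $U$ and every plot $p:U\to\psi_d(\mathbb{R}^m)$. *Galatius–Randal-Williams topology.* (1) For $W\in\psi_d(\mathbb{R}^m)$ let $NW=\{(x,v):x\in W,\ v\perp T_xW\}$ be its normal bundle and $\Gamma_c(NW)$ the space of compactly supported smooth sections, with the strong $C^\infty$ topology: a subbasis is given by the sets $\{t : |X_1\cdots X_r(t-s)(x)|<\varepsilon(x)\text{ for all }x\in W\}$, for $s\in\Gamma_c(NW)$, $r\ge 0$, smooth vector fields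 $X_1,\dots,X_r$ on $W$ and continuous $\varepsilon:W\to(0,\infty)$. For each tubular neighbourhood $N\subseteq NW$ (an open neighbourhood of the zero section that $(x,v)\mapsto x+v$ maps diffeomorphically onto an open subset of $\mathbb{R}^m$) there is a chart sending a section $s\in\Gamma_c(NW)$ with values in $N$ to its image $\{x+s(x):x\in W\}\in\psi_d(\mathbb{R}^m)$. Let $\psi_d(\mathbb{R}^m)^{cs}$ be $\psi_d(\mathbb{R}^m)$ with the topology determined by these charts, i.e. a set is open if and only if its preimage under each chart is open. (2) For compact $K\subseteq\mathbb{R}^m$ let $\pi_K:\psi_d(\mathbb{R}^m)\to\psi_d(K\subset\mathbb{R}^m)$ be the quotient map identifying submanifolds that agree on a neighbourhood of $K$; give $\psi_d(K\subset\mathbb{R}^m)$ the quotient topology from $\psi_d(\mathbb{R}^m)^{cs}$, and let $\psi_d(\mathbb{R}^m)^K$ be $\psi_d(\mathbb{R}^m)$ with the coarsest topology making $\pi_K$ continuous. (3) $\tau_{\mathrm{GRW}}$ is the coarsest topology on $\psi_d(\mathbb{R}^m)$ that is finer than that of $\psi_d(\mathbb{R}^m)^K$ for every compact $K$. **Theorem.**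 The identity map is a homeomorphism $(\psi_d(\mathbb{R}^m),\tau_{\mathrm{plot}})\cong(\psi_d(\mathbb{R}^m),\tau_{\mathrm{GRW}})$. -/

import Mathlib

open scoped Manifold ContDiff Topology RealInnerProductSpace

noncomputable section

/-! ### Submanifolds, tangent vectors, submersions -/

/-- `S ⊆ N` is a (boundaryless, embedded) smooth `k`-dimensional submanifold of the
boundaryless smooth manifold `N`: around each of its points there is a slice chart, that is, a
smooth chart of `N` in which `S` becomes a `k`-dimensional linear subspace. -/
def IsSmoothSubmanifold {E H N : Type*} [NormedAddCommGroup E] [NormedSpace ℝ E]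
    [FiniteDimensional ℝ E] [TopologicalSpace H] (I : ModelWithCorners ℝ E H) [I.Boundaryless]
    [TopologicalSpace N] [ChartedSpace H N] (k : ℕ) (S : Set N) : Prop :=
  ∀ x ∈ S, ∃ e ∈ IsManifold.maximalAtlas I ∞ N, x ∈ e.source ∧
    ∃ L : Submodule ℝ E, Module.finrank ℝ L = k ∧ ∀ y ∈ e.source, y ∈ S ↔ I (e y) ∈ L

/-- The vectors tangent to `S ⊆ N` at `x`: the velocities at time `0` of smooth curves
in `S` through `x`. If `S` is a submanifold, this is the tangent space of `S` at `x ∈ S`.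
(In Mathlib the tangent space of `N` at `x` is the model space `E`.) -/
def tangentVectors {E H N : Type*} [NormedAddCommGroup E] [NormedSpace ℝ E]
    [TopologicalSpace H] (I : ModelWithCorners ℝ E H)
    [TopologicalSpace N] [ChartedSpace H N] (S : Set N) (x : N) : Set (TangentSpace I x) :=
  {v | ∃ γ : ℝ → N, ContMDiffAt 𝓘(ℝ, ℝ) I ∞ γ 0 ∧ (∀ᶠ t in 𝓝 (0 : ℝ), γ t ∈ S) ∧
    γ 0 = x ∧ (mfderiv 𝓘(ℝ, ℝ) I γ 0 (1 : ℝ) : E) = v}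

/-- The restriction of `f : N → N'` to the submanifold `S` of `N` is a submersion: its
differential maps the tangent space of `S` onto that of `N'`, at every point of `S`. -/
def RestrictsToSubmersion {E H N E' H' N' : Type*}
    [NormedAddCommGroup E] [NormedSpace ℝ E] [TopologicalSpace H] (I : ModelWithCorners ℝ E H)
    [TopologicalSpace N] [ChartedSpace H N]
    [NormedAddCommGroup E'] [NormedSpace ℝ E'] [TopologicalSpace H'] (I' : ModelWithCorners ℝ E' H')
    [TopologicalSpace N'] [ChartedSpace H' N'] (f : N → N') (S : Set N) : Prop :=
  ∀ x ∈ S, ∀ b : TangentSpace I' (f x), ∃ v ∈ tangentVectors I S x, mfderiv I I' f x v = b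

/-! ### The set of closed submanifolds of Euclidean space -/

/-- `ℝ^m` with its Euclidean norm and standard smooth structure. -/
abbrev Euc (m : ℕ) : Type := EuclideanSpace ℝ (Fin m)

/-- `W` is a smooth `d`-dimensional submanifold of `ℝ^m` without boundary, closed as a subset. -/
def IsClosedSubmanifold (d : ℕ) {m : ℕ} (W : Set (Euc m)) : Prop :=
  IsClosed W ∧ IsSmoothSubmanifold 𝓘(ℝ, Euc m) d W

/-- The set `ψ_d(ℝ^m)`. -/
def Psi (d m : ℕ) : Type := {W : Set (Euc m) // IsClosedSubmanifold d W}

/-! ### The plot topology -/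

/-- The graph of a set-theoretic map `p : U → ψ_d(ℝ^m)`. -/
def plotGraph {d m : ℕ} {U : Type} (p : U → Psi d m) : Set (U × Euc m) :=
  {q | q.2 ∈ (p q.1).1}

/-- `p : U → ψ_d(ℝ^m)` is a plot, where `U` is a smooth manifold of dimension `n`: its graph is a
closed smooth submanifold of `U × ℝ^m` (of dimension `n + d`, which is the dimension forced by the
last condition), and the projection of the graph to `U` is a submersion. -/
structure IsPlot {d m n : ℕ} {U : Type} [TopologicalSpace U] [ChartedSpace (Euc n) U]
    (p : U → Psi d m) : Prop where
  isClosed_graph : IsClosed (plotGraph p)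
  submanifold_graph :
    IsSmoothSubmanifold (𝓘(ℝ, Euc n).prod 𝓘(ℝ, Euc m)) (n + d) (plotGraph p)
  submersion :
    RestrictsToSubmersion (𝓘(ℝ, Euc n).prod 𝓘(ℝ, Euc m)) 𝓘(ℝ, Euc n)
      (Prod.fst : U × Euc m → U) (plotGraph p)

/-- The plot topology on `ψ_d(ℝ^m)`: a set is open if and only if its preimage under every plot,
parametrised by any finite-dimensional smooth manifold, is open. -/
def plotTopology (d m : ℕ) : TopologicalSpace (Psi d m) where
  IsOpen O := ∀ (n : ℕ) (U : Type) [TopologicalSpace U] [T2Space U] [SecondCountableTopology U]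
    [ChartedSpace (Euc n) U] [IsManifold 𝓘(ℝ, Euc n) ∞ U] (p : U → Psi d m),
    IsPlot (n := n) p → IsOpen (p ⁻¹' O)
  isOpen_univ := by
    intros
    simp
  isOpen_inter := by
    intro s t hs ht n U _ _ _ _ _ p hp
    exact (hs n U p hp).inter (ht n U p hp)
  isOpen_sUnion := by
    intro S hS n U _ _ _ _ _ p hp
    rw [Set.preimage_sUnion]
    exact isOpen_biUnion fun t ht => hS t ht n U p hp

/-! ### The Galatius–Randal-Williams topology

It is constructed in three steps. -/

section StepOne

variable {m : ℕ}

/-- The (total space of the) normal bundle of `W ⊆ ℝ^m`: the pairs `(x, v)` with `x ∈ W` and `v`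
orthogonal to the tangent space of `W` at `x`. -/
def normalBundle (W : Set (Euc m)) : Set (Euc m × Euc m) :=
  {q | q.1 ∈ W ∧ ∀ w : Euc m, w ∈ tangentVectors 𝓘(ℝ, Euc m) W q.1 → ⟪w, q.2⟫ = 0}

/-- The space `Γ_c` of compactly supported smooth sections of the normal bundle of a closed
submanifold `W` of `ℝ^m`. A section is recorded as a function `W → ℝ^m`, extended by zero to
`ℝ^m`; smoothness is only required along `W`. (`ContDiffOn ℝ ∞ s W` says that `s` is smooth as a
function on the submanifold `W`, i.e. that near each point of `W` it agrees on `W` with a smooth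
function on an open subset of `ℝ^m`.) -/
structure NormalSection (W : Set (Euc m)) where
  toFun : Euc m → Euc m
  eq_zero_off : ∀ x, x ∉ W → toFun x = 0
  smooth : ContDiffOn ℝ ∞ toFun W
  normal : ∀ x ∈ W, (x, toFun x) ∈ normalBundle W
  compact_support : HasCompactSupport toFun

/-- `X` restricts to a smooth tangent vector field on the submanifold `W`. -/
def IsTangentField (W : Set (Euc m)) (X : Euc m → Euc m) : Prop :=
  ContDiffOn ℝ ∞ X W ∧ ∀ x ∈ W, X x ∈ tangentVectors 𝓘(ℝ, Euc m) W x

/-- `X₁ X₂ ⋯ X_r f`, the iterated derivative of a (vector-valued) smooth function `f` on the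
submanifold `W` along tangent vector fields. (A derivative of `f` within `W` is unique on vectors
tangent to `W`, so the choice made by `fderivWithin` does not matter.) -/
def iteratedFieldDeriv (W : Set (Euc m)) (Xs : List (Euc m → Euc m)) (f : Euc m → Euc m) :
    Euc m → Euc m :=
  Xs.foldr (fun X g x => fderivWithin ℝ g W x (X x)) f

/-- The strong `C^∞` topology on `Γ_c`. A subbasis is given by the sets `s + B(ε, X)`, where
`B(ε, X)` consists of the sections `f` with `|X₁ ⋯ X_r f| < ε` pointwise on `W`, for a positive
continuous function `ε` on `W` and finitely many (possibly zero) vector fields `X₁, …, X_r`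
on `W`. -/
def strongTopology (W : Set (Euc m)) : TopologicalSpace (NormalSection W) :=
  TopologicalSpace.generateFrom
    {V | ∃ (s : NormalSection W) (Xs : List (Euc m → Euc m)) (ε : Euc m → ℝ),
      (∀ X ∈ Xs, IsTangentField W X) ∧ ContinuousOn ε W ∧ (∀ x ∈ W, 0 < ε x) ∧
      V = {t | ∀ x ∈ W,
        ‖iteratedFieldDeriv W Xs (fun y => t.toFun y - s.toFun y) x‖ < ε x}}

/-- `N` is a tubular neighbourhood of `W`: an open neighbourhood of the zero section in the normal
bundle which the map `(x, v) ↦ x + v` embeds into `ℝ^m`, i.e. maps diffeomorphically onto an open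
subset of `ℝ^m`. -/
structure IsTubularNeighbourhood (W : Set (Euc m)) (N : Set (Euc m × Euc m)) : Prop where
  isOpen_in_normalBundle : ∃ O : Set (Euc m × Euc m), IsOpen O ∧ N = normalBundle W ∩ O
  zero_section : ∀ x ∈ W, (x, (0 : Euc m)) ∈ N
  isOpen_image : IsOpen ((fun q : Euc m × Euc m => q.1 + q.2) '' N)
  smooth_inverse : ∃ g : Euc m → Euc m × Euc m,
    ContDiffOn ℝ ∞ g ((fun q : Euc m × Euc m => q.1 + q.2) '' N) ∧ ∀ q ∈ N, g (q.1 + q.2) = q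

/-- The image `{x + s(x) | x ∈ W}` of a normal section. -/
def sectionImage {W : Set (Euc m)} (s : NormalSection W) : Set (Euc m) :=
  (fun x => x + s.toFun x) '' W

/-- The domain of the chart at `W` given by a tubular neighbourhood `N`: the sections with values
in `N`. (Their images are always closed `d`-dimensional submanifolds; the second condition only
records this.) -/
def ChartDomain {d : ℕ} (W : Psi d m) (N : Set (Euc m × Euc m)) : Type :=
  {s : NormalSection W.1 // (∀ x ∈ W.1, (x, s.toFun x) ∈ N) ∧ IsClosedSubmanifold d (sectionImage s)}

/-- The chart of `ψ_d(ℝ^m)` at `W` sends a section of the normal bundle to its image. -/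
def chartMap {d : ℕ} (W : Psi d m) (N : Set (Euc m × Euc m)) (s : ChartDomain W N) : Psi d m :=
  ⟨sectionImage s.1, s.2.2⟩

/-- Step 1, the topology of `ψ_d(ℝ^m)^{cs}`: the topology determined by the charts `Γ_c ⇢ ψ_d(ℝ^m)`,
with `Γ_c` in the strong `C^∞` topology, i.e. a set is open if and only if its preimage under each
chart is open. -/
def compactSupportTopology (d m : ℕ) : TopologicalSpace (Psi d m) :=
  ⨆ (W : Psi d m) (N : Set (Euc m × Euc m)) (_ : IsTubularNeighbourhood W.1 N),
    TopologicalSpace.coinduced (chartMap W N)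
      (TopologicalSpace.induced Subtype.val (strongTopology W.1))

end StepOne

/-- Having the same germ near `K`, i.e. agreeing on some open neighbourhood of `K`. -/
def germSetoid (d m : ℕ) (K : Set (Euc m)) : Setoid (Psi d m) where
  r W W' := ∃ V : Set (Euc m), IsOpen V ∧ K ⊆ V ∧ W.1 ∩ V = W'.1 ∩ V
  iseqv :=
    { refl := fun _ => ⟨Set.univ, isOpen_univ, Set.subset_univ _, rfl⟩
      symm := fun ⟨V, h1, h2, h3⟩ => ⟨V, h1, h2, h3.symm⟩
      trans := by
        rintro A B C ⟨V, h1, h2, h3⟩ ⟨V', h1', h2', h3'⟩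
        refine ⟨V ∩ V', h1.inter h1', Set.subset_inter h2 h2', ?_⟩
        rw [← Set.inter_assoc, h3, Set.inter_right_comm, h3', Set.inter_right_comm,
          Set.inter_assoc] }

/-- The set `ψ_d(K ⊂ ℝ^m)` of germs near `K` of closed submanifolds. -/
def PsiGerm (d m : ℕ) (K : Set (Euc m)) : Type := Quotient (germSetoid d m K)

/-- `π_K : ψ_d(ℝ^m) → ψ_d(K ⊂ ℝ^m)`. -/
def toGerm (d m : ℕ) (K : Set (Euc m)) (W : Psi d m) : PsiGerm d m K :=
  Quotient.mk (germSetoid d m K) W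

/-- Step 2, the topology of `ψ_d(ℝ^m)^K`: give `ψ_d(K ⊂ ℝ^m)` the quotient topology of
`ψ_d(ℝ^m)^{cs}`, and then take the coarsest topology on `ψ_d(ℝ^m)` that makes `π_K` continuous. -/
def germTopology (d m : ℕ) (K : Set (Euc m)) : TopologicalSpace (Psi d m) :=
  TopologicalSpace.induced (toGerm d m K)
    (TopologicalSpace.coinduced (toGerm d m K) (compactSupportTopology d m))

/-- Step 3, the Galatius–Randal-Williams topology: the coarsest topology on `ψ_d(ℝ^m)` that is
finer than the topology of `ψ_d(ℝ^m)^K` for every compact `K`. -/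
def grwTopology (d m : ℕ) : TopologicalSpace (Psi d m) :=
  ⨅ (K : Set (Euc m)) (_ : IsCompact K), germTopology d m K

end

/-! Two facts carry the proof. Call a submanifold close to the image of a section `s` if, near a
compact set `K`, it agrees with the image of a section strongly close to `s`.

First, plots are continuous for this notion (`IsPlot.eventually_exists_section`). By submersivity
the graph of a plot is locally a smooth family of submanifolds (`IsPlot.isFiberedAt`). If the fibre
over `u₀` agrees near `K` with the image of a section `s₀` of a tubular neighbourhood, the
projection of that neighbourhood is a local diffeomorphism on this fibre. By the inverse function
theorem the nearby fibres are locally images of sections depending smoothly on the parameter. By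
uniqueness these glue along a compact set, and a cutoff function extends them by `s₀`. The resulting
family is constant outside a compact set, hence continuous in the strong topology
(`IsTubularRetraction.eventually_mem_strong`). So GRW-open sets are plot-open.

Second, a plot-open set containing the image of `s` contains everything close to it, for some `K`
and some strong neighbourhood of `s` (`exists_strong_nhds_germ_subset`). Otherwise there are
sections `t n`, with the derivatives of `t n - s` up to order `n` below `1 / n!`, and submanifolds
`W' n` outside the set that agree with the image of `t n` near the ball of radius `n!`. They are
placed on one smooth curve, `W' n` at time `2⁻ⁿ` and the image of `s` at time `0`, which contradicts
openness of the preimage. On the level of sections, the `t n` are switched on one at a time by bumps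
in dyadic time intervals; smoothness at time `0` follows from the rapid decay. The `W' n` themselves
are not images of sections far out. The curve therefore follows `W' n` close to time `2⁻ⁿ` and the
sections in between. While it changes from one to the other, space is compressed into a ball of
radius at most `n!`, where the two agree. The compression is trivial at the times `2⁻ⁿ` and `0`, so
the curve passes exactly through the prescribed points (`exists_isPlot_dyadic`).

Given a plot-open set and a point of it, take `K` and `V` from the second fact, and let `A` be the
set of submanifolds agreeing near `K` with the image of a section in `V`. It lies in the given set
and is saturated for germs at `K`. It is plot-open by the first fact, and therefore open in the
compactly supported topology by the second. Hence it is GRW-open. -/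

noncomputable section

/-! ### Local diffeomorphisms of a vector space -/

section LocalDiffeo

variable {E : Type*} [NormedAddCommGroup E] [NormedSpace ℝ E]

/-- A homeomorphism between open subsets of a vector space that is smooth in both directions. -/
structure IsLocalDiffeo (e : OpenPartialHomeomorph E E) : Prop where
  smooth : ContDiffOn ℝ ∞ e e.source
  smooth_symm : ContDiffOn ℝ ∞ e.symm e.target

/-- Inverse function theorem: a smooth map with injective differential at `a` restricts to a
diffeomorphism between open sets near `a`. -/
theorem exists_localDiffeo_of_injective [FiniteDimensional ℝ E] {G : E → E} {S : Set E}
    (hS : IsOpen S) (hG : ContDiffOn ℝ ∞ G S) {a : E} (ha : a ∈ S)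
    (hinj : ∀ v, fderiv ℝ G a v = 0 → v = 0) :
    ∃ e : OpenPartialHomeomorph E E, IsLocalDiffeo e ∧ a ∈ e.source ∧ e.source ⊆ S ∧
      (e : E → E) = G := by
  have : CompleteSpace E := FiniteDimensional.complete ℝ E
  have hat : ∀ x ∈ S, ContDiffAt ℝ ∞ G x := fun x hx => hG.contDiffAt (hS.mem_nhds hx)
  let A : E ≃L[ℝ] E := (LinearEquiv.ofInjectiveEndo (fderiv ℝ G a : E →ₗ[ℝ] E)
    ((injective_iff_map_eq_zero _).2 hinj)).toContinuousLinearEquiv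
  have hA : (A : E →L[ℝ] E) = fderiv ℝ G a := by ext v; rfl
  have hstrict : HasStrictFDerivAt G (A : E →L[ℝ] E) a := by
    rw [hA]; exact (hat a ha).hasStrictFDerivAt (by simp)
  set φ := hstrict.toOpenPartialHomeomorph G
  have hcont : ContinuousOn (fderiv ℝ G) S :=
    hG.continuousOn_fderiv_of_isOpen hS (by simp)
  -- Invertibility of the differential is needed at every point of the source, not only at `a`, for
  -- the inverse to be smooth on its whole target.
  set S' := S ∩ fderiv ℝ G ⁻¹' (Set.range ((↑) : (E ≃L[ℝ] E) → E →L[ℝ] E))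
  have hS' : IsOpen S' := hcont.isOpen_inter_preimage hS ContinuousLinearEquiv.isOpen
  have hcoe : (φ : E → E) = G := rfl
  refine ⟨φ.restrOpen S' hS', ⟨?_, ?_⟩, ?_, ?_, rfl⟩
  · intro x hx
    exact (hat x hx.2.1).contDiffWithinAt
  · intro y hy
    have hmem : φ.symm y ∈ S' := by
      have := (φ.restrOpen S' hS').map_target hy
      exact this.2
    obtain ⟨B, hB⟩ := hmem.2
    have hty : y ∈ φ.target := by
      have := (φ.restrOpen S' hS').map_target hy
      rw [← (φ.restrOpen S' hS').right_inv hy]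
      exact φ.map_source this.1
    refine (φ.contDiffAt_symm (f₀' := B) hty ?_ (hat _ hmem.1)).contDiffWithinAt
    rw [hB]
    exact ((hat _ hmem.1).differentiableAt (by simp)).hasFDerivAt
  · refine ⟨hstrict.mem_toOpenPartialHomeomorph_source, ha, A, hA⟩
  · intro x hx
    exact hx.2.1

namespace IsLocalDiffeo

variable {e : OpenPartialHomeomorph E E} (he : IsLocalDiffeo e)
include he

theorem symm : IsLocalDiffeo e.symm := ⟨he.smooth_symm, by simpa using he.smooth⟩

theorem contDiffAt {x : E} (hx : x ∈ e.source) : ContDiffAt ℝ ∞ e x :=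
  he.smooth.contDiffAt (e.open_source.mem_nhds hx)

theorem contDiffAt_symm {x : E} (hx : x ∈ e.target) : ContDiffAt ℝ ∞ e.symm x :=
  he.smooth_symm.contDiffAt (e.open_target.mem_nhds hx)

theorem differentiableAt {x : E} (hx : x ∈ e.source) : DifferentiableAt ℝ e x :=
  (he.contDiffAt hx).differentiableAt (by simp)

theorem differentiableAt_symm {x : E} (hx : x ∈ e.target) : DifferentiableAt ℝ e.symm x :=
  (he.contDiffAt_symm hx).differentiableAt (by simp)

theorem fderiv_symm_fderiv {x : E} (hx : x ∈ e.source) (v : E) :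
    fderiv ℝ e.symm (e x) (fderiv ℝ e x v) = v := by
  have h1 : HasFDerivAt (e.symm ∘ e) ((fderiv ℝ e.symm (e x)).comp (fderiv ℝ e x)) x :=
    HasFDerivAt.comp x (he.differentiableAt_symm (e.map_source hx)).hasFDerivAt
      (he.differentiableAt hx).hasFDerivAt
  have h2 : HasFDerivAt (e.symm ∘ e) (ContinuousLinearMap.id ℝ E) x :=
    (hasFDerivAt_id x).congr_of_eventuallyEq (e.eventually_left_inverse hx)
  exact DFunLike.congr_fun (h1.unique h2) v

theorem fderiv_fderiv_symm {x : E} (hx : x ∈ e.source) (v : E) :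
    fderiv ℝ e x (fderiv ℝ e.symm (e x) v) = v := by
  have := he.symm.fderiv_symm_fderiv (x := e x) (e.map_source hx) v
  simpa [e.left_inv hx] using this

theorem fderiv_injective {x : E} (hx : x ∈ e.source) {v : E} (hv : fderiv ℝ e x v = 0) :
    v = 0 := by
  rw [← he.fderiv_symm_fderiv hx v, hv, map_zero]

end IsLocalDiffeo

theorem IsLocalDiffeo.trans {e e' : OpenPartialHomeomorph E E} (he : IsLocalDiffeo e)
    (he' : IsLocalDiffeo e') : IsLocalDiffeo (e.trans e') := by
  refine ⟨?_, ?_⟩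
  · rw [OpenPartialHomeomorph.trans_source]
    exact he'.smooth.comp (he.smooth.mono Set.inter_subset_left) fun x hx => hx.2
  · rw [OpenPartialHomeomorph.trans_target]
    exact he.smooth_symm.comp (he'.smooth_symm.mono Set.inter_subset_left) fun x hx => hx.2

end LocalDiffeo

/-! ### Slice charts in Euclidean space -/

section Slice

variable {m : ℕ}

/-- In the chart `e`, the set `W` is the linear subspace `L`. -/
structure IsSliceChart {E : Type*} [NormedAddCommGroup E] [NormedSpace ℝ E] (W : Set E)
    (e : OpenPartialHomeomorph E E) (L : Submodule ℝ E) : Prop extends IsLocalDiffeo e where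
  mem_iff : ∀ y ∈ e.source, y ∈ W ↔ e y ∈ L

/-- On a vector space the charts of the maximal atlas are the partial homeomorphisms that are smooth
both ways, so manifold language can be dropped from here on. -/
theorem isSmoothSubmanifold_iff_slice {d : ℕ} {W : Set (Euc m)} :
    IsSmoothSubmanifold 𝓘(ℝ, Euc m) d W ↔ ∀ x ∈ W, ∃ (e : OpenPartialHomeomorph (Euc m) (Euc m))
      (L : Submodule ℝ (Euc m)), IsSliceChart W e L ∧ x ∈ e.source ∧ Module.finrank ℝ L = d := by
  constructor
  · intro h x hx
    obtain ⟨e, he, hxe, L, hL, hmem⟩ := h x hx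
    rw [IsManifold.mem_maximalAtlas_iff_contMDiffOn, contMDiffOn_iff_contDiffOn,
      contMDiffOn_iff_contDiffOn] at he
    exact ⟨e, L, ⟨⟨he.1, he.2⟩, hmem⟩, hxe, hL⟩
  · intro h x hx
    obtain ⟨e, L, he, hxe, hL⟩ := h x hx
    refine ⟨e, ?_, hxe, L, hL, he.mem_iff⟩
    rw [IsManifold.mem_maximalAtlas_iff_contMDiffOn, contMDiffOn_iff_contDiffOn,
      contMDiffOn_iff_contDiffOn]
    exact ⟨he.smooth, he.smooth_symm⟩

theorem mem_tangentVectors_iff {E : Type*} [NormedAddCommGroup E] [NormedSpace ℝ E]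
    {W : Set E} {x v : E} :
    v ∈ tangentVectors 𝓘(ℝ, E) W x ↔ ∃ γ : ℝ → E, ContDiffAt ℝ ∞ γ 0 ∧
      (∀ᶠ t in 𝓝 (0 : ℝ), γ t ∈ W) ∧ γ 0 = x ∧ HasDerivAt γ v 0 := by
  constructor
  · rintro ⟨γ, h1, h2, h3, h4⟩
    rw [contMDiffAt_iff_contDiffAt] at h1
    refine ⟨γ, h1, h2, h3, ?_⟩
    rw [← h4, mfderiv_eq_fderiv]
    exact (h1.differentiableAt (by simp)).hasFDerivAt.hasDerivAt
  · rintro ⟨γ, h1, h2, h3, h4⟩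
    refine ⟨γ, contMDiffAt_iff_contDiffAt.2 h1, h2, h3, ?_⟩
    rw [mfderiv_eq_fderiv]
    exact h4.deriv

/-- The velocity of a curve that stays in a linear subspace lies in the subspace. -/
theorem HasDerivAt.mem_of_eventually_mem {E : Type*} [NormedAddCommGroup E] [NormedSpace ℝ E]
    [FiniteDimensional ℝ E] (L : Submodule ℝ E) {γ : ℝ → E} {v : E} {t₀ : ℝ}
    (h : HasDerivAt γ v t₀) (hL : ∀ᶠ t in 𝓝 t₀, γ t ∈ L) : v ∈ L := by
  have h0 := hL.self_of_nhds
  refine L.closed_of_finiteDimensional.mem_of_tendsto (hasDerivAt_iff_tendsto_slope.1 h) ?_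
  filter_upwards [hL.filter_mono nhdsWithin_le_nhds] with t ht
  exact L.smul_mem _ (L.sub_mem ht h0)

namespace IsSliceChart

variable {E : Type*} [NormedAddCommGroup E] [NormedSpace ℝ E] [FiniteDimensional ℝ E]
  {W : Set E} {e : OpenPartialHomeomorph E E} {L : Submodule ℝ E}
  (he : IsSliceChart W e L)
include he

/-- The chart carries curves in `W` to curves in `L`; conversely, straight lines in `L` pull back to
curves in `W`. -/
theorem mem_tangentVectors {x : E} (hxW : x ∈ W) (hx : x ∈ e.source) {v : E} :
    v ∈ tangentVectors 𝓘(ℝ, E) W x ↔ fderiv ℝ e x v ∈ L := by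
  rw [mem_tangentVectors_iff]
  constructor
  · rintro ⟨γ, h1, h2, h3, h4⟩
    subst h3
    refine HasDerivAt.mem_of_eventually_mem L
      ((he.differentiableAt hx).hasFDerivAt.comp_hasDerivAt 0 h4) ?_
    filter_upwards [h2, h1.continuousAt.preimage_mem_nhds (e.open_source.mem_nhds hx)] with t ht ht'
    exact (he.mem_iff _ ht').1 ht
  · intro hv
    have hc : ContDiffAt ℝ ∞ (fun t : ℝ => e x + t • fderiv ℝ e x v) 0 := by fun_prop
    have hd : HasDerivAt (fun t : ℝ => e x + t • fderiv ℝ e x v) (fderiv ℝ e x v) 0 := by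
      simpa using ((hasDerivAt_id (0 : ℝ)).smul_const (fderiv ℝ e x v)).const_add (e x)
    have hs : ContDiffAt ℝ ∞ e.symm ((fun t : ℝ => e x + t • fderiv ℝ e x v) 0) := by
      simpa using he.contDiffAt_symm (e.map_source hx)
    refine ⟨fun t => e.symm (e x + t • fderiv ℝ e x v), hs.comp 0 hc, ?_, ?_, ?_⟩
    · have : ∀ᶠ t : ℝ in 𝓝 0, e x + t • fderiv ℝ e x v ∈ e.target := by
        apply hc.continuousAt.preimage_mem_nhds
        simpa using e.open_target.mem_nhds (e.map_source hx)
      filter_upwards [this] with t ht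
      rw [he.mem_iff _ (e.map_target ht), e.right_inv ht]
      exact L.add_mem ((he.mem_iff _ hx).1 hxW) (L.smul_mem _ hv)
    · simp [e.left_inv hx]
    · have := (hs.differentiableAt (by simp)).hasFDerivAt.comp_hasDerivAt 0 hd
      simpa [he.fderiv_symm_fderiv hx] using! this

end IsSliceChart

end Slice

end

noncomputable section

/-! ### Tubular neighbourhoods -/

section Tubular

variable {m : ℕ}

-- Expanding in an orthonormal basis reduces the adjoint to finitely many inner products, each
-- visibly smooth.
open ContinuousLinearMap in
theorem ContDiffOn.adjoint_apply {X E : Type*} [NormedAddCommGroup X] [NormedSpace ℝ X]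
    [NormedAddCommGroup E] [InnerProductSpace ℝ E] [FiniteDimensional ℝ E] [CompleteSpace E]
    {A : X → E →L[ℝ] E} {n : X → E}
    {S : Set X} (hA : ContDiffOn ℝ ∞ A S) (hn : ContDiffOn ℝ ∞ n S) :
    ContDiffOn ℝ ∞ (fun x => adjoint (A x) (n x)) S := by
  let b := stdOrthonormalBasis ℝ E
  have h : ∀ x, adjoint (A x) (n x) = ∑ i, ⟪A x (b i), n x⟫ • b i := by
    intro x
    rw [← b.sum_repr (adjoint (A x) (n x))]
    simp [b.repr_apply_apply, adjoint_inner_right]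
  simp_rw [h]
  refine ContDiffOn.sum fun i _ => ContDiffOn.smul ?_ contDiffOn_const
  exact (hA.clm_apply contDiffOn_const).inner ℝ hn

/-- A product rule for `A x (w x)` at a zero of `w`, where `A` need only be continuous. -/
theorem ContinuousAt.hasFDerivAt_clm_apply {X E F : Type*} [NormedAddCommGroup X]
    [NormedSpace ℝ X] [NormedAddCommGroup E] [NormedSpace ℝ E] [NormedAddCommGroup F]
    [NormedSpace ℝ F] {A : X → E →L[ℝ] F} {w : X → E} {w' : X →L[ℝ] E} {x₀ : X}
    (hA : ContinuousAt A x₀) (hw : HasFDerivAt w w' x₀) (h0 : w x₀ = 0) :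
    HasFDerivAt (fun x => A x (w x)) ((A x₀).comp w') x₀ := by
  have h1 : HasFDerivAt (fun x => A x₀ (w x)) ((A x₀).comp w') x₀ :=
    (A x₀).hasFDerivAt.comp x₀ hw
  have h2 : (fun x => (A x - A x₀) (w x)) =o[𝓝 x₀] fun x => x - x₀ := by
    have hw1 : w =O[𝓝 x₀] fun x => x - x₀ := by
      simpa [h0] using hw.isBigO_sub
    have hA1 : (fun x => ‖A x - A x₀‖) =o[𝓝 x₀] fun _ => (1 : ℝ) := by
      rw [Asymptotics.isLittleO_one_iff]
      simpa [ContinuousAt] using (hA.sub (continuousAt_const (y := A x₀))).norm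
    have h3 : (fun x => ‖A x - A x₀‖ * ‖w x‖) =o[𝓝 x₀] fun x => 1 * ‖x - x₀‖ :=
      hA1.mul_isBigO hw1.norm_norm
    refine Asymptotics.IsBigO.trans_isLittleO (g := fun x => ‖A x - A x₀‖ * ‖w x‖) ?_ ?_
    · refine Asymptotics.IsBigO.of_bound 1 (Filter.Eventually.of_forall fun x => ?_)
      rw [one_mul, Real.norm_of_nonneg (by positivity)]
      exact (A x - A x₀).le_opNorm _
    · simpa using h3
  have h3 : HasFDerivAt (fun x => (A x - A x₀) (w x)) (0 : X →L[ℝ] F) x₀ := by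
    rw [hasFDerivAt_iff_isLittleO]
    simpa [h0] using h2
  have h4 := h1.add h3
  rw [add_zero] at h4
  exact h4.congr_of_eventuallyEq (Filter.Eventually.of_forall fun x => by simp)

theorem normalBundle_add_smul {W : Set (Euc m)} {x v w : Euc m} (hv : (x, v) ∈ normalBundle W)
    (hw : (x, w) ∈ normalBundle W) (a : ℝ) : (x, v + a • w) ∈ normalBundle W := by
  refine ⟨hv.1, fun u hu => ?_⟩
  simp [inner_add_right, inner_smul_right, hv.2 u hu, hw.2 u hu]

theorem zero_mem_normalBundle {W : Set (Euc m)} {x : Euc m} (hx : x ∈ W) :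
    (x, (0 : Euc m)) ∈ normalBundle W := ⟨hx, fun u _ => by simp⟩

/-- The linear coordinates on the normal bundle induced by a slice chart: the tangential part is
the chart, and the normal part is the adjoint differential of the inverse of the chart. -/
def normalCoord (e : OpenPartialHomeomorph (Euc m) (Euc m)) (q : Euc m × Euc m) : Euc m :=
  e q.1 + ContinuousLinearMap.adjoint (fderiv ℝ e.symm (e q.1)) q.2

/-- The parametrisation of the normal bundle that is inverse to `normalCoord`. -/
def normalParam (e : OpenPartialHomeomorph (Euc m) (Euc m)) (L : Submodule ℝ (Euc m))
    (z : Euc m) : Euc m × Euc m :=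
  (e.symm (L.starProjection z),
    ContinuousLinearMap.adjoint (fderiv ℝ e (e.symm (L.starProjection z))) (Lᗮ.starProjection z))

variable {W : Set (Euc m)} {e : OpenPartialHomeomorph (Euc m) (Euc m)} {L : Submodule ℝ (Euc m)}

theorem IsLocalDiffeo.contDiffOn_fderiv (he : IsLocalDiffeo e) :
    ContDiffOn ℝ ∞ (fderiv ℝ e) e.source :=
  he.smooth.fderiv_of_isOpen e.open_source (by simp)

theorem IsLocalDiffeo.contDiffOn_normalCoord (he : IsLocalDiffeo e) :
    ContDiffOn ℝ ∞ (normalCoord e) (e.source ×ˢ Set.univ) := by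
  have h1 : ContDiffOn ℝ ∞ (fun q : Euc m × Euc m => e q.1) (e.source ×ˢ Set.univ) :=
    he.smooth.comp contDiff_fst.contDiffOn fun q hq => hq.1
  refine h1.add (ContDiffOn.adjoint_apply ?_ contDiff_snd.contDiffOn)
  exact he.symm.contDiffOn_fderiv.comp h1 fun q hq => e.map_source hq.1

theorem IsLocalDiffeo.contDiffOn_normalParam (he : IsLocalDiffeo e) (L : Submodule ℝ (Euc m)) :
    ContDiffOn ℝ ∞ (normalParam e L) (L.starProjection ⁻¹' e.target) := by
  have h1 : ContDiffOn ℝ ∞ (fun z : Euc m => e.symm (L.starProjection z))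
      (L.starProjection ⁻¹' e.target) :=
    he.smooth_symm.comp (L.starProjection.contDiff.contDiffOn) fun q hq => hq
  refine h1.prodMk (ContDiffOn.adjoint_apply ?_ (Lᗮ.starProjection.contDiff.contDiffOn))
  exact he.contDiffOn_fderiv.comp h1 fun q hq => e.map_target hq

open ContinuousLinearMap in
theorem IsLocalDiffeo.adjoint_adjoint_symm (he : IsLocalDiffeo e) {x : Euc m} (hx : x ∈ e.source)
    (v : Euc m) : adjoint (fderiv ℝ e x) (adjoint (fderiv ℝ e.symm (e x)) v) = v := by
  refine ext_inner_right ℝ fun w => ?_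
  rw [adjoint_inner_left, adjoint_inner_left, he.fderiv_symm_fderiv hx]

open ContinuousLinearMap in
theorem IsLocalDiffeo.adjoint_symm_adjoint (he : IsLocalDiffeo e) {x : Euc m} (hx : x ∈ e.source)
    (v : Euc m) : adjoint (fderiv ℝ e.symm (e x)) (adjoint (fderiv ℝ e x) v) = v := by
  refine ext_inner_right ℝ fun w => ?_
  rw [adjoint_inner_left, adjoint_inner_left, he.fderiv_fderiv_symm hx]

theorem starProjection_add_of_mem {l n : Euc m} (hl : l ∈ L) (hn : n ∈ Lᗮ) :
    L.starProjection (l + n) = l ∧ Lᗮ.starProjection (l + n) = n := by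
  have hl' : l ∈ Lᗮᗮ := by simpa using hl
  rw [map_add, map_add, Submodule.starProjection_eq_self_iff.2 hl,
    Submodule.starProjection_eq_self_iff.2 hn,
    (Submodule.starProjection_apply_eq_zero_iff L).2 hn,
    (Submodule.starProjection_apply_eq_zero_iff Lᗮ).2 hl']
  simp

namespace IsSliceChart

variable (he : IsSliceChart W e L)
include he

/-- The tangent space is the image of `L` under the differential of `e.symm`; moving that
differential to the other side of the inner product turns orthogonality to it into orthogonality to
`L`. -/
theorem mem_normalBundle_iff {x v : Euc m} (hx : x ∈ e.source) :
    (x, v) ∈ normalBundle W ↔ x ∈ W ∧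
      ContinuousLinearMap.adjoint (fderiv ℝ e.symm (e x)) v ∈ Lᗮ := by
  refine and_congr_right fun hxW => ?_
  change (∀ w : Euc m, w ∈ tangentVectors 𝓘(ℝ, Euc m) W x → ⟪w, v⟫ = 0) ↔ _
  rw [Submodule.mem_orthogonal]
  constructor
  · intro h u hu
    rw [ContinuousLinearMap.adjoint_inner_right]
    refine h _ ?_
    rw [he.mem_tangentVectors hxW hx, he.fderiv_fderiv_symm hx]
    exact hu
  · intro h w hw
    have := h _ ((he.mem_tangentVectors hxW hx).1 hw)
    rwa [ContinuousLinearMap.adjoint_inner_right, he.fderiv_symm_fderiv hx] at this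

theorem projections_normalCoord {q : Euc m × Euc m} (hq : q ∈ normalBundle W)
    (hx : q.1 ∈ e.source) : L.starProjection (normalCoord e q) = e q.1 ∧
      Lᗮ.starProjection (normalCoord e q) =
        ContinuousLinearMap.adjoint (fderiv ℝ e.symm (e q.1)) q.2 :=
  starProjection_add_of_mem ((he.mem_iff _ hx).1 hq.1) ((he.mem_normalBundle_iff hx).1 hq).2

theorem normalParam_normalCoord {q : Euc m × Euc m} (hq : q ∈ normalBundle W)
    (hx : q.1 ∈ e.source) : normalParam e L (normalCoord e q) = q := by
  obtain ⟨h1, h2⟩ := he.projections_normalCoord hq hx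
  rw [normalParam, h1, h2, e.left_inv hx, he.adjoint_adjoint_symm hx]

theorem normalParam_mem {z : Euc m} (hz : L.starProjection z ∈ e.target) :
    normalParam e L z ∈ normalBundle W := by
  refine (he.mem_normalBundle_iff (e.map_target hz)).2 ⟨?_, ?_⟩
  · rw [he.mem_iff _ (e.map_target hz), e.right_inv hz]
    exact Submodule.starProjection_apply_mem _ _
  · rw [he.adjoint_symm_adjoint (e.map_target hz)]
    exact Submodule.starProjection_apply_mem _ _

theorem normalCoord_normalParam {z : Euc m} (hz : L.starProjection z ∈ e.target) :
    normalCoord e (normalParam e L z) = z := by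
  rw [normalCoord, normalParam, he.adjoint_symm_adjoint (e.map_target hz), e.right_inv hz]
  exact Submodule.starProjection_add_starProjection_orthogonal _

/-- The map `(x, v) ↦ x + v`, read in the coordinates `normalCoord`, is a local diffeomorphism
along the zero section. -/
theorem exists_localDiffeo_add {x₀ : Euc m} (hx₀ : x₀ ∈ W) (hx : x₀ ∈ e.source) :
    ∃ φ : OpenPartialHomeomorph (Euc m) (Euc m), IsLocalDiffeo φ ∧ e x₀ ∈ φ.source ∧
      φ.source ⊆ L.starProjection ⁻¹' e.target ∧
      (φ : Euc m → Euc m) = fun z => (normalParam e L z).1 + (normalParam e L z).2 := by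
  have hP : L.starProjection (e x₀) = e x₀ :=
    Submodule.starProjection_eq_self_iff.2 ((he.mem_iff _ hx).1 hx₀)
  have hQ : Lᗮ.starProjection (e x₀) = 0 := by
    rw [Submodule.starProjection_apply_eq_zero_iff]
    simpa using (he.mem_iff _ hx).1 hx₀
  have hS : IsOpen (L.starProjection ⁻¹' e.target) :=
    e.open_target.preimage L.starProjection.continuous
  have hp := he.contDiffOn_normalParam L
  have hmem : e x₀ ∈ L.starProjection ⁻¹' e.target := by
    simpa [hP] using e.map_source hx
  refine exists_localDiffeo_of_injective hS (hp.fst.add hp.snd) hmem fun v hv => ?_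
  have h1 : HasFDerivAt (fun z => (normalParam e L z).1)
      ((fderiv ℝ e.symm (e x₀)).comp L.starProjection) (e x₀) := by
    refine HasFDerivAt.comp (e x₀) (g := e.symm) ?_ L.starProjection.hasFDerivAt
    rw [hP]
    exact (he.differentiableAt_symm (e.map_source hx)).hasFDerivAt
  have h2 : HasFDerivAt (fun z => (normalParam e L z).2)
      ((ContinuousLinearMap.adjoint (fderiv ℝ e x₀)).comp Lᗮ.starProjection) (e x₀) := by
    have hsymm : ContinuousAt (fun z => e.symm (L.starProjection z)) (e x₀) := h1.continuousAt
    have hd : ContinuousAt (fun z => ContinuousLinearMap.adjoint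
        (fderiv ℝ e (e.symm (L.starProjection z)))) (e x₀) := by
      refine (ContinuousLinearMap.adjoint (𝕜 := ℝ) (E := Euc m) (F := Euc m)
        |>.continuous.continuousAt).comp
        (ContinuousAt.comp (g := fderiv ℝ e) ?_ hsymm)
      rw [hP, e.left_inv hx]
      exact he.contDiffOn_fderiv.continuousOn.continuousAt (e.open_source.mem_nhds hx)
    have := hd.hasFDerivAt_clm_apply Lᗮ.starProjection.hasFDerivAt hQ
    rwa [hP, e.left_inv hx] at this
  have h3 := h1.add h2
  have h4 : fderiv ℝ e.symm (e x₀) (L.starProjection v) +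
      ContinuousLinearMap.adjoint (fderiv ℝ e x₀) (Lᗮ.starProjection v) = 0 := by
    rw [← hv]
    exact (DFunLike.congr_fun h3.fderiv v).symm
  -- The differential along the zero section adds a tangent and a normal vector. These are
  -- orthogonal, so a vanishing sum forces both to vanish.
  have h5 : ⟪fderiv ℝ e.symm (e x₀) (L.starProjection v),
      ContinuousLinearMap.adjoint (fderiv ℝ e x₀) (Lᗮ.starProjection v)⟫ = 0 := by
    rw [ContinuousLinearMap.adjoint_inner_right, he.fderiv_fderiv_symm hx]
    exact Submodule.inner_right_of_mem_orthogonal (Submodule.starProjection_apply_mem _ _)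
      (Submodule.starProjection_apply_mem _ _)
  set a := fderiv ℝ e.symm (e x₀) (L.starProjection v) with ha
  set b := ContinuousLinearMap.adjoint (fderiv ℝ e x₀) (Lᗮ.starProjection v) with hb
  have hab : b = -a := by rw [eq_neg_iff_add_eq_zero, add_comm, h4]
  have ha0 : a = 0 := by
    rw [hab, inner_neg_right, neg_eq_zero, inner_self_eq_zero] at h5
    exact h5
  have hb0 : b = 0 := by rw [hab, ha0, neg_zero]
  have hPv : L.starProjection v = 0 := by
    rw [← he.fderiv_fderiv_symm hx (L.starProjection v), ← ha, ha0, map_zero]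
  have hQv : Lᗮ.starProjection v = 0 := by
    rw [← he.adjoint_symm_adjoint hx (Lᗮ.starProjection v), ← hb, hb0, map_zero]
  rw [← L.starProjection_add_starProjection_orthogonal v, hPv, hQv, add_zero]

/-- The quantification over all open `O` in the box allows the box to be shrunk later without
changing the inverse `g`. -/
theorem exists_local_tubular {x₀ : Euc m} (hx₀ : x₀ ∈ W) (hx : x₀ ∈ e.source) :
    ∃ r > 0, ∃ g : Euc m → Euc m × Euc m,
      (∀ q ∈ normalBundle W ∩ Metric.ball x₀ r ×ˢ Metric.ball 0 r, g (q.1 + q.2) = q) ∧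
      ∀ O ⊆ Metric.ball x₀ r ×ˢ Metric.ball 0 r, IsOpen O →
        IsOpen ((fun q : Euc m × Euc m => q.1 + q.2) '' (normalBundle W ∩ O)) ∧
        ContDiffOn ℝ ∞ g ((fun q : Euc m × Euc m => q.1 + q.2) '' (normalBundle W ∩ O)) := by
  obtain ⟨φ, hφ, h0, hsub, hcoe⟩ := he.exists_localDiffeo_add hx₀ hx
  have hcont := he.contDiffOn_normalCoord.continuousOn
  have hopen : IsOpen ((e.source ×ˢ Set.univ) ∩ normalCoord e ⁻¹' φ.source) :=
    hcont.isOpen_inter_preimage (e.open_source.prod isOpen_univ) φ.open_source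
  have hmem : (x₀, (0 : Euc m)) ∈ (e.source ×ˢ Set.univ) ∩ normalCoord e ⁻¹' φ.source := by
    refine ⟨⟨hx, trivial⟩, ?_⟩
    simpa [normalCoord] using h0
  obtain ⟨r, hr, hball⟩ := Metric.isOpen_iff.1 hopen _ hmem
  rw [← ball_prod_same] at hball
  have key : ∀ q ∈ normalBundle W ∩ Metric.ball x₀ r ×ˢ Metric.ball 0 r,
      φ (normalCoord e q) = q.1 + q.2 := by
    intro q hq
    rw [hcoe]
    simp only [he.normalParam_normalCoord hq.1 (hball hq.2).1.1]
  refine ⟨r, hr, normalParam e L ∘ φ.symm, fun q hq => ?_, fun O hO hOo => ?_⟩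
  · rw [← key q hq, Function.comp, φ.left_inv (hball hq.2).2,
      he.normalParam_normalCoord hq.1 (hball hq.2).1.1]
  · have himage : (fun q : Euc m × Euc m => q.1 + q.2) '' (normalBundle W ∩ O) =
        φ '' (φ.source ∩ normalParam e L ⁻¹' O) := by
      apply Set.Subset.antisymm
      · rintro _ ⟨q, hq, rfl⟩
        have hqB := hball (hO hq.2)
        refine ⟨normalCoord e q, ⟨hqB.2, ?_⟩, key q ⟨hq.1, hO hq.2⟩⟩
        rw [Set.mem_preimage, he.normalParam_normalCoord hq.1 hqB.1.1]
        exact hq.2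
      · rintro _ ⟨z, hz, rfl⟩
        exact ⟨normalParam e L z, ⟨he.normalParam_mem (hsub hz.1), hz.2⟩, by rw [hcoe]⟩
    have hcp : ContDiffOn ℝ ∞ (normalParam e L) φ.source :=
      (he.contDiffOn_normalParam L).mono hsub
    rw [himage]
    refine ⟨φ.isOpen_image_of_subset_source
      (hcp.continuousOn.isOpen_inter_preimage φ.open_source hOo) Set.inter_subset_left, ?_⟩
    refine hcp.comp (hφ.smooth_symm.mono ?_) ?_
    · rintro _ ⟨z, hz, rfl⟩
      exact φ.map_source hz.1
    · rintro _ ⟨z, hz, rfl⟩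
      exact φ.map_target (φ.map_source hz.1)

end IsSliceChart

/-- Every submanifold of Euclidean space has a tubular neighbourhood. -/
theorem exists_isTubularNeighbourhood {d : ℕ} {W : Set (Euc m)}
    (hW : IsSmoothSubmanifold 𝓘(ℝ, Euc m) d W) : ∃ N, IsTubularNeighbourhood W N := by
  rw [isSmoothSubmanifold_iff_slice] at hW
  have hloc : ∀ x : W, ∃ r > 0, ∃ g : Euc m → Euc m × Euc m,
      (∀ q ∈ normalBundle W ∩ Metric.ball x.1 r ×ˢ Metric.ball 0 r, g (q.1 + q.2) = q) ∧
      ∀ O ⊆ Metric.ball x.1 r ×ˢ Metric.ball 0 r, IsOpen O →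
        IsOpen ((fun q : Euc m × Euc m => q.1 + q.2) '' (normalBundle W ∩ O)) ∧
        ContDiffOn ℝ ∞ g ((fun q : Euc m × Euc m => q.1 + q.2) '' (normalBundle W ∩ O)) := by
    intro x
    obtain ⟨e, L, he, hx, -⟩ := hW x.1 x.2
    exact he.exists_local_tubular x.2 hx
  choose r hr g hg hO using hloc
  -- A quarter of the radius: if points of `B x` and `B x'` have the same sum and `r x' ≤ r x`, the
  -- second base point is within `3/4 * r x` of `x`. Both points then lie in the full box at `x`,
  -- where `g` inverts addition.
  set B : W → Set (Euc m × Euc m) := fun x =>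
    Metric.ball x.1 (r x / 4) ×ˢ Metric.ball 0 (r x / 4) with hB
  have hBsub : ∀ x, B x ⊆ Metric.ball x.1 (r x) ×ˢ Metric.ball 0 (r x) := fun x =>
    Set.prod_mono (Metric.ball_subset_ball (by linarith [hr x]))
      (Metric.ball_subset_ball (by linarith [hr x]))
  have hBo : ∀ x, IsOpen (B x) := fun x => Metric.isOpen_ball.prod Metric.isOpen_ball
  set E : Euc m × Euc m → Euc m := fun q => q.1 + q.2 with hE
  have hinj' : ∀ x x' : W, r x' ≤ r x → ∀ q ∈ normalBundle W ∩ B x, ∀ q' ∈ normalBundle W ∩ B x',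
      E q = E q' → q = q' := by
    intro x x' hle q hq q' hq' hqq
    have h1 : q' ∈ Metric.ball x.1 (r x) ×ˢ Metric.ball (0 : Euc m) (r x) := by
      obtain ⟨⟨-, h2, h3⟩, -, h4, h5⟩ := hq, hq'
      simp only [Metric.mem_ball, dist_zero_right] at h2 h3 h4 h5
      refine ⟨?_, ?_⟩
      · have h6 : q'.1 - x.1 = (q.1 - x.1) + q.2 - q'.2 := by
          have : q'.1 = q.1 + q.2 - q'.2 := by
            rw [eq_sub_iff_add_eq]; exact hqq.symm
          rw [this]; abel
        rw [Metric.mem_ball, dist_eq_norm, h6]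
        rw [dist_eq_norm] at h2
        have := norm_sub_le ((q.1 - x.1) + q.2) q'.2
        have := norm_add_le (q.1 - x.1) q.2
        linarith [hr x]
      · simp only [Metric.mem_ball, dist_zero_right]
        linarith [hr x]
    rw [← hg x q ⟨hq.1, hBsub x hq.2⟩, ← hg x q' ⟨hq'.1, h1⟩]
    exact congrArg (g x) hqq
  have hinj : Set.InjOn E (normalBundle W ∩ ⋃ x, B x) := by
    rintro q ⟨hq, hqB⟩ q' ⟨hq', hqB'⟩ hqq
    obtain ⟨x, hx⟩ := Set.mem_iUnion.1 hqB
    obtain ⟨x', hx'⟩ := Set.mem_iUnion.1 hqB'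
    rcases le_total (r x') (r x) with h | h
    · exact hinj' x x' h q ⟨hq, hx⟩ q' ⟨hq', hx'⟩ hqq
    · exact (hinj' x' x h q' ⟨hq', hx'⟩ q ⟨hq, hx⟩ hqq.symm).symm
  have hunion : E '' (normalBundle W ∩ ⋃ x, B x) = ⋃ x, E '' (normalBundle W ∩ B x) := by
    rw [Set.inter_iUnion, Set.image_iUnion]
  refine ⟨normalBundle W ∩ ⋃ x, B x, ⟨⟨_, isOpen_iUnion hBo, rfl⟩, ?_, ?_, ?_⟩⟩
  · intro x hx
    refine ⟨zero_mem_normalBundle hx, Set.mem_iUnion.2 ⟨⟨x, hx⟩, ?_, ?_⟩⟩ <;>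
      simpa using hr _
  · rw [hunion]
    exact isOpen_iUnion fun x => (hO x _ (hBsub x) (hBo x)).1
  · refine ⟨Function.invFunOn E (normalBundle W ∩ ⋃ x, B x), ?_, fun q hq =>
      hinj.leftInvOn_invFunOn hq⟩
    -- Locally the global inverse is one of the given maps `g x`, by injectivity, and is therefore
    -- smooth.
    rw [hunion]
    intro y hy
    obtain ⟨x, hx⟩ := Set.mem_iUnion.1 hy
    have hop := (hO x _ (hBsub x) (hBo x)).1
    refine ContDiffAt.contDiffWithinAt ?_
    refine ContDiffAt.congr_of_eventuallyEq
      ((hO x _ (hBsub x) (hBo x)).2.contDiffAt (hop.mem_nhds hx)) ?_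
    filter_upwards [hop.mem_nhds hx] with z hz
    obtain ⟨q, hq, rfl⟩ := hz
    rw [hg x q ⟨hq.1, hBsub x hq.2⟩]
    exact hinj.leftInvOn_invFunOn ⟨hq.1, Set.mem_iUnion.2 ⟨x, hq.2⟩⟩

end Tubular

end

noncomputable section

/-! ### The retraction of a tubular neighbourhood -/

section Retraction

variable {m : ℕ}

/-- `π` is the bundle projection of the tubular neighbourhood `N`, transported to the open subset
`Ω` of Euclidean space that is the image of `N`. -/
structure IsTubularRetraction (W : Set (Euc m)) (N : Set (Euc m × Euc m)) (Ω : Set (Euc m))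
    (π : Euc m → Euc m) : Prop where
  isOpen : IsOpen Ω
  smooth : ContDiffOn ℝ ∞ π Ω
  mem : ∀ y ∈ Ω, (π y, y - π y) ∈ N
  add_mem : ∀ x v, (x, v) ∈ N → x + v ∈ Ω ∧ π (x + v) = x
  subset_normalBundle : N ⊆ normalBundle W
  zero_mem : ∀ x ∈ W, (x, (0 : Euc m)) ∈ N

theorem IsTubularNeighbourhood.exists_retraction {W : Set (Euc m)} {N : Set (Euc m × Euc m)}
    (hN : IsTubularNeighbourhood W N) : ∃ Ω π, IsTubularRetraction W N Ω π := by
  obtain ⟨g, hg, hgq⟩ := hN.smooth_inverse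
  obtain ⟨O, hO, hNO⟩ := hN.isOpen_in_normalBundle
  refine ⟨(fun q : Euc m × Euc m => q.1 + q.2) '' N, fun y => (g y).1, hN.isOpen_image, hg.fst,
    ?_, ?_, ?_, hN.zero_section⟩
  · rintro _ ⟨q, hq, rfl⟩
    simpa [hgq q hq] using hq
  · intro x v hq
    exact ⟨⟨_, hq, rfl⟩, by simp only [hgq (x, v) hq]⟩
  · rw [hNO]; exact Set.inter_subset_left

namespace IsTubularRetraction

variable {W : Set (Euc m)} {N : Set (Euc m × Euc m)} {Ω : Set (Euc m)} {π : Euc m → Euc m}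
  (hπ : IsTubularRetraction W N Ω π)
include hπ

theorem proj_mem {y : Euc m} (hy : y ∈ Ω) : π y ∈ W :=
  (hπ.subset_normalBundle (hπ.mem y hy)).1

theorem mapsTo : Set.MapsTo π Ω W := fun _ hy => hπ.proj_mem hy

theorem subset : W ⊆ Ω := fun x hx => by
  simpa using (hπ.add_mem x 0 (hπ.zero_mem x hx)).1

theorem proj_eq {x : Euc m} (hx : x ∈ W) : π x = x := by
  simpa using (hπ.add_mem x 0 (hπ.zero_mem x hx)).2

theorem contDiffOn_comp {F : Type*} [NormedAddCommGroup F] [NormedSpace ℝ F] {f : Euc m → F}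
    (hf : ContDiffOn ℝ ∞ f W) : ContDiffOn ℝ ∞ (fun y => f (π y)) Ω :=
  hf.comp hπ.smooth hπ.mapsTo

theorem contDiffOn_comp_prod {X F : Type*} [NormedAddCommGroup X] [NormedSpace ℝ X]
    [NormedAddCommGroup F] [NormedSpace ℝ F] {A : Set X} {σ : X × Euc m → F}
    (hσ : ContDiffOn ℝ ∞ σ (A ×ˢ W)) :
    ContDiffOn ℝ ∞ (fun q : X × Euc m => σ (q.1, π q.2)) (A ×ˢ Ω) := by
  refine hσ.comp (contDiff_fst.contDiffOn.prodMk
    (hπ.smooth.comp contDiff_snd.contDiffOn fun q hq => hq.2)) ?_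
  intro q hq
  exact ⟨hq.1, hπ.proj_mem hq.2⟩

end IsTubularRetraction

end Retraction

/-! ### Smooth families of submanifolds -/

section Fibered

variable {X : Type*} [NormedAddCommGroup X] [NormedSpace ℝ X] {m : ℕ}

/-- A chart of `X × ℝ^m` over `X` in which `Γ` becomes `X × L`. -/
structure IsFiberedChart (Γ : Set (X × Euc m))
    (Ψ : OpenPartialHomeomorph (X × Euc m) (X × Euc m)) (L : Submodule ℝ (Euc m)) : Prop
    extends IsLocalDiffeo Ψ where
  fst_eq : ∀ q ∈ Ψ.source, (Ψ q).1 = q.1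
  mem_iff : ∀ q ∈ Ψ.source, q ∈ Γ ↔ (Ψ q).2 ∈ L

/-- Near `q`, the set `Γ` is a smooth family of `d`-dimensional submanifolds of `ℝ^m`
parametrised by `X`. -/
def IsFiberedAt (d : ℕ) (Γ : Set (X × Euc m)) (q : X × Euc m) : Prop :=
  ∃ Ψ L, IsFiberedChart Γ Ψ L ∧ q ∈ Ψ.source ∧ Module.finrank ℝ L = d

theorem IsFiberedChart.symm_fst_eq {Γ : Set (X × Euc m)}
    {Ψ : OpenPartialHomeomorph (X × Euc m) (X × Euc m)} {L : Submodule ℝ (Euc m)}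
    (h : IsFiberedChart Γ Ψ L) {q : X × Euc m} (hq : q ∈ Ψ.target) : (Ψ.symm q).1 = q.1 := by
  rw [← h.fst_eq _ (Ψ.map_target hq), Ψ.right_inv hq]

/-- The restriction of a fibered chart to a fibre. -/
def fiberChart (Ψ : OpenPartialHomeomorph (X × Euc m) (X × Euc m))
    (h : ∀ q ∈ Ψ.source, (Ψ q).1 = q.1) (a : X) : OpenPartialHomeomorph (Euc m) (Euc m) where
  toFun y := (Ψ (a, y)).2
  invFun z := (Ψ.symm (a, z)).2
  source := {y | (a, y) ∈ Ψ.source}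
  target := {z | (a, z) ∈ Ψ.target}
  map_source' y hy := by
    have : (a, (Ψ (a, y)).2) = Ψ (a, y) := Prod.ext (h _ hy).symm rfl
    simp only [Set.mem_ofPred_eq, this]
    exact Ψ.map_source hy
  map_target' z hz := by
    have : (a, (Ψ.symm (a, z)).2) = Ψ.symm (a, z) := Prod.ext (by
      rw [← h _ (Ψ.map_target hz), Ψ.right_inv hz]) rfl
    simp only [Set.mem_ofPred_eq, this]
    exact Ψ.map_target hz
  left_inv' y hy := by
    have : (a, (Ψ (a, y)).2) = Ψ (a, y) := Prod.ext (h _ hy).symm rfl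
    rw [this, Ψ.left_inv hy]
  right_inv' z hz := by
    have : (a, (Ψ.symm (a, z)).2) = Ψ.symm (a, z) := Prod.ext (by
      rw [← h _ (Ψ.map_target hz), Ψ.right_inv hz]) rfl
    rw [this, Ψ.right_inv hz]
  open_source := Ψ.open_source.preimage (Continuous.prodMk_right a)
  open_target := Ψ.open_target.preimage (Continuous.prodMk_right a)
  continuousOn_toFun := continuous_snd.comp_continuousOn
    (Ψ.continuousOn.comp (Continuous.prodMk_right a).continuousOn fun _ h => h)
  continuousOn_invFun := continuous_snd.comp_continuousOn
    (Ψ.symm.continuousOn.comp (Continuous.prodMk_right a).continuousOn fun _ h => h)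

theorem IsFiberedChart.isSliceChart {Γ : Set (X × Euc m)}
    {Ψ : OpenPartialHomeomorph (X × Euc m) (X × Euc m)} {L : Submodule ℝ (Euc m)}
    (h : IsFiberedChart Γ Ψ L) (a : X) :
    IsSliceChart {y | (a, y) ∈ Γ} (fiberChart Ψ h.fst_eq a) L where
  smooth := (h.smooth.comp (contDiff_prodMk_right a).contDiffOn fun _ h => h).snd
  smooth_symm := (h.smooth_symm.comp (contDiff_prodMk_right a).contDiffOn fun _ h => h).snd
  mem_iff y hy := h.mem_iff (a, y) hy

theorem isSmoothSubmanifold_fiber {d : ℕ} {Γ : Set (X × Euc m)} {a : X}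
    (h : ∀ y, (a, y) ∈ Γ → IsFiberedAt d Γ (a, y)) :
    IsSmoothSubmanifold 𝓘(ℝ, Euc m) d {y | (a, y) ∈ Γ} := by
  rw [isSmoothSubmanifold_iff_slice]
  intro y hy
  obtain ⟨Ψ, L, hΨ, hq, hL⟩ := h y hy
  exact ⟨_, L, hΨ.isSliceChart a, hq, hL⟩

theorem IsFiberedAt.congr {d : ℕ} {Γ Γ' : Set (X × Euc m)} {q : X × Euc m}
    (h : IsFiberedAt d Γ q) (hΓ : ∀ᶠ q' in 𝓝 q, q' ∈ Γ' ↔ q' ∈ Γ) : IsFiberedAt d Γ' q := by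
  obtain ⟨Ψ, L, hΨ, hq, hL⟩ := h
  obtain ⟨S, hS, hSo, hqS⟩ := eventually_nhds_iff.1 hΓ
  refine ⟨Ψ.restrOpen S hSo, L, ⟨⟨?_, ?_⟩, ?_, ?_⟩, ⟨hq, hqS⟩, hL⟩
  · exact hΨ.smooth.mono Set.inter_subset_left
  · refine hΨ.smooth_symm.mono fun z hz => ?_
    have := (Ψ.restrOpen S hSo).map_target hz
    rw [← (Ψ.restrOpen S hSo).right_inv hz]
    exact Ψ.map_source this.1
  · exact fun q hq => hΨ.fst_eq q hq.1
  · intro q hq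
    rw [hS q hq.2]
    exact hΨ.mem_iff q hq.1

theorem IsFiberedAt.comp {d : ℕ} {Γ : Set (X × Euc m)}
    {Φ : OpenPartialHomeomorph (X × Euc m) (X × Euc m)} (hΦ : IsLocalDiffeo Φ)
    (hfst : ∀ q ∈ Φ.source, (Φ q).1 = q.1) {q : X × Euc m} (hq : q ∈ Φ.source)
    (h : IsFiberedAt d Γ (Φ q)) : IsFiberedAt d (Φ ⁻¹' Γ) q := by
  obtain ⟨Ψ, L, hΨ, hqΨ, hL⟩ := h
  refine ⟨Φ.trans Ψ, L, ⟨hΦ.trans hΨ.toIsLocalDiffeo, ?_, ?_⟩, ?_, hL⟩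
  · intro q hq
    rw [OpenPartialHomeomorph.trans_source] at hq
    exact (hΨ.fst_eq _ hq.2).trans (hfst _ hq.1)
  · intro q hq
    rw [OpenPartialHomeomorph.trans_source] at hq
    exact hΨ.mem_iff _ hq.2
  · rw [OpenPartialHomeomorph.trans_source]
    exact ⟨hq, hqΨ⟩

variable {W : Set (Euc m)} {N : Set (Euc m × Euc m)} {Ω : Set (Euc m)} {π : Euc m → Euc m}
  {e : OpenPartialHomeomorph (Euc m) (Euc m)} {L : Submodule ℝ (Euc m)} {A : Set X}
  {σ : X × Euc m → Euc m}

theorem IsSliceChart.normalCoord_mem_iff (he : IsSliceChart W e L) {q : Euc m × Euc m}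
    (hq : q ∈ normalBundle W) (hx : q.1 ∈ e.source) : normalCoord e q ∈ L ↔ q.2 = 0 := by
  have h1 : normalCoord e q ∈ L ↔ Lᗮ.starProjection (normalCoord e q) = 0 := by
    rw [Submodule.starProjection_apply_eq_zero_iff, Submodule.orthogonal_orthogonal]
  rw [h1, (he.projections_normalCoord hq hx).2]
  refine ⟨fun h => ?_, fun h => by rw [h, map_zero]⟩
  rw [← he.adjoint_adjoint_symm hx q.2, h, map_zero]

/-- The graph of a smooth family of sections of a tubular neighbourhood is a smooth family of
submanifolds. -/
theorem IsTubularRetraction.isFiberedAt_family {d : ℕ} (hπ : IsTubularRetraction W N Ω π)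
    (hN : IsTubularNeighbourhood W N) (hW : IsSmoothSubmanifold 𝓘(ℝ, Euc m) d W)
    (hA : IsOpen A) (hσ : ContDiffOn ℝ ∞ σ (A ×ˢ W))
    (hσN : ∀ a ∈ A, ∀ x ∈ W, (x, σ (a, x)) ∈ N) {q : X × Euc m}
    (hq : q ∈ {q : X × Euc m | q.1 ∈ A ∧ q.2 ∈ (fun x => x + σ (q.1, x)) '' W}) :
    IsFiberedAt d {q : X × Euc m | q.1 ∈ A ∧ q.2 ∈ (fun x => x + σ (q.1, x)) '' W} q := by
  obtain ⟨O, hO, hNO⟩ := hN.isOpen_in_normalBundle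
  obtain ⟨haA, x₀, hx₀, hq2⟩ := hq
  obtain ⟨e, L, he, hxe, hL⟩ := isSmoothSubmanifold_iff_slice.1 hW x₀ hx₀
  have hsmooth : ContDiffOn ℝ ∞ (fun q : X × Euc m => (q.1, normalCoord e
      (π q.2, q.2 - π q.2 - σ (q.1, π q.2)))) (A ×ˢ (Ω ∩ π ⁻¹' e.source)) := by
    refine contDiff_fst.contDiffOn.prodMk (he.contDiffOn_normalCoord.comp ?_ ?_)
    · have h1 : ContDiffOn ℝ ∞ (fun q : X × Euc m => π q.2) (A ×ˢ (Ω ∩ π ⁻¹' e.source)) :=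
        hπ.smooth.comp contDiff_snd.contDiffOn fun q hq => hq.2.1
      exact h1.prodMk ((contDiff_snd.contDiffOn.sub h1).sub
        ((hπ.contDiffOn_comp_prod hσ).mono (Set.prod_mono subset_rfl Set.inter_subset_left)))
    · intro q hq
      exact ⟨hq.2.2, trivial⟩
  set T : Set (X × Euc m) := A ×ˢ (L.starProjection ⁻¹' e.target) with hT
  have hTo : IsOpen T := hA.prod (e.open_target.preimage L.starProjection.continuous)
  have hparam : ContDiffOn ℝ ∞ (fun q : X × Euc m => normalParam e L q.2) T :=
    (he.contDiffOn_normalParam L).comp contDiff_snd.contDiffOn fun q hq => hq.2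
  have hσ' : ContDiffOn ℝ ∞ (fun q : X × Euc m => σ (q.1, (normalParam e L q.2).1)) T := by
    refine hσ.comp (contDiff_fst.contDiffOn.prodMk hparam.fst) ?_
    intro q hq
    exact ⟨hq.1, (he.normalParam_mem hq.2).1⟩
  have htarget : ContinuousOn (fun q : X × Euc m => ((normalParam e L q.2).1,
      (normalParam e L q.2).2 + σ (q.1, (normalParam e L q.2).1))) T :=
    (hparam.fst.prodMk (hparam.snd.add hσ')).continuousOn
  have hinvsmooth : ContDiffOn ℝ ∞ (fun q : X × Euc m => (q.1, (normalParam e L q.2).1 +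
      ((normalParam e L q.2).2 + σ (q.1, (normalParam e L q.2).1)))) T :=
    contDiff_fst.contDiffOn.prodMk (hparam.fst.add (hparam.snd.add hσ'))
  have hnormal : ∀ a ∈ A, ∀ y ∈ Ω, (π y, y - π y - σ (a, π y)) ∈ normalBundle W := by
    intro a ha y hy
    have := normalBundle_add_smul (hπ.subset_normalBundle (hπ.mem y hy))
      (hπ.subset_normalBundle (hσN a ha _ (hπ.proj_mem hy))) (-1)
    simpa [sub_eq_add_neg] using this
  have hmemN : ∀ q ∈ T ∩ (fun q : X × Euc m => ((normalParam e L q.2).1,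
      (normalParam e L q.2).2 + σ (q.1, (normalParam e L q.2).1))) ⁻¹' O,
      ((normalParam e L q.2).1,
        (normalParam e L q.2).2 + σ (q.1, (normalParam e L q.2).1)) ∈ N := by
    intro q hq
    rw [hNO]
    refine ⟨?_, hq.2⟩
    have h1 := he.normalParam_mem hq.1.2
    have h2 := normalBundle_add_smul h1 (hπ.subset_normalBundle (hσN q.1 hq.1.1 _ h1.1)) 1
    rwa [one_smul] at h2
  -- Subtracting `σ` from the normal component moves the graph to the zero section, which
  -- `normalCoord e` then flattens to `L`.
  let Ψ : OpenPartialHomeomorph (X × Euc m) (X × Euc m) :=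
    { toFun := fun q => (q.1, normalCoord e (π q.2, q.2 - π q.2 - σ (q.1, π q.2)))
      invFun := fun q => (q.1, (normalParam e L q.2).1 +
        ((normalParam e L q.2).2 + σ (q.1, (normalParam e L q.2).1)))
      source := A ×ˢ (Ω ∩ π ⁻¹' e.source)
      target := T ∩ (fun q : X × Euc m => ((normalParam e L q.2).1,
        (normalParam e L q.2).2 + σ (q.1, (normalParam e L q.2).1))) ⁻¹' O
      map_source' := by
        rintro ⟨a, y⟩ ⟨ha, hy, hye⟩
        have hn := hnormal a ha y hy
        refine ⟨⟨ha, ?_⟩, ?_⟩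
        · simp only [Set.mem_preimage]
          rw [(he.projections_normalCoord hn hye).1]
          exact e.map_source hye
        · simp only [Set.mem_preimage]
          rw [he.normalParam_normalCoord hn hye, sub_add_cancel]
          have := hπ.mem y hy
          rw [hNO] at this
          exact this.2
      map_target' := by
        rintro ⟨a, z⟩ hz
        have h1 := hπ.add_mem _ _ (hmemN _ hz)
        refine ⟨hz.1.1, h1.1, ?_⟩
        simp only [Set.mem_preimage]
        rw [h1.2]
        exact e.map_target hz.1.2
      left_inv' := by
        rintro ⟨a, y⟩ ⟨ha, hy, hye⟩
        simp only
        rw [he.normalParam_normalCoord (hnormal a ha y hy) hye]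
        simp
      right_inv' := by
        rintro ⟨a, z⟩ hz
        have h1 := hπ.add_mem _ _ (hmemN _ hz)
        simp only at h1 ⊢
        rw [h1.2, add_sub_cancel_left, add_sub_cancel_right, Prod.mk.eta,
          he.normalCoord_normalParam hz.1.2]
      open_source := hA.prod (hπ.smooth.continuousOn.isOpen_inter_preimage hπ.isOpen e.open_source)
      open_target := htarget.isOpen_inter_preimage hTo hO
      continuousOn_toFun := hsmooth.continuousOn
      continuousOn_invFun := hinvsmooth.continuousOn.mono Set.inter_subset_left }
  have hπy : ∀ a ∈ A, ∀ x ∈ W, x + σ (a, x) ∈ Ω ∧ π (x + σ (a, x)) = x := fun a ha x hx =>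
    hπ.add_mem x _ (hσN a ha x hx)
  refine ⟨Ψ, L, ⟨⟨hsmooth, hinvsmooth.mono Set.inter_subset_left⟩, fun _ _ => rfl, ?_⟩, ?_, hL⟩
  · rintro ⟨a, y⟩ ⟨ha, hy, hye⟩
    change (a ∈ A ∧ _) ↔ normalCoord e _ ∈ L
    rw [he.normalCoord_mem_iff (hnormal a ha y hy) hye]
    constructor
    · rintro ⟨-, x, hx, hxy⟩
      have hxy' : x + σ (a, x) = y := hxy
      subst hxy'
      simp only
      rw [(hπy a ha x hx).2]
      abel
    · intro h
      refine ⟨ha, π y, hπ.proj_mem hy, ?_⟩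
      simp only at h ⊢
      rw [sub_sub, sub_eq_zero] at h
      exact h.symm
  · refine ⟨haA, ?_⟩
    rw [← hq2]
    refine ⟨(hπy _ haA x₀ hx₀).1, ?_⟩
    rw [Set.mem_preimage, (hπy _ haA x₀ hx₀).2]
    exact hxe

/-- The image of a compactly supported section of a tubular neighbourhood is a closed
submanifold. -/
theorem isClosedSubmanifold_sectionImage {d : ℕ} (hN : IsTubularNeighbourhood W N)
    (hW : IsClosedSubmanifold d W) (s : NormalSection W)
    (hs : ∀ x ∈ W, (x, s.toFun x) ∈ N) : IsClosedSubmanifold d (sectionImage s) := by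
  obtain ⟨Ω, π, hπ⟩ := hN.exists_retraction
  have hcont : ContinuousOn (fun x => x + s.toFun x) W :=
    continuousOn_id.add s.smooth.continuousOn
  constructor
  · obtain ⟨C, hC⟩ : ∃ C, ∀ x ∈ W, ‖s.toFun x‖ ≤ C := by
      obtain ⟨C, hC⟩ := (s.compact_support.isCompact.inter_left hW.1).exists_bound_of_continuousOn
        (s.smooth.continuousOn.mono Set.inter_subset_left)
      refine ⟨max C 0, fun x hx => ?_⟩
      by_cases h : x ∈ tsupport s.toFun
      · exact (hC x ⟨hx, h⟩).trans (le_max_left _ _)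
      · rw [image_eq_zero_of_notMem_tsupport h]; simp
    refine isClosed_of_closure_subset fun y hy => ?_
    -- The section is bounded by `C`, so points of its image within distance `1` of `y` have base
    -- points in the ball of radius `R`. Closedness thus reduces to compactness.
    set R := ‖y‖ + 1 + C with hR
    have hcpt : IsClosed ((fun x => x + s.toFun x) '' (W ∩ Metric.closedBall 0 R)) :=
      (((isCompact_closedBall 0 R).inter_left hW.1).image_of_continuousOn
        (hcont.mono Set.inter_subset_left)).isClosed
    have hy' : y ∈ closure ((fun x => x + s.toFun x) '' (W ∩ Metric.closedBall 0 R)) := by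
      rw [mem_closure_iff_nhds] at hy ⊢
      intro V hV
      obtain ⟨_, ⟨hz, hzb⟩, x, hx, rfl⟩ :=
        hy (V ∩ Metric.ball y 1) (Filter.inter_mem hV (Metric.ball_mem_nhds _ one_pos))
      refine ⟨_, hz, x, ⟨hx, ?_⟩, rfl⟩
      rw [mem_closedBall_zero_iff]
      simp only [Metric.mem_ball, dist_eq_norm] at hzb
      have h1 : x = (x + s.toFun x - y) + y - s.toFun x := by abel
      rw [h1]
      have h2 := norm_sub_le ((x + s.toFun x - y) + y) (s.toFun x)
      have h3 := norm_add_le (x + s.toFun x - y) y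
      linarith [hC x hx]
    rw [hcpt.closure_eq] at hy'
    exact Set.image_mono Set.inter_subset_left hy'
  -- The section is regarded as a constant family over a dummy parameter space.
  · have h := isSmoothSubmanifold_fiber (X := ℝ) (d := d) (a := 0)
      (Γ := {q : ℝ × Euc m | q.1 ∈ Set.univ ∧ q.2 ∈ (fun x => x + s.toFun x) '' W})
      (fun y hy => hπ.isFiberedAt_family (σ := fun q => s.toFun q.2) hN hW.2 isOpen_univ
        (s.smooth.comp contDiff_snd.contDiffOn fun q hq => hq.2) (fun a _ => hs) hy)
    simpa [sectionImage] using! h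

end Fibered

end

noncomputable section

/-! ### Iterated derivatives along tangent fields -/

section FieldDerivatives

variable {m : ℕ} {W : Set (Euc m)} {N : Set (Euc m × Euc m)} {Ω : Set (Euc m)}
  {π : Euc m → Euc m}

/-- Derivatives within `W` need not be unique as linear maps. On a tangent vector, however, both
give the velocity of `f` along a curve in `W`. -/
theorem HasFDerivWithinAt.apply_unique_of_mem_tangentVectors {E F : Type*}
    [NormedAddCommGroup E] [NormedSpace ℝ E] [NormedAddCommGroup F] [NormedSpace ℝ F]
    {W : Set E} {f : E → F} {f₁ f₂ : E →L[ℝ] F} {x v : E}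
    (h₁ : HasFDerivWithinAt f f₁ W x) (h₂ : HasFDerivWithinAt f f₂ W x)
    (hv : v ∈ tangentVectors 𝓘(ℝ, E) W x) : f₁ v = f₂ v := by
  obtain ⟨γ, -, hγW, rfl, hγ⟩ := mem_tangentVectors_iff.1 hv
  have key : ∀ f' : E →L[ℝ] F, HasFDerivWithinAt f f' W (γ 0) →
      HasDerivAt (f ∘ γ) (f' v) 0 := by
    intro f' hf'
    have h : HasDerivWithinAt (f ∘ γ) (f' v) (γ ⁻¹' W) 0 :=
      hf'.comp_hasDerivWithinAt 0 hγ.hasDerivWithinAt (Set.mapsTo_preimage γ W)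
    exact h.hasDerivAt hγW
  exact (key _ h₁).unique (key _ h₂)

/-- Composition with `π` extends `f` to an open set, where derivatives are ordinary ones. -/
theorem IsTubularRetraction.fderivWithin_apply (hπ : IsTubularRetraction W N Ω π)
    {f : Euc m → Euc m} (hf : ContDiffOn ℝ ∞ f W) {x v : Euc m} (hx : x ∈ W)
    (hv : v ∈ tangentVectors 𝓘(ℝ, Euc m) W x) :
    fderivWithin ℝ f W x v = fderiv ℝ (fun y => f (π y)) x v := by
  have h1 : HasFDerivAt (fun y => f (π y)) (fderiv ℝ (fun y => f (π y)) x) x :=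
    (((hπ.contDiffOn_comp hf).contDiffAt (hπ.isOpen.mem_nhds (hπ.subset hx))).differentiableAt
      (by simp)).hasFDerivAt
  have h2 : HasFDerivWithinAt f (fderiv ℝ (fun y => f (π y)) x) W x :=
    h1.hasFDerivWithinAt.congr (fun y hy => by simp only [hπ.proj_eq hy])
      (by simp only [hπ.proj_eq hx])
  exact ((hf.differentiableOn (by simp) x hx).hasFDerivWithinAt).apply_unique_of_mem_tangentVectors
    h2 hv

theorem iteratedFieldDeriv_congr {U : Set (Euc m)} (hU : IsOpen U) {f g : Euc m → Euc m}
    (h : ∀ x ∈ W, x ∈ U → f x = g x) (Xs : List (Euc m → Euc m)) :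
    ∀ x ∈ W, x ∈ U → iteratedFieldDeriv W Xs f x = iteratedFieldDeriv W Xs g x := by
  induction Xs with
  | nil => exact h
  | cons X Xs ih =>
    intro x hx hxU
    change fderivWithin ℝ (iteratedFieldDeriv W Xs f) W x (X x) =
      fderivWithin ℝ (iteratedFieldDeriv W Xs g) W x (X x)
    rw [Filter.EventuallyEq.fderivWithin_eq _ (ih x hx hxU)]
    filter_upwards [self_mem_nhdsWithin, mem_nhdsWithin_of_mem_nhds (hU.mem_nhds hxU)] with y hy hyU
    exact ih y hy hyU

/-- Extended along `π`, one field derivative is a partial derivative on the open set `A ×ˢ Ω`, so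
joint smoothness in parameter and point survives each step of the induction. -/
theorem IsTubularRetraction.contDiffOn_iteratedFieldDeriv_family
    (hπ : IsTubularRetraction W N Ω π) {X : Type*} [NormedAddCommGroup X] [NormedSpace ℝ X]
    {A : Set X} (hA : IsOpen A) {h : X × Euc m → Euc m} (hh : ContDiffOn ℝ ∞ h (A ×ˢ W))
    {Xs : List (Euc m → Euc m)} (hXs : ∀ X ∈ Xs, IsTangentField W X) :
    ContDiffOn ℝ ∞ (fun q : X × Euc m => iteratedFieldDeriv W Xs (fun x => h (q.1, x)) q.2)
      (A ×ˢ W) := by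
  induction Xs with
  | nil => exact hh
  | cons Y Ys ih =>
    set k : X × Euc m → Euc m :=
      fun q => iteratedFieldDeriv W Ys (fun x => h (q.1, x)) q.2 with hk
    have hksm : ContDiffOn ℝ ∞ k (A ×ˢ W) := ih fun X hX => hXs X (List.mem_cons_of_mem _ hX)
    have hY : IsTangentField W Y := hXs Y List.mem_cons_self
    have hH := hπ.contDiffOn_comp_prod hksm
    have hopen : IsOpen (A ×ˢ Ω) := hA.prod hπ.isOpen
    set H : X × Euc m → Euc m := fun q => k (q.1, π q.2) with hHdef
    have hfd : ContDiffOn ℝ ∞ (fun q : X × Euc m => fderiv ℝ H q (0, Y q.2)) (A ×ˢ W) := by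
      refine ((hH.fderiv_of_isOpen hopen (m := ∞) (by simp)).mono
        (Set.prod_mono subset_rfl hπ.subset)).clm_apply (contDiffOn_const.prodMk ?_)
      exact hY.1.comp contDiff_snd.contDiffOn fun q hq => hq.2
    refine hfd.congr ?_
    rintro ⟨a, x⟩ ⟨ha, hx⟩
    have hka : ContDiffOn ℝ ∞ (fun y => k (a, y)) W :=
      hksm.comp (contDiff_prodMk_right a).contDiffOn fun y hy => ⟨ha, hy⟩
    change fderivWithin ℝ (fun y => k (a, y)) W x (Y x) = fderiv ℝ H (a, x) (0, Y x)
    rw [hπ.fderivWithin_apply hka hx (hY.2 x hx)]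
    have h1 : HasFDerivAt H (fderiv ℝ H (a, x)) (a, x) :=
      ((hH.contDiffAt (hopen.mem_nhds ⟨ha, hπ.subset hx⟩)).differentiableAt (by simp)).hasFDerivAt
    have h2 : HasFDerivAt (fun y => H (a, y)) ((fderiv ℝ H (a, x)).comp
        (ContinuousLinearMap.inr ℝ X (Euc m))) x := h1.comp x (hasFDerivAt_prodMk_right a x)
    rw [show (fun y => k (a, π y)) = fun y => H (a, y) from rfl, h2.fderiv]
    simp

theorem IsTubularRetraction.contDiffOn_iteratedFieldDeriv
    (hπ : IsTubularRetraction W N Ω π) {h : Euc m → Euc m} (hh : ContDiffOn ℝ ∞ h W)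
    {Xs : List (Euc m → Euc m)} (hXs : ∀ X ∈ Xs, IsTangentField W X) :
    ContDiffOn ℝ ∞ (iteratedFieldDeriv W Xs h) W := by
  have h1 := hπ.contDiffOn_iteratedFieldDeriv_family (X := ℝ) isOpen_univ
    (h := fun q => h q.2) (hh.comp contDiff_snd.contDiffOn fun q hq => hq.2) hXs
  exact h1.comp (contDiff_prodMk_right (0 : ℝ)).contDiffOn fun y hy => ⟨trivial, hy⟩

/-- The tangential part of the constant vector field `v`. -/
theorem IsTubularRetraction.isTangentField_fderiv (hπ : IsTubularRetraction W N Ω π)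
    (v : Euc m) : IsTangentField W (fun x => fderiv ℝ π x v) := by
  refine ⟨((hπ.smooth.fderiv_of_isOpen hπ.isOpen (m := ∞) (by simp)).clm_apply
    contDiffOn_const).mono hπ.subset, fun x hx => ?_⟩
  have hat := hπ.smooth.contDiffAt (hπ.isOpen.mem_nhds (hπ.subset hx))
  have hc : ContDiffAt ℝ ∞ (fun t : ℝ => x + t • v) 0 := by fun_prop
  have hd : HasDerivAt (fun t : ℝ => x + t • v) v 0 := by
    simpa using ((hasDerivAt_id (0 : ℝ)).smul_const v).const_add x
  have hx0 : (fun t : ℝ => x + t • v) 0 = x := by simp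
  refine mem_tangentVectors_iff.2 ⟨fun t => π (x + t • v), ?_, ?_, ?_, ?_⟩
  · exact ContDiffAt.comp (g := π) 0 (by simpa using hat) hc
  · have : ∀ᶠ t : ℝ in 𝓝 0, x + t • v ∈ Ω :=
      hc.continuousAt.preimage_mem_nhds (by simpa using hπ.isOpen.mem_nhds (hπ.subset hx))
    filter_upwards [this] with t ht using hπ.proj_mem ht
  · simp [hπ.proj_eq hx]
  · have h1 : HasFDerivAt π (fderiv ℝ π x) ((fun t : ℝ => x + t • v) 0) := by
      rw [hx0]; exact (hat.differentiableAt (by simp)).hasFDerivAt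
    exact h1.comp_hasDerivAt 0 hd

/-- A smooth family of sections that is constant outside of a compact set is continuous in the
strong topology. -/
theorem IsTubularRetraction.eventually_mem_strong (hπ : IsTubularRetraction W N Ω π)
    (hW : IsClosed W) {X : Type*} [NormedAddCommGroup X] [NormedSpace ℝ X]
    {A : Set X} (hA : IsOpen A) {a₀ : X} (ha₀ : a₀ ∈ A) {σ : X × Euc m → Euc m}
    (hσ : ContDiffOn ℝ ∞ σ (A ×ˢ W)) (s₀ : NormalSection W)
    (h₀ : ∀ x ∈ W, σ (a₀, x) = s₀.toFun x) {C : Set (Euc m)} (hC : IsCompact C)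
    (hσC : ∀ a ∈ A, ∀ x ∈ W, x ∉ C → σ (a, x) = s₀.toFun x)
    {V : Set (NormalSection W)} (hV : IsOpen[strongTopology W] V) (hs₀ : s₀ ∈ V) :
    ∀ᶠ a in 𝓝 a₀, ∀ t : NormalSection W, (∀ x ∈ W, t.toFun x = σ (a, x)) → t ∈ V := by
  induction hV with
  | basic V hV =>
    obtain ⟨s, Xs, ε, hXs, hε, hpos, rfl⟩ := hV
    set h : X × Euc m → Euc m := fun q => σ q - s.toFun q.2 with hh
    have hhs : ContDiffOn ℝ ∞ h (A ×ˢ W) :=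
      hσ.sub (s.smooth.comp contDiff_snd.contDiffOn fun q hq => hq.2)
    have hD := (hπ.contDiffOn_iteratedFieldDeriv_family hA hhs hXs).continuousOn
    have hloc : ∀ U, IsOpen U → ∀ a, ∀ t : NormalSection W,
        (∀ x ∈ W, x ∈ U → t.toFun x = σ (a, x)) → ∀ x ∈ W, x ∈ U →
        iteratedFieldDeriv W Xs (fun y => t.toFun y - s.toFun y) x =
          iteratedFieldDeriv W Xs (fun y => h (a, y)) x := by
      intro U hU a t ht
      exact iteratedFieldDeriv_congr hU (fun x hx hxU => by rw [hh, ht x hx hxU]) Xs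
    have hev : ∀ᶠ a in 𝓝 a₀, ∀ x ∈ C, x ∈ W →
        ‖iteratedFieldDeriv W Xs (fun y => h (a, y)) x‖ < ε x := by
      refine hC.eventually_forall_of_forall_eventually fun x hx => ?_
      by_cases hxW : x ∈ W
      · have hlt : ‖iteratedFieldDeriv W Xs (fun y => h (a₀, y)) x‖ < ε x := by
          rw [← hloc Set.univ isOpen_univ a₀ s₀ (fun x hx _ => (h₀ x hx).symm) x hxW trivial]
          exact hs₀ x hxW
        have hc1 := (hD (a₀, x) ⟨ha₀, hxW⟩).norm
        have hc2 : ContinuousWithinAt (fun q : X × Euc m => ε q.2) (A ×ˢ W) (a₀, x) :=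
          (hε x hxW).comp continuous_snd.continuousWithinAt fun q hq => hq.2
        have h3 := (hc1.tendsto).eventually_lt hc2.tendsto hlt
        rw [eventually_nhdsWithin_iff] at h3
        filter_upwards [h3, (hA.preimage continuous_fst).mem_nhds (x := (a₀, x)) ha₀]
          with q hq hqA hqW
        exact hq ⟨hqA, hqW⟩
      · filter_upwards [(hW.isOpen_compl.preimage continuous_snd).mem_nhds (x := (a₀, x)) hxW]
          with q hq hqW
        exact absurd hqW hq
    filter_upwards [hev, hA.mem_nhds ha₀] with a ha haA t ht x hx
    by_cases hxC : x ∈ C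
    · rw [hloc Set.univ isOpen_univ a t (fun x hx _ => ht x hx) x hx trivial]
      exact ha x hxC hx
    -- On the open complement of `C` the sections agree with `s₀`, hence so do all their
    -- derivatives.
    · rw [iteratedFieldDeriv_congr (U := Cᶜ) (g := fun y => s₀.toFun y - s.toFun y)
        hC.isClosed.isOpen_compl ?_ Xs x hx hxC]
      · exact hs₀ x hx
      · intro y hy hyC
        rw [ht y hy, hσC a haA y hy hyC]
  | univ => exact Filter.Eventually.of_forall fun _ _ _ => trivial
  | inter V V' _ _ ih ih' =>
    filter_upwards [ih hs₀.1, ih' hs₀.2] with a h1 h2 t ht using ⟨h1 t ht, h2 t ht⟩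
  | sUnion S _ ih =>
    obtain ⟨V, hVS, hV⟩ := hs₀
    filter_upwards [ih V hVS hV] with a h1 t ht using ⟨V, hVS, h1 t ht⟩

end FieldDerivatives

end

noncomputable section

/-! ### Submersions straightened over the base -/

section LinearFibered

variable {X : Type*} [NormedAddCommGroup X] [NormedSpace ℝ X] [FiniteDimensional ℝ X] {m : ℕ}

/-- A linear map into a given subspace with a given kernel of complementary dimension. -/
theorem exists_clm_mem_and_ker {V F : Type*} [NormedAddCommGroup V] [NormedSpace ℝ V]
    [FiniteDimensional ℝ V] [NormedAddCommGroup F] [NormedSpace ℝ F] [FiniteDimensional ℝ F]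
    (L : Submodule ℝ V) (T : Submodule ℝ F)
    (h : Module.finrank ℝ V = Module.finrank ℝ L + Module.finrank ℝ T) :
    ∃ β : V →L[ℝ] F, (∀ w, β w ∈ T) ∧ ∀ w, β w = 0 ↔ w ∈ L := by
  have hquot := L.finrank_quotient_add_finrank
  let B : (V ⧸ L) ≃ₗ[ℝ] T := LinearEquiv.ofFinrankEq _ _ (by omega)
  refine ⟨LinearMap.toContinuousLinearMap (T.subtype ∘ₗ (B : _ →ₗ[ℝ] T) ∘ₗ L.mkQ),
    fun w => (B (L.mkQ w)).2, fun w => ?_⟩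
  change ((B (L.mkQ w) : T) : F) = 0 ↔ _
  simp

/-- A submanifold of `X × ℝ^m` that submerses onto `X` is a smooth family of submanifolds. -/
theorem IsSliceChart.isFiberedAt {d : ℕ} {Γ : Set (X × Euc m)}
    {e : OpenPartialHomeomorph (X × Euc m) (X × Euc m)} {L : Submodule ℝ (X × Euc m)}
    (he : IsSliceChart Γ e L) (hL : Module.finrank ℝ L = Module.finrank ℝ X + d)
    {q₀ : X × Euc m} (hq₀ : q₀ ∈ e.source)
    (hsub : ∀ b : X, ∃ v : X × Euc m, fderiv ℝ e q₀ v ∈ L ∧ v.1 = b) : IsFiberedAt d Γ q₀ := by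
  set A := fderiv ℝ e q₀ with hA
  -- The kernel `T` consists of the vertical vectors whose image under the differential of `e` lies
  -- in `L`. The hypothesis `hsub` makes `g` onto, which gives `T` dimension `d`.
  let g : Euc m →ₗ[ℝ] (X × Euc m) ⧸ L :=
    L.mkQ ∘ₗ (A : X × Euc m →ₗ[ℝ] X × Euc m) ∘ₗ LinearMap.inr ℝ X (Euc m)
  have hg : ∀ k, g k = 0 ↔ A (0, k) ∈ L := fun k => Submodule.Quotient.mk_eq_zero L
  have hgsurj : Function.Surjective g := by
    intro w
    obtain ⟨w, rfl⟩ := L.mkQ_surjective w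
    obtain ⟨v, hv, hv1⟩ := hsub (fderiv ℝ e.symm (e q₀) w).1
    refine ⟨(fderiv ℝ e.symm (e q₀) w - v).2, ?_⟩
    have h1 : ((0 : X), (fderiv ℝ e.symm (e q₀) w - v).2) = fderiv ℝ e.symm (e q₀) w - v :=
      Prod.ext (by simp [hv1]) rfl
    change L.mkQ (A ((0 : X), (fderiv ℝ e.symm (e q₀) w - v).2)) = _
    rw [h1, map_sub, he.fderiv_fderiv_symm hq₀, map_sub, sub_eq_self]
    simpa using hv
  set T : Submodule ℝ (Euc m) := LinearMap.ker g with hT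
  have hrank := LinearMap.finrank_range_add_finrank_ker g
  rw [LinearMap.range_eq_top.2 hgsurj, finrank_top] at hrank
  have hquot := L.finrank_quotient_add_finrank
  rw [Module.finrank_prod] at hquot
  have hTd : Module.finrank ℝ T = d := by rw [hT]; omega
  have hperp := T.finrank_add_finrank_orthogonal
  obtain ⟨β, hβmem, hβ0⟩ := exists_clm_mem_and_ker L Tᗮ (by rw [Module.finrank_prod]; omega)
  -- The map `β` takes values in `Tᗮ` and has kernel `L`. So the second component lies in `T`
  -- exactly on `Γ`, while the projection to `T` records the vertical tangential direction.
  set G : X × Euc m → X × Euc m := fun q => (q.1, T.starProjection q.2 + β (e q)) with hG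
  have hGs : ContDiffOn ℝ ∞ G e.source :=
    contDiff_fst.contDiffOn.prodMk
      ((T.starProjection.contDiff.comp contDiff_snd).contDiffOn.add
        (β.contDiff.comp_contDiffOn he.smooth))
  have hdecomp : ∀ k w, T.starProjection k + β w ∈ T ↔ w ∈ L := by
    intro k w
    rw [T.add_mem_iff_right (Submodule.starProjection_apply_mem _ _), ← hβ0]
    refine ⟨fun h => ?_, fun h => by rw [h]; exact T.zero_mem⟩
    have := Submodule.inner_right_of_mem_orthogonal h (hβmem w)
    simpa using this
  obtain ⟨Ψ, hΨ, hmem, hsubset, hcoe⟩ := exists_localDiffeo_of_injective e.open_source hGs hq₀ (by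
    rintro ⟨h, k⟩ hv
    have hd : HasFDerivAt G ((ContinuousLinearMap.fst ℝ X (Euc m)).prod
        (T.starProjection.comp (ContinuousLinearMap.snd ℝ X (Euc m)) + β.comp A)) q₀ :=
      hasFDerivAt_fst.prodMk ((T.starProjection.hasFDerivAt.comp q₀ hasFDerivAt_snd).add
        (β.hasFDerivAt.comp q₀ (he.differentiableAt hq₀).hasFDerivAt))
    rw [hd.fderiv] at hv
    have h1 : h = 0 := congrArg Prod.fst hv
    have h2 : T.starProjection k + β (A (h, k)) = 0 := congrArg Prod.snd hv
    subst h1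
    have h3 : A (0, k) ∈ L := (hdecomp k _).1 (by rw [h2]; exact T.zero_mem)
    have h4 : k ∈ T := (hg k).2 h3
    rw [(hβ0 _).2 h3, add_zero, Submodule.starProjection_eq_self_iff.2 h4] at h2
    rw [h2]; rfl)
  refine ⟨Ψ, T, ⟨hΨ, ?_, ?_⟩, hmem, hTd⟩
  · intro q _
    rw [hcoe]
  · intro q hq
    rw [he.mem_iff _ (hsubset hq), hcoe]
    exact (hdecomp _ _).symm

end LinearFibered

/-! ### Plots and smooth families of submanifolds -/

section Plots

variable {E F : Type*} [NormedAddCommGroup E] [NormedSpace ℝ E] [NormedAddCommGroup F]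
  [NormedSpace ℝ F]

/-- The product charted space on `E × F` coincides with its structure as a vector space only after
rewriting. The two variants that follow have `ModelProd` as target (for charts) and as source (for
their inverses). -/
theorem contMDiffOn_prod_iff_contDiffOn {f : E × F → E × F} {s : Set (E × F)} :
    ContMDiffOn (𝓘(ℝ, E).prod 𝓘(ℝ, F)) (𝓘(ℝ, E).prod 𝓘(ℝ, F)) ∞ f s ↔ ContDiffOn ℝ ∞ f s := by
  rw [← modelWithCornersSelf_prod, chartedSpaceSelf_prod]
  exact contMDiffOn_iff_contDiffOn

theorem contMDiffOn_modelProd_iff_contDiffOn {f : E × F → E × F} {s : Set (E × F)} :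
    ContMDiffOn (M' := ModelProd E F) (𝓘(ℝ, E).prod 𝓘(ℝ, F)) (𝓘(ℝ, E).prod 𝓘(ℝ, F)) ∞ f s ↔
      ContDiffOn ℝ ∞ f s := by
  rw [← contMDiffOn_prod_iff_contDiffOn, chartedSpaceSelf_prod]

theorem contMDiffOn_modelProd_iff_contDiffOn' {f : E × F → E × F} {s : Set (E × F)} :
    ContMDiffOn (M := ModelProd E F) (𝓘(ℝ, E).prod 𝓘(ℝ, F)) (𝓘(ℝ, E).prod 𝓘(ℝ, F)) ∞ f s ↔
      ContDiffOn ℝ ∞ f s := by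
  rw [← contMDiffOn_prod_iff_contDiffOn, chartedSpaceSelf_prod]

theorem tangentVectors_prod (S : Set (E × F)) (x : E × F) :
    (tangentVectors (𝓘(ℝ, E).prod 𝓘(ℝ, F)) S x : Set (E × F)) =
      tangentVectors 𝓘(ℝ, E × F) S x := by
  unfold tangentVectors
  rw [modelWithCornersSelf_prod, ← chartedSpaceSelf_prod]

theorem Submodule.finrank_top_prod [FiniteDimensional ℝ E] [FiniteDimensional ℝ F]
    (L : Submodule ℝ F) : Module.finrank ℝ ((⊤ : Submodule ℝ E).prod L) =
      Module.finrank ℝ E + Module.finrank ℝ L := by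
  have h := LinearMap.finrank_range_of_inj
    (f := (LinearMap.id : E →ₗ[ℝ] E).prodMap L.subtype)
    (Function.injective_id.prodMap Subtype.val_injective)
  rwa [LinearMap.range_prodMap, LinearMap.range_id, Submodule.range_subtype,
    Module.finrank_prod] at h

/-- A closed smooth family of submanifolds parametrised by a vector space is a plot. -/
theorem isPlot_of_isFiberedAt {d m n : ℕ} {p : Euc n → Psi d m} (hcl : IsClosed (plotGraph p))
    (hfib : ∀ q ∈ plotGraph p, IsFiberedAt d (plotGraph p) q) : IsPlot (n := n) p where
  isClosed_graph := hcl
  submanifold_graph := by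
    intro q hq
    obtain ⟨Ψ, L, hΨ, hqΨ, hL⟩ := hfib q hq
    refine ⟨Ψ, ?_, hqΨ, (⊤ : Submodule ℝ (Euc n)).prod L, ?_, ?_⟩
    · refine OpenPartialHomeomorph.mem_maximalAtlas_of_contMDiffOn (n := ∞)
        (H := ModelProd (Euc n) (Euc m)) _ ?_ ?_
      · exact contMDiffOn_modelProd_iff_contDiffOn.2 hΨ.smooth
      · exact contMDiffOn_modelProd_iff_contDiffOn'.2 hΨ.smooth_symm
    · rw [Submodule.finrank_top_prod, hL, finrank_euclideanSpace_fin]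
    · intro y hy
      rw [hΨ.mem_iff y hy]
      change (Ψ y).2 ∈ L ↔ (Ψ y).1 ∈ (⊤ : Submodule ℝ (Euc n)) ∧ (Ψ y).2 ∈ L
      simp
  submersion := by
    intro q hq b
    obtain ⟨Ψ, L, hΨ, hqΨ, hL⟩ := hfib q hq
    -- In a fibered chart the family is a product, so every direction of the base lifts to a
    -- horizontal line.
    let w : Euc n × Euc m := (b, 0)
    have hΨq : (Ψ q).2 ∈ L := (hΨ.mem_iff q hqΨ).1 hq
    set γ : ℝ → Euc n × Euc m := fun t => Ψ q + t • w with hγ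
    have hc : ContDiffAt ℝ ∞ γ 0 := by fun_prop
    have hd : HasDerivAt γ w 0 := by
      have := ((hasDerivAt_id (0 : ℝ)).smul_const w).const_add (Ψ q)
      rwa [one_smul] at this
    have hγ0 : γ 0 = Ψ q := by simp [hγ]
    have hs : ContDiffAt ℝ ∞ Ψ.symm (γ 0) := by
      rw [hγ0]; exact hΨ.contDiffAt_symm (Ψ.map_source hqΨ)
    have htar : ∀ᶠ t in 𝓝 (0 : ℝ), γ t ∈ Ψ.target := by
      apply hc.continuousAt.preimage_mem_nhds
      rw [hγ0]
      exact Ψ.open_target.mem_nhds (Ψ.map_source hqΨ)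
    have hdv : HasDerivAt (fun t => Ψ.symm (γ t)) (fderiv ℝ Ψ.symm (γ 0) w) 0 :=
      (hs.differentiableAt (by simp)).hasFDerivAt.comp_hasDerivAt 0 hd
    have hfst : (fderiv ℝ Ψ.symm (γ 0) w).1 = b := by
      have h1 : HasDerivAt (fun t => (Ψ.symm (γ t)).1) (fderiv ℝ Ψ.symm (γ 0) w).1 0 :=
        (ContinuousLinearMap.fst ℝ (Euc n) (Euc m)).hasFDerivAt.comp_hasDerivAt 0 hdv
      have h2 : HasDerivAt (fun t => (Ψ.symm (γ t)).1) b 0 := by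
        have h3 : HasDerivAt (fun t => (γ t).1) b 0 :=
          (ContinuousLinearMap.fst ℝ (Euc n) (Euc m)).hasFDerivAt.comp_hasDerivAt 0 hd
        refine h3.congr_of_eventuallyEq ?_
        filter_upwards [htar] with t ht using hΨ.symm_fst_eq ht
      exact h1.unique h2
    refine ⟨(fderiv ℝ Ψ.symm (γ 0) w : Euc n × Euc m), ?_, ?_⟩
    · have : fderiv ℝ Ψ.symm (γ 0) w ∈
          (tangentVectors 𝓘(ℝ, Euc n × Euc m) (plotGraph p) q : Set (Euc n × Euc m)) := ?_
      · rw [← tangentVectors_prod] at this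
        exact this
      refine mem_tangentVectors_iff.2 ⟨fun t => Ψ.symm (γ t), hs.comp 0 hc, ?_, ?_, hdv⟩
      · filter_upwards [htar] with t ht
        rw [hΨ.mem_iff _ (Ψ.map_target ht), Ψ.right_inv ht]
        change (Ψ q).2 + t • (0 : Euc m) ∈ L
        simpa using hΨq
      · simp only [hγ0]
        exact Ψ.left_inv hqΨ
    · rw [mfderiv_fst]
      exact hfst

/-- The graph of `p`, read in the chart `c` of the parameter space. -/
def chartGraph {d m n : ℕ} {U : Type} [TopologicalSpace U] (c : OpenPartialHomeomorph U (Euc n))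
    (p : U → Psi d m) : Set (Euc n × Euc m) :=
  {q | q.1 ∈ c.target ∧ q.2 ∈ (p (c.symm q.1)).1}

/-- This is the chain rule that translates the submersion condition, stated with manifold
derivatives, into an ordinary derivative in a chart of the base. -/
theorem hasDerivAt_comp_fst {m n : ℕ} {U : Type} [TopologicalSpace U] [ChartedSpace (Euc n) U]
    {γ : ℝ → U × Euc m} {q : U × Euc m} (hq : γ 0 = q)
    (hγ : MDifferentiableAt 𝓘(ℝ, ℝ) (𝓘(ℝ, Euc n).prod 𝓘(ℝ, Euc m)) γ 0) {c : U → Euc n}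
    (hc : MDifferentiableAt 𝓘(ℝ, Euc n) 𝓘(ℝ, Euc n) c q.1) (v : Euc n × Euc m)
    (hv : (mfderiv 𝓘(ℝ, ℝ) (𝓘(ℝ, Euc n).prod 𝓘(ℝ, Euc m)) γ 0 (1 : ℝ) : Euc n × Euc m) = v) :
    HasDerivAt (fun t => c (γ t).1) (mfderiv 𝓘(ℝ, Euc n) 𝓘(ℝ, Euc n) c q.1
      (mfderiv (𝓘(ℝ, Euc n).prod 𝓘(ℝ, Euc m)) 𝓘(ℝ, Euc n) Prod.fst q v) : Euc n) 0 := by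
  subst hq hv
  have h1 : HasMFDerivAt (𝓘(ℝ, Euc n).prod 𝓘(ℝ, Euc m)) 𝓘(ℝ, Euc n)
      (Prod.fst : U × Euc m → U) (γ 0) _ := mdifferentiableAt_fst.hasMFDerivAt
  have h2 := hc.hasMFDerivAt.comp 0 (h1.comp 0 hγ.hasMFDerivAt)
  let D : ℝ →L[ℝ] Euc n := (mfderiv 𝓘(ℝ, Euc n) 𝓘(ℝ, Euc n) c (γ 0).1).comp
    ((mfderiv (𝓘(ℝ, Euc n).prod 𝓘(ℝ, Euc m)) 𝓘(ℝ, Euc n) Prod.fst (γ 0)).comp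
      (mfderiv 𝓘(ℝ, ℝ) (𝓘(ℝ, Euc n).prod 𝓘(ℝ, Euc m)) γ 0))
  have h3 : HasFDerivAt (fun t => c (γ t).1) D 0 := hasMFDerivAt_iff_hasFDerivAt.1 h2
  exact h3.hasDerivAt

/-- In a chart of its parameter space, a plot is a smooth family of submanifolds. -/
theorem IsPlot.isFiberedAt {d m n : ℕ} {U : Type} [TopologicalSpace U] [ChartedSpace (Euc n) U]
    [IsManifold 𝓘(ℝ, Euc n) ∞ U] {p : U → Psi d m} (hp : IsPlot (n := n) p) (u₀ : U) {y₀ : Euc m}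
    (hy₀ : y₀ ∈ (p u₀).1) :
    IsFiberedAt d (chartGraph (chartAt (Euc n) u₀) p) (chartAt (Euc n) u₀ u₀, y₀) := by
  set c := chartAt (Euc n) u₀ with hc
  have hu₀ : u₀ ∈ c.source := mem_chart_source _ u₀
  obtain ⟨e, he, hxe, L, hL, hmem⟩ := hp.submanifold_graph (u₀, y₀) hy₀
  rw [IsManifold.mem_maximalAtlas_iff_contMDiffOn] at he
  have hcs : ContMDiffOn 𝓘(ℝ, Euc n) 𝓘(ℝ, Euc n) ∞ c c.source := contMDiffOn_chart
  have hcs' : ContMDiffOn 𝓘(ℝ, Euc n) 𝓘(ℝ, Euc n) ∞ c.symm c.target := contMDiffOn_chart_symm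
  let k : OpenPartialHomeomorph (Euc n × Euc m) (U × Euc m) :=
    c.symm.prod (OpenPartialHomeomorph.refl (Euc m))
  have hk : ContMDiffOn (𝓘(ℝ, Euc n).prod 𝓘(ℝ, Euc m)) (𝓘(ℝ, Euc n).prod 𝓘(ℝ, Euc m)) ∞ k
      k.source :=
    hcs'.prodMap (contMDiffOn_id (I := 𝓘(ℝ, Euc m)) (n := ∞) (s := (Set.univ : Set (Euc m))))
  have hk' : ContMDiffOn (𝓘(ℝ, Euc n).prod 𝓘(ℝ, Euc m)) (𝓘(ℝ, Euc n).prod 𝓘(ℝ, Euc m)) ∞ k.symm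
      k.target := by
    have := hcs.prodMap (contMDiffOn_id (I := 𝓘(ℝ, Euc m)) (n := ∞) (s := (Set.univ : Set (Euc m))))
    exact this
  let e' : OpenPartialHomeomorph (Euc n × Euc m) (Euc n × Euc m) := k.trans e
  have hk0 : k (c u₀, y₀) = (u₀, y₀) := by
    change (c.symm (c u₀), y₀) = _
    rw [c.left_inv hu₀]
  have hq₀ : (c u₀, y₀) ∈ e'.source := by
    rw [OpenPartialHomeomorph.trans_source]
    refine ⟨⟨c.map_source hu₀, trivial⟩, ?_⟩
    rw [Set.mem_preimage, hk0]
    exact hxe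
  have hdiffeo : IsLocalDiffeo e' := by
    constructor
    · refine contMDiffOn_modelProd_iff_contDiffOn.1 ?_
      rw [OpenPartialHomeomorph.trans_source]
      exact he.1.comp (hk.mono Set.inter_subset_left) fun x hx => hx.2
    · refine contMDiffOn_modelProd_iff_contDiffOn'.1 ?_
      rw [OpenPartialHomeomorph.trans_target]
      exact hk'.comp (he.2.mono Set.inter_subset_left) fun x hx => hx.2
  have hslice : IsSliceChart (chartGraph c p) e' L := by
    refine ⟨hdiffeo, fun q hq => ?_⟩
    rw [OpenPartialHomeomorph.trans_source] at hq
    refine Iff.trans ?_ (hmem (k q) hq.2)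
    exact and_iff_right hq.1.1
  refine hslice.isFiberedAt (by rw [hL, finrank_euclideanSpace_fin]) hq₀ fun b => ?_
  have hmd : MDifferentiableAt 𝓘(ℝ, Euc n) 𝓘(ℝ, Euc n) c u₀ :=
    (hcs.contMDiffAt (c.open_source.mem_nhds hu₀)).mdifferentiableAt (by simp)
  -- Charts have invertible differential, so `b` comes from a tangent vector of `U`, to which the
  -- submersion property applies.
  obtain ⟨B, hB⟩ : ∃ B : TangentSpace 𝓘(ℝ, Euc n) u₀,
      mfderiv 𝓘(ℝ, Euc n) 𝓘(ℝ, Euc n) c u₀ B = b := by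
    have hinv := isInvertible_mfderiv_extChartAt (I := 𝓘(ℝ, Euc n))
      (mem_extChartAt_source (I := 𝓘(ℝ, Euc n)) u₀)
    obtain ⟨B, hB⟩ := hinv.bijective.surjective b
    refine ⟨B, ?_⟩
    rw [← hB]
    rfl
  obtain ⟨v, ⟨γ, hγ, hγS, hγ0, hγv⟩, hv⟩ := hp.submersion (u₀, y₀) hy₀ B
  set γ₂ : ℝ → Euc n × Euc m := fun t => (c (γ t).1, (γ t).2) with hγ₂
  have hγ1 : ContMDiffAt 𝓘(ℝ, ℝ) 𝓘(ℝ, Euc n) ∞ (fun t => (γ t).1) 0 :=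
    contMDiffAt_fst.comp 0 hγ
  have hγ2 : ContDiffAt ℝ ∞ (fun t => (γ t).2) 0 :=
    contMDiffAt_iff_contDiffAt.1 (contMDiffAt_snd.comp 0 hγ)
  have hγ10 : (γ 0).1 = u₀ := by rw [hγ0]
  have hcγ : ContMDiffAt 𝓘(ℝ, ℝ) 𝓘(ℝ, Euc n) ∞ (fun t => c (γ t).1) 0 := by
    refine ContMDiffAt.comp (g := c) 0 ?_ hγ1
    rw [hγ10]
    exact hcs.contMDiffAt (c.open_source.mem_nhds hu₀)
  have hγ₂s : ContDiffAt ℝ ∞ γ₂ 0 := (contMDiffAt_iff_contDiffAt.1 hcγ).prodMk hγ2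
  have hγ₂0 : γ₂ 0 = (c u₀, y₀) := by simp [hγ₂, hγ0]
  have hγ₂d := (hγ₂s.differentiableAt (by simp)).hasDerivAt
  refine ⟨deriv γ₂ 0, ?_, ?_⟩
  · have htan : deriv γ₂ 0 ∈
        (tangentVectors 𝓘(ℝ, Euc n × Euc m) (chartGraph c p) (c u₀, y₀) : Set _) := by
      refine mem_tangentVectors_iff.2 ⟨γ₂, hγ₂s, ?_, hγ₂0, hγ₂d⟩
      have hsrc : ∀ᶠ t in 𝓝 (0 : ℝ), (γ t).1 ∈ c.source := by
        apply hγ1.continuousAt.preimage_mem_nhds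
        rw [hγ10]
        exact c.open_source.mem_nhds hu₀
      filter_upwards [hsrc, hγS] with t ht htS
      refine ⟨c.map_source ht, ?_⟩
      simp only [hγ₂, c.left_inv ht]
      exact htS
    refine (hslice.mem_tangentVectors ?_ hq₀).1 htan
    refine ⟨c.map_source hu₀, ?_⟩
    simp only [c.left_inv hu₀]
    exact hy₀
  · have h1 : HasDerivAt (fun t => c (γ t).1) (deriv γ₂ 0).1 0 :=
      (ContinuousLinearMap.fst ℝ (Euc n) (Euc m)).hasFDerivAt.comp_hasDerivAt 0 hγ₂d
    have h2 := hasDerivAt_comp_fst hγ0 (hγ.mdifferentiableAt (by simp)) hmd v hγv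
    rw [h1.unique h2, hv]
    exact hB

end Plots

end

noncomputable section

/-! ### Local sections from the inverse function theorem -/

section LocalSections

variable {X : Type*} [NormedAddCommGroup X] [NormedSpace ℝ X] [FiniteDimensional ℝ X] {m : ℕ}
  {W : Set (Euc m)} {N : Set (Euc m × Euc m)} {Ω : Set (Euc m)} {π : Euc m → Euc m}

/-- If the section `s₀` is transverse to itself along the projection: a vector tangent to its
image and killed by the projection vanishes. -/
theorem IsTubularRetraction.eq_zero_of_tangent (hπ : IsTubularRetraction W N Ω π)
    {s₀ : Euc m → Euc m} (hs₀ : ContDiffOn ℝ ∞ s₀ W) {S : Set (Euc m)} {y₀ k : Euc m}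
    (hy₀ : y₀ ∈ Ω) (hS : ∀ᶠ y in 𝓝 y₀, y ∈ S → y = π y + s₀ (π y))
    (hk : k ∈ tangentVectors 𝓘(ℝ, Euc m) S y₀) (hπk : fderiv ℝ π y₀ k = 0) : k = 0 := by
  obtain ⟨γ, hγ, hγS, rfl, hγd⟩ := mem_tangentVectors_iff.1 hk
  have hπd : HasDerivAt (fun t => π (γ t)) (0 : Euc m) 0 := by
    rw [← hπk]
    exact ((hπ.smooth.contDiffAt (hπ.isOpen.mem_nhds hy₀)).differentiableAt
      (by simp)).hasFDerivAt.comp_hasDerivAt 0 hγd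
  have hsd : HasDerivAt (fun t => s₀ (π (π (γ t)))) (0 : Euc m) 0 := by
    have h := (((hπ.contDiffOn_comp hs₀).contDiffAt (hπ.isOpen.mem_nhds
      (hπ.subset (hπ.proj_mem hy₀)))).differentiableAt
      (by simp)).hasFDerivAt.comp_hasDerivAt 0 hπd
    rwa [map_zero] at h
  -- The second `π` is inserted because `s₀` is smooth only along `W`, whereas `s₀ ∘ π` is
  -- differentiable on an open set.
  have hev : ∀ᶠ t in 𝓝 (0 : ℝ), γ t = π (γ t) + s₀ (π (π (γ t))) := by
    filter_upwards [hγS, hγ.continuousAt.eventually hS,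
      hγ.continuousAt.preimage_mem_nhds (hπ.isOpen.mem_nhds hy₀)] with t h1 h2 h3
    rw [hπ.proj_eq (hπ.proj_mem h3)]
    exact h2 h1
  have h := (hπd.add hsd).congr_of_eventuallyEq hev
  simpa using hγd.unique h

/-- Near a point where the fibre over `a₀` of a smooth family is the image of a section, the
family consists of images of sections, which depend smoothly on the parameter. -/
theorem IsTubularRetraction.exists_local_section {d : ℕ} (hπ : IsTubularRetraction W N Ω π)
    (hW : IsSmoothSubmanifold 𝓘(ℝ, Euc m) d W)
    {s₀ : Euc m → Euc m} (hs₀ : ContDiffOn ℝ ∞ s₀ W) (hs₀N : ∀ x ∈ W, (x, s₀ x) ∈ N)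
    {Γ : Set (X × Euc m)} {a₀ : X} {x₀ : Euc m} (hx₀ : x₀ ∈ W)
    (hΓ : IsFiberedAt d Γ (a₀, x₀ + s₀ x₀))
    (hagree : ∀ᶠ y in 𝓝 (x₀ + s₀ x₀), (a₀, y) ∈ Γ ↔ y ∈ (fun x => x + s₀ x) '' W) :
    ∃ (r : ℝ) (A : Set X) (B : Set (Euc m)) (Y : X × Euc m → Euc m), 0 < r ∧ IsOpen A ∧ a₀ ∈ A ∧
      IsOpen B ∧ x₀ ∈ B ∧ ContDiffOn ℝ ∞ Y (A ×ˢ B) ∧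
      (∀ a ∈ A, ∀ x ∈ W, x ∈ B → (a, Y (a, x)) ∈ Γ ∧ Y (a, x) ∈ Ω ∧ π (Y (a, x)) = x ∧
        ‖Y (a, x) - (x₀ + s₀ x₀)‖ < r / 4 ∧ ‖(x + s₀ x) - (x₀ + s₀ x₀)‖ < r / 4 ∧
        (a₀, x + s₀ x) ∈ Γ) ∧
      (∀ a ∈ A, ∀ y, ‖y - (x₀ + s₀ x₀)‖ < r → (a, y) ∈ Γ → y ∈ Ω ∧ (π y ∈ B → y = Y (a, π y))) := by
  set y₀ := x₀ + s₀ x₀ with hy₀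
  obtain ⟨hy₀Ω, hπy₀⟩ : y₀ ∈ Ω ∧ π y₀ = x₀ := hπ.add_mem _ _ (hs₀N x₀ hx₀)
  obtain ⟨e, L, he, hxe, hL⟩ := isSmoothSubmanifold_iff_slice.1 hW x₀ hx₀
  obtain ⟨Ψ, T, hΨ, hqΨ, hT⟩ := hΓ
  have hperp := L.finrank_add_finrank_orthogonal
  obtain ⟨β, hβmem, hβ0⟩ := exists_clm_mem_and_ker T Lᗮ (by omega)
  set S : Set (X × Euc m) := Ψ.source ∩ Prod.snd ⁻¹' (Ω ∩ π ⁻¹' e.source) with hS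
  have hSo : IsOpen S := Ψ.open_source.inter
    ((hπ.smooth.continuousOn.isOpen_inter_preimage hπ.isOpen e.open_source).preimage
      continuous_snd)
  have hSmem : (a₀, y₀) ∈ S := ⟨hqΨ, hy₀Ω, by rw [Set.mem_preimage, hπy₀]; exact hxe⟩
  -- The term `e (π y)` lies in `L`, and `β` takes values in `Lᗮ` with kernel `T`. So `H`
  -- straightens `Γ` and the projection `π` simultaneously: the `L`-part determines `π y`, and the
  -- `Lᗮ`-part vanishes exactly on `Γ`.
  set H : X × Euc m → X × Euc m := fun q => (q.1, e (π q.2) + β (Ψ q).2) with hH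
  have heπ : ContDiffOn ℝ ∞ (fun y => e (π y)) (Ω ∩ π ⁻¹' e.source) :=
    he.smooth.comp (hπ.smooth.mono Set.inter_subset_left) fun y hy => hy.2
  have hHs : ContDiffOn ℝ ∞ H S :=
    contDiff_fst.contDiffOn.prodMk ((heπ.comp contDiff_snd.contDiffOn fun q hq => hq.2).add
      (β.contDiff.comp_contDiffOn (hΨ.smooth.mono Set.inter_subset_left).snd))
  have heL : ∀ y ∈ Ω ∩ π ⁻¹' e.source, e (π y) ∈ L := fun y hy =>
    (he.mem_iff _ hy.2).1 (hπ.proj_mem hy.1)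
  have hsplit : ∀ u ∈ L, ∀ v w, v ∈ L → u + β w = v → u = v ∧ w ∈ T := by
    intro u hu v w hv h
    have h1 := starProjection_add_of_mem hu (hβmem w)
    have h2 := starProjection_add_of_mem hv Lᗮ.zero_mem
    rw [add_zero] at h2
    rw [h] at h1
    exact ⟨h1.1.symm.trans h2.1, (hβ0 w).1 (h1.2.symm.trans h2.2)⟩
  have hπat : ContDiffAt ℝ ∞ π y₀ := hπ.smooth.contDiffAt (hπ.isOpen.mem_nhds hy₀Ω)
  obtain ⟨Φ, hΦ, hΦmem, hΦS, hcoe⟩ := exists_localDiffeo_of_injective hSo hHs hSmem (by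
    rintro ⟨h, k⟩ hv
    have hopen : IsOpen (Ω ∩ π ⁻¹' e.source) :=
      hπ.smooth.continuousOn.isOpen_inter_preimage hπ.isOpen e.open_source
    have hd1 : HasFDerivAt (fun y => e (π y)) ((fderiv ℝ e x₀).comp (fderiv ℝ π y₀)) y₀ := by
      refine HasFDerivAt.comp (g := e) y₀ ?_ (hπat.differentiableAt (by simp)).hasFDerivAt
      rw [hπy₀]
      exact (he.differentiableAt hxe).hasFDerivAt
    have hd2 : HasFDerivAt (fun q => (Ψ q).2) ((ContinuousLinearMap.snd ℝ X (Euc m)).comp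
        (fderiv ℝ Ψ (a₀, y₀))) (a₀, y₀) :=
      hasFDerivAt_snd.comp _ (hΨ.differentiableAt hqΨ).hasFDerivAt
    have hd : HasFDerivAt H ((ContinuousLinearMap.fst ℝ X (Euc m)).prod
        (((fderiv ℝ e x₀).comp (fderiv ℝ π y₀)).comp (ContinuousLinearMap.snd ℝ X (Euc m)) +
          β.comp ((ContinuousLinearMap.snd ℝ X (Euc m)).comp (fderiv ℝ Ψ (a₀, y₀)))))
        (a₀, y₀) := by
      refine hasFDerivAt_fst.prodMk (HasFDerivAt.add ?_ (β.hasFDerivAt.comp _ hd2))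
      exact HasFDerivAt.comp (g := fun y => e (π y)) (a₀, y₀) hd1 hasFDerivAt_snd
    rw [hd.fderiv] at hv
    have h1 : h = 0 := congrArg Prod.fst hv
    have h2 : fderiv ℝ e x₀ (fderiv ℝ π y₀ k) + β (fderiv ℝ Ψ (a₀, y₀) (h, k)).2 = 0 :=
      congrArg Prod.snd hv
    subst h1
    have h3 : fderiv ℝ e x₀ (fderiv ℝ π y₀ k) ∈ L := by
      have hline : HasDerivAt (fun t : ℝ => y₀ + t • k) k 0 := by
        simpa using ((hasDerivAt_id (0 : ℝ)).smul_const k).const_add y₀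
      have hd1' : HasFDerivAt (fun y => e (π y)) ((fderiv ℝ e x₀).comp (fderiv ℝ π y₀))
          ((fun t : ℝ => y₀ + t • k) 0) := by simpa using hd1
      have hcomp := HasFDerivAt.comp_hasDerivAt (l := fun y => e (π y)) 0 hd1' hline
      refine HasDerivAt.mem_of_eventually_mem L hcomp ?_
      have : ∀ᶠ t : ℝ in 𝓝 0, y₀ + t • k ∈ Ω ∩ π ⁻¹' e.source := by
        apply hline.continuousAt.preimage_mem_nhds
        simpa using hopen.mem_nhds hSmem.2
      filter_upwards [this] with t ht using heL _ ht
    obtain ⟨h4, h5⟩ := hsplit _ h3 0 _ L.zero_mem h2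
    have h6 := he.fderiv_injective hxe h4
    have h7 : k ∈ tangentVectors 𝓘(ℝ, Euc m) {y | (a₀, y) ∈ Γ} y₀ := by
      refine ((hΨ.isSliceChart a₀).mem_tangentVectors ?_ hqΨ).2 ?_
      · exact hagree.self_of_nhds.2 ⟨x₀, hx₀, rfl⟩
      · have hd3 : HasFDerivAt (fun y => (Ψ (a₀, y)).2) (((ContinuousLinearMap.snd ℝ X (Euc m)).comp
            (fderiv ℝ Ψ (a₀, y₀))).comp (ContinuousLinearMap.inr ℝ X (Euc m))) y₀ :=
          HasFDerivAt.comp (g := fun q => (Ψ q).2) y₀ hd2 (hasFDerivAt_prodMk_right a₀ y₀)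
        change fderiv ℝ (fun y => (Ψ (a₀, y)).2) y₀ k ∈ T
        rw [hd3.fderiv]
        exact h5
    -- A kernel vector is tangent to the fibre over `a₀` and killed by `π`; that fibre is the image
    -- of a section.
    have h8 : k = 0 := by
      refine hπ.eq_zero_of_tangent hs₀ hy₀Ω ?_ h7 h6
      filter_upwards [hagree] with y hy hyΓ
      obtain ⟨x, hx, rfl⟩ := hy.1 hyΓ
      simp only [(hπ.add_mem _ _ (hs₀N x hx)).2]
    rw [h8]; rfl)
  have hfst : ∀ q ∈ Φ.target, (Φ.symm q).1 = q.1 := by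
    intro q hq
    have := congrArg Prod.fst (Φ.right_inv hq)
    rw [hcoe] at this
    exact this
  have hΦy₀ : Φ (a₀, y₀) = (a₀, e x₀) := by
    rw [hcoe]
    refine Prod.ext rfl ?_
    have : (Ψ (a₀, y₀)).2 ∈ T := (hΨ.mem_iff _ hqΨ).1 (hagree.self_of_nhds.2 ⟨x₀, hx₀, rfl⟩)
    simp only [hH]
    rw [hπy₀, (hβ0 _).2 this, add_zero]
  obtain ⟨r, hr, hball⟩ := Metric.isOpen_iff.1 Φ.open_source _ hΦmem
  rw [← ball_prod_same] at hball
  -- The local section inverts `H` over `L`. The radius `r / 4`, against uniqueness up to distance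
  -- `r`, leaves room to compare sections based at different points.
  set R : Set (X × Euc m) := (Prod.snd ⁻¹' e.source) ∩
    (fun q : X × Euc m => (q.1, e q.2)) ⁻¹' (Φ.target ∩ Φ.symm ⁻¹' (Prod.snd ⁻¹'
      Metric.ball y₀ (r / 4))) with hR
  have hec : ContDiffOn ℝ ∞ (fun q : X × Euc m => (q.1, e q.2)) (Prod.snd ⁻¹' e.source) :=
    contDiff_fst.contDiffOn.prodMk (he.smooth.comp contDiff_snd.contDiffOn fun q hq => hq)
  have hRo : IsOpen R := hec.continuousOn.isOpen_inter_preimage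
    (e.open_source.preimage continuous_snd)
    (Φ.symm.continuousOn.isOpen_inter_preimage Φ.open_target
      (Metric.isOpen_ball.preimage continuous_snd))
  have hRmem : (a₀, x₀) ∈ R := by
    refine ⟨hxe, ?_, ?_⟩
    · simp only [← hΦy₀]
      exact Φ.map_source hΦmem
    · simp only [Set.mem_preimage, ← hΦy₀, Φ.left_inv hΦmem]
      exact Metric.mem_ball_self (by linarith)
  obtain ⟨A₁, B₁, hA₁, haA₁, hB₁, hxB₁, hAB⟩ := mem_nhds_prod_iff'.1 (hRo.mem_nhds hRmem)
  have hs₀c : ContinuousOn (fun x => x + s₀ x) W := continuousOn_id.add hs₀.continuousOn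
  obtain ⟨B₂, hB₂, hxB₂, hB₂sub⟩ := mem_nhdsWithin.1
    ((hs₀c x₀ hx₀).preimage_mem_nhdsWithin (Filter.inter_mem
      (Metric.ball_mem_nhds y₀ (by linarith : 0 < r / 4)) hagree))
  have hYs : ContDiffOn ℝ ∞ (fun q : X × Euc m => (Φ.symm (q.1, e q.2)).2) R :=
    (hΦ.smooth_symm.comp (hec.mono Set.inter_subset_left) fun q hq => hq.2.1).snd
  refine ⟨r, A₁ ∩ Metric.ball a₀ r, B₁ ∩ B₂, fun q => (Φ.symm (q.1, e q.2)).2, hr,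
    hA₁.inter Metric.isOpen_ball, ⟨haA₁, Metric.mem_ball_self hr⟩, hB₁.inter hB₂, ⟨hxB₁, hxB₂⟩,
    hYs.mono fun q hq => hAB ⟨hq.1.1, hq.2.1⟩, ?_, ?_⟩
  · intro a ha x hx hxB
    have hq : (a, x) ∈ R := hAB ⟨ha.1, hxB.1⟩
    have hqt : (a, e x) ∈ Φ.target := hq.2.1
    set y := (Φ.symm (a, e x)).2 with hy
    have hay : Φ.symm (a, e x) = (a, y) := Prod.ext (hfst _ hqt) rfl
    have hsrc : (a, y) ∈ Φ.source := by rw [← hay]; exact Φ.map_target hqt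
    have hval : Φ (a, y) = (a, e x) := by rw [← hay]; exact Φ.right_inv hqt
    rw [hcoe] at hval
    have hval2 : e (π y) + β (Ψ (a, y)).2 = e x := congrArg Prod.snd hval
    have hyS := hΦS hsrc
    obtain ⟨h1, h2⟩ := hsplit _ (heL y hyS.2) _ _ ((he.mem_iff x hq.1).1 hx) hval2
    refine ⟨(hΨ.mem_iff _ hyS.1).2 h2, hyS.2.1, e.injOn hyS.2.2 hq.1 h1, ?_, ?_, ?_⟩
    · rw [← dist_eq_norm]; exact hq.2.2
    · rw [← dist_eq_norm]; exact (hB₂sub ⟨hxB.2, hx⟩).1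
    · exact (hB₂sub ⟨hxB.2, hx⟩).2.2 ⟨x, hx, rfl⟩
  · intro a ha y hy hyΓ
    have hsrc : (a, y) ∈ Φ.source := by
      refine hball ⟨ha.2, ?_⟩
      rw [Metric.mem_ball, dist_eq_norm]; exact hy
    have hyS := hΦS hsrc
    refine ⟨hyS.2.1, fun hB => ?_⟩
    have hval : Φ (a, y) = (a, e (π y)) := by
      rw [hcoe]
      refine Prod.ext rfl ?_
      simp only [hH]
      rw [(hβ0 _).2 ((hΨ.mem_iff _ hyS.1).1 hyΓ), add_zero]
    simp only
    rw [← hval, Φ.left_inv hsrc]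

end LocalSections

end

noncomputable section

/-! ### Gluing sections along a compact set -/

section GluedSections

variable {X : Type*} [NormedAddCommGroup X] [NormedSpace ℝ X] [FiniteDimensional ℝ X] {m : ℕ}
  {W : Set (Euc m)} {N : Set (Euc m × Euc m)} {Ω : Set (Euc m)} {π : Euc m → Euc m}

/-- Along a compact set, the local sections of `exists_local_section` glue. -/
theorem IsTubularRetraction.exists_glued_section {d : ℕ} (hπ : IsTubularRetraction W N Ω π)
    (hW : IsSmoothSubmanifold 𝓘(ℝ, Euc m) d W)
    {s₀ : Euc m → Euc m} (hs₀ : ContDiffOn ℝ ∞ s₀ W) (hs₀N : ∀ x ∈ W, (x, s₀ x) ∈ N)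
    {Γ : Set (X × Euc m)} {a₀ : X} {C : Set (Euc m)} (hC : IsCompact C) (hCW : C ⊆ W)
    (hΓ : ∀ x ∈ C, IsFiberedAt d Γ (a₀, x + s₀ x))
    (hagree : ∀ x ∈ C, ∀ᶠ y in 𝓝 (x + s₀ x), (a₀, y) ∈ Γ ↔ y ∈ (fun x => x + s₀ x) '' W) :
    ∃ (A : Set X) (B : Set (Euc m)) (σ : X × Euc m → Euc m), IsOpen A ∧ a₀ ∈ A ∧
      IsOpen B ∧ C ⊆ B ∧ ContDiffOn ℝ ∞ σ (A ×ˢ (W ∩ B)) ∧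
      (∀ a ∈ A, ∀ x ∈ W, x ∈ B → (x, σ (a, x)) ∈ N ∧ (a, x + σ (a, x)) ∈ Γ) ∧
      (∀ x ∈ W, x ∈ B → σ (a₀, x) = s₀ x) ∧
      ∀ x ∈ C, ∀ᶠ q : X × Euc m in 𝓝 (a₀, x + s₀ x), q ∈ Γ → q.2 = π q.2 + σ (q.1, π q.2) := by
  classical
  choose r A B Y hr hA haA hB hxB hY hsec huniq using fun x : C =>
    hπ.exists_local_section hW hs₀ hs₀N (hCW x.2) (hΓ x.1 x.2) (hagree x.1 x.2)
  have hoverlap' : ∀ i j : C, r j ≤ r i → ∀ a ∈ A i, a ∈ A j → ∀ x ∈ W, x ∈ B i → x ∈ B j →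
      Y j (a, x) = Y i (a, x) := by
    intro i j hij a hai haj x hx hxi hxj
    obtain ⟨hΓj, -, hπj, hdj, hdj', -⟩ := hsec j a haj x hx hxj
    obtain ⟨-, -, -, -, hdi', -⟩ := hsec i a hai x hx hxi
    -- Three distances, each below a quarter of the larger radius `r i`, put the value of `Y j` in
    -- the region where `Y i` is unique.
    have hnorm : ‖Y j (a, x) - (i.1 + s₀ i.1)‖ < r i := by
      have h1 : Y j (a, x) - (i.1 + s₀ i.1) = (Y j (a, x) - (j.1 + s₀ j.1)) -
          ((x + s₀ x) - (j.1 + s₀ j.1)) + ((x + s₀ x) - (i.1 + s₀ i.1)) := by abel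
      rw [h1]
      have h2 := norm_add_le ((Y j (a, x) - (j.1 + s₀ j.1)) -
          ((x + s₀ x) - (j.1 + s₀ j.1))) ((x + s₀ x) - (i.1 + s₀ i.1))
      have h3 := norm_sub_le (Y j (a, x) - (j.1 + s₀ j.1)) ((x + s₀ x) - (j.1 + s₀ j.1))
      linarith [hr i]
    have h := (huniq i a hai _ hnorm hΓj).2 (by rw [hπj]; exact hxi)
    rwa [hπj] at h
  have hoverlap : ∀ i j : C, ∀ a ∈ A i, a ∈ A j → ∀ x ∈ W, x ∈ B i → x ∈ B j →
      Y j (a, x) = Y i (a, x) := by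
    intro i j a hai haj x hx hxi hxj
    rcases le_total (r j) (r i) with h | h
    · exact hoverlap' i j h a hai haj x hx hxi hxj
    · exact (hoverlap' j i h a haj hai x hx hxj hxi).symm
  obtain ⟨t, ht⟩ := hC.elim_finite_subcover B hB fun x hx => Set.mem_iUnion.2 ⟨⟨x, hx⟩, hxB ⟨x, hx⟩⟩
  set A' : Set X := ⋂ i ∈ t, A i with hA'
  set B' : Set (Euc m) := ⋃ i ∈ t, B i with hB'
  -- The chosen index does not matter for `a ∈ A'` and points of `W`, by `hoverlap`. The value `0`
  -- outside the cover is never used.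
  let σ : X × Euc m → Euc m := fun q =>
    if h : ∃ i ∈ t, q.2 ∈ B i then Y h.choose q - q.2 else 0
  have hAmem : ∀ a ∈ A', ∀ i ∈ t, a ∈ A i := fun a ha i hi => by
    simpa using Set.mem_iInter₂.1 ha i hi
  have hσ : ∀ i ∈ t, ∀ a ∈ A', ∀ x ∈ W, x ∈ B i → σ (a, x) = Y i (a, x) - x := by
    intro i hi a ha x hx hxi
    have h : ∃ i ∈ t, (a, x).2 ∈ B i := ⟨i, hi, hxi⟩
    simp only [σ, dif_pos h]
    rw [hoverlap i h.choose a (hAmem a ha i hi) (hAmem a ha _ h.choose_spec.1) x hx hxi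
      h.choose_spec.2]
  have ha₀A' : a₀ ∈ A' := Set.mem_iInter₂.2 fun i _ => haA i
  have hA'o : IsOpen A' := isOpen_biInter_finset fun i _ => hA i
  refine ⟨A', B', σ, hA'o, ha₀A', isOpen_biUnion fun i _ => hB i, ht, ?_, ?_, ?_, ?_⟩
  · rintro ⟨a, x⟩ ⟨ha, hx, hxB'⟩
    obtain ⟨i, hi, hxi⟩ := Set.mem_iUnion₂.1 hxB'
    have h1 : ContDiffWithinAt ℝ ∞ (fun q : X × Euc m => Y i q - q.2) (A' ×ˢ (W ∩ B i)) (a, x) :=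
      (((hY i).mono (Set.prod_mono (Set.iInter₂_subset i hi) Set.inter_subset_right)).sub
        contDiff_snd.contDiffOn) (a, x) ⟨ha, hx, hxi⟩
    have h2 : ContDiffWithinAt ℝ ∞ σ (A' ×ˢ (W ∩ B i)) (a, x) :=
      h1.congr (fun q hq => hσ i hi q.1 hq.1 q.2 hq.2.1 hq.2.2) (hσ i hi a ha x hx hxi)
    refine h2.mono_of_mem_nhdsWithin ?_
    have h3 : Prod.snd ⁻¹' (B i) ∈ 𝓝[A' ×ˢ (W ∩ B')] (a, x) :=
      mem_nhdsWithin_of_mem_nhds (((hB i).preimage continuous_snd).mem_nhds hxi)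
    filter_upwards [h3, self_mem_nhdsWithin] with q hq hq' using ⟨hq'.1, hq'.2.1, hq⟩
  · intro a ha x hx hxB'
    obtain ⟨i, hi, hxi⟩ := Set.mem_iUnion₂.1 hxB'
    obtain ⟨h1, h2, h3, -⟩ := hsec i a (hAmem a ha i hi) x hx hxi
    rw [hσ i hi a ha x hx hxi, add_sub_cancel]
    refine ⟨?_, h1⟩
    have := hπ.mem _ h2
    rwa [h3] at this
  · intro x hx hxB'
    obtain ⟨i, hi, hxi⟩ := Set.mem_iUnion₂.1 hxB'
    obtain ⟨-, -, -, -, h1, h2⟩ := hsec i a₀ (haA i) x hx hxi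
    have h3 := (huniq i a₀ (haA i) _ (by linarith [hr i]) h2).2
    rw [(hπ.add_mem x _ (hs₀N x hx)).2] at h3
    rw [hσ i hi a₀ ha₀A' x hx hxi, ← h3 hxi, add_sub_cancel_left]
  · intro x hx
    obtain ⟨i, hi, hxi⟩ := Set.mem_iUnion₂.1 (ht hx)
    obtain ⟨-, -, -, -, h1, -⟩ := hsec i a₀ (haA i) x (hCW hx) hxi
    obtain ⟨hΩ, hπx⟩ := hπ.add_mem x _ (hs₀N x (hCW hx))
    have hπc : ContinuousAt (fun q : X × Euc m => π q.2) (a₀, x + s₀ x) :=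
      ContinuousAt.comp (g := π) (hπ.smooth.continuousOn.continuousAt (hπ.isOpen.mem_nhds hΩ))
        continuousAt_snd
    have e1 : ∀ᶠ q : X × Euc m in 𝓝 (a₀, x + s₀ x), q.1 ∈ A' :=
      (hA'o.preimage continuous_fst).mem_nhds ha₀A'
    have e2 : ∀ᶠ q : X × Euc m in 𝓝 (a₀, x + s₀ x), π q.2 ∈ B i :=
      hπc.preimage_mem_nhds (by rw [hπx]; exact (hB i).mem_nhds hxi)
    have e3 : ∀ᶠ q : X × Euc m in 𝓝 (a₀, x + s₀ x), ‖q.2 - (i.1 + s₀ i.1)‖ < r i := by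
      have hc : Continuous fun q : X × Euc m => ‖q.2 - (i.1 + s₀ i.1)‖ := by fun_prop
      exact hc.continuousAt.eventually_lt continuousAt_const (by simp only; linarith [hr i])
    filter_upwards [e1, e2, e3] with q h1 h2 h3 hq
    obtain ⟨h4, h5⟩ := huniq i q.1 (hAmem _ h1 i hi) q.2 h3 hq
    rw [hσ i hi q.1 h1 _ (hπ.proj_mem h4) h2, add_sub_cancel]
    exact h5 h2

/-- The distance from the graph of `s₀` to the complement of an open set cutting out `N` serves as
radius. With it, staying inside `N` becomes a strongly open condition on sections. -/
theorem IsTubularNeighbourhood.exists_radius (hN : IsTubularNeighbourhood W N)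
    {s₀ : Euc m → Euc m} (hs₀ : ContDiffOn ℝ ∞ s₀ W) (hs₀N : ∀ x ∈ W, (x, s₀ x) ∈ N) :
    ∃ ε : Euc m → ℝ, ContinuousOn ε W ∧ (∀ x ∈ W, 0 < ε x) ∧
      ∀ x ∈ W, ∀ v, (x, v) ∈ normalBundle W → ‖v - s₀ x‖ < ε x → (x, v) ∈ N := by
  obtain ⟨O, hO, hNO⟩ := hN.isOpen_in_normalBundle
  by_cases hne : Oᶜ.Nonempty
  · refine ⟨fun x => Metric.infDist (x, s₀ x) Oᶜ, ?_, ?_, ?_⟩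
    · exact (Metric.continuous_infDist_pt _).comp_continuousOn
        (continuousOn_id.prodMk hs₀.continuousOn)
    · intro x hx
      have h := hs₀N x hx
      rw [hNO] at h
      exact (hO.isClosed_compl.notMem_iff_infDist_pos hne).1 (by simpa using h.2)
    · intro x hx v hv hlt
      rw [hNO]
      refine ⟨hv, ?_⟩
      by_contra hnO
      have := Metric.infDist_le_dist_of_mem (x := (x, s₀ x)) (s := Oᶜ) hnO
      rw [Prod.dist_eq, dist_self, max_eq_right dist_nonneg, dist_comm, dist_eq_norm] at this
      linarith
  · refine ⟨fun _ => 1, continuousOn_const, fun _ _ => one_pos, fun x hx v hv _ => ?_⟩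
    rw [hNO]
    refine ⟨hv, ?_⟩
    rw [Set.not_nonempty_iff_eq_empty, Set.compl_empty_iff] at hne
    rw [hne]
    trivial

theorem isOpen_strong_basic (s₀ : NormalSection W) {Xs : List (Euc m → Euc m)}
    (hXs : ∀ X ∈ Xs, IsTangentField W X) {ε : Euc m → ℝ} (hε : ContinuousOn ε W)
    (hpos : ∀ x ∈ W, 0 < ε x) : IsOpen[strongTopology W] {t : NormalSection W |
      ∀ x ∈ W, ‖iteratedFieldDeriv W Xs (fun y => t.toFun y - s₀.toFun y) x‖ < ε x} :=
  TopologicalSpace.isOpen_generateFrom_of_mem ⟨s₀, Xs, ε, hXs, hε, hpos, rfl⟩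

theorem isOpen_strong_norm_lt (s₀ : NormalSection W) {ε : Euc m → ℝ} (hε : ContinuousOn ε W)
    (hpos : ∀ x ∈ W, 0 < ε x) : IsOpen[strongTopology W] {t : NormalSection W |
      ∀ x ∈ W, ‖t.toFun x - s₀.toFun x‖ < ε x} :=
  isOpen_strong_basic s₀ (Xs := []) (by simp) hε hpos

end GluedSections

end

noncomputable section

/-! ### Continuity of plots in the section charts -/

section NearbySections

variable {X : Type*} [NormedAddCommGroup X] [NormedSpace ℝ X] [FiniteDimensional ℝ X] {m : ℕ}
  {W : Set (Euc m)} {N : Set (Euc m × Euc m)} {Ω : Set (Euc m)} {π : Euc m → Euc m}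

/-- A smooth cutoff function for a compact subset of an open set. -/
theorem exists_cutoff {C B : Set (Euc m)} (hC : IsCompact C) (hB : IsOpen B) (hCB : C ⊆ B) :
    ∃ (χ : Euc m → ℝ) (C₁ C₂ : Set (Euc m)), ContDiff ℝ ∞ χ ∧ IsOpen C₁ ∧ C ⊆ C₁ ∧ C₁ ⊆ B ∧
      IsCompact C₂ ∧ C₂ ⊆ B ∧ (∀ x ∈ C₁, χ x = 1) ∧ (∀ x ∉ C₂, χ x = 0) := by
  obtain ⟨C₂, hC₂, hCC₂, hC₂B⟩ := exists_compact_between hC hB hCB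
  obtain ⟨f, h1, h2, -⟩ := exists_contMDiffMap_one_nhds_of_subset_interior 𝓘(ℝ, Euc m)
    (n := ⊤) hC.isClosed hCC₂
  obtain ⟨C₁, hC₁, hCC₁, hfC₁⟩ := mem_nhdsSet_iff_exists.1 h1
  exact ⟨f, C₁ ∩ B, C₂, f.contMDiff.contDiff, hC₁.inter hB, Set.subset_inter hCC₁ hCB,
    Set.inter_subset_right, hC₂, hC₂B, fun x hx => hfC₁ hx.1, h2⟩

/-- The section of the normal bundle obtained from `s₀` by a perturbation with compact support. -/
def NormalSection.modify (s₀ : NormalSection W) {C : Set (Euc m)} (hC : IsCompact C)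
    (f : Euc m → Euc m) (hf : ContDiffOn ℝ ∞ f W) (hfN : ∀ x ∈ W, (x, f x) ∈ normalBundle W)
    (hfC : ∀ x ∈ W, x ∉ C → f x = s₀.toFun x) : NormalSection W where
  toFun := W.indicator f
  eq_zero_off x hx := Set.indicator_of_notMem hx f
  smooth := hf.congr fun x hx => Set.indicator_of_mem hx f
  normal x hx := by rw [Set.indicator_of_mem hx]; exact hfN x hx
  compact_support := by
    refine HasCompactSupport.intro (hC.union s₀.compact_support.isCompact) fun x hx => ?_
    rw [Set.mem_union, not_or] at hx
    by_cases hxW : x ∈ W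
    · rw [Set.indicator_of_mem hxW, hfC x hxW hx.1]
      exact image_eq_zero_of_notMem_tsupport hx.2
    · exact Set.indicator_of_notMem hxW f

theorem NormalSection.modify_apply (s₀ : NormalSection W) {C : Set (Euc m)} (hC : IsCompact C)
    (f : Euc m → Euc m) (hf : ContDiffOn ℝ ∞ f W) (hfN : ∀ x ∈ W, (x, f x) ∈ normalBundle W)
    (hfC : ∀ x ∈ W, x ∉ C → f x = s₀.toFun x) {x : Euc m} (hx : x ∈ W) :
    (s₀.modify hC f hf hfN hfC).toFun x = f x := Set.indicator_of_mem hx f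

/-- If near a compact set `K` the fibre over `a₀` of a closed smooth family agrees with the image
of a section of a tubular neighbourhood, then so do the nearby fibres, for nearby sections. -/
theorem IsTubularRetraction.eventually_exists_section {d : ℕ} (hπ : IsTubularRetraction W N Ω π)
    (hN : IsTubularNeighbourhood W N) (hW : IsClosedSubmanifold d W) (s₀ : NormalSection W)
    (hs₀N : ∀ x ∈ W, (x, s₀.toFun x) ∈ N) {Γ : Set (X × Euc m)} {a₀ : X}
    (hcl : ∀ y, (a₀, y) ∉ Γ → ∀ᶠ q in 𝓝 (a₀, y), q ∉ Γ)
    (hfib : ∀ y, (a₀, y) ∈ Γ → IsFiberedAt d Γ (a₀, y))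
    {K V₀ : Set (Euc m)} (hK : IsCompact K) (hV₀ : IsOpen V₀) (hKV₀ : K ⊆ V₀)
    (hagree : ∀ y ∈ V₀, (a₀, y) ∈ Γ ↔ y ∈ sectionImage s₀)
    {V : Set (NormalSection W)} (hV : IsOpen[strongTopology W] V) (hs₀V : s₀ ∈ V) :
    ∀ᶠ a in 𝓝 a₀, ∃ s : NormalSection W, (∀ x ∈ W, (x, s.toFun x) ∈ N) ∧ s ∈ V ∧
      ∃ V', IsOpen V' ∧ K ⊆ V' ∧ ∀ y ∈ V', (a, y) ∈ Γ ↔ y ∈ sectionImage s := by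
  have hclosed := (isClosedSubmanifold_sectionImage hN hW s₀ hs₀N).1
  -- Agreement of nearby fibres will be proved on the compact `K'`, which contains an open
  -- thickening of `K`, as agreement of germs requires.
  obtain ⟨δ, hδ, hδV₀⟩ := hK.exists_cthickening_subset_open hV₀ hKV₀
  set K' := Metric.cthickening δ K with hK'
  have hK'c : IsCompact K' := hK.cthickening
  have hsΩ : sectionImage s₀ ⊆ Ω := by
    rintro _ ⟨x, hx, rfl⟩
    exact (hπ.add_mem x _ (hs₀N x hx)).1
  set C := π '' (K' ∩ sectionImage s₀) with hC
  have hCc : IsCompact C := (hK'c.inter_right hclosed).image_of_continuousOn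
    (hπ.smooth.continuousOn.mono (Set.inter_subset_right.trans hsΩ))
  have hCspec : ∀ x ∈ C, x ∈ W ∧ x + s₀.toFun x ∈ K' := by
    rintro _ ⟨_, ⟨hy, x, hx, rfl⟩, rfl⟩
    simp only [(hπ.add_mem x _ (hs₀N x hx)).2]
    exact ⟨hx, hy⟩
  obtain ⟨A, B, σ, hA, ha₀, hB, hCB, hσ, hσN, hσ₀, hσu⟩ := hπ.exists_glued_section hW.2 s₀.smooth
    hs₀N (Γ := Γ) (a₀ := a₀) hCc (fun x hx => (hCspec x hx).1)
    (fun x hx => hfib _ ((hagree _ (hδV₀ (hCspec x hx).2)).2 ⟨x, (hCspec x hx).1, rfl⟩))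
    (fun x hx => by
      filter_upwards [hV₀.mem_nhds (hδV₀ (hCspec x hx).2)] with y hy using hagree y hy)
  obtain ⟨χ, C₁, C₂, hχ, hC₁, hCC₁, hC₁B, hC₂, hC₂B, hχ1, hχ0⟩ := exists_cutoff hCc hB hCB
  -- The glued sections exist only near `C`. The cutoff extends them by `s₀`, which keeps the
  -- support compact and makes the family constant outside `C₂`.
  set σ' : X × Euc m → Euc m :=
    fun q => s₀.toFun q.2 + χ q.2 • (σ q - s₀.toFun q.2) with hσ'
  have hs₀snd : ContDiffOn ℝ ∞ (fun q : X × Euc m => s₀.toFun q.2) (A ×ˢ W) :=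
    s₀.smooth.comp contDiff_snd.contDiffOn fun q hq => hq.2
  have hσ'off : ∀ a, ∀ x ∉ C₂, σ' (a, x) = s₀.toFun x := by
    intro a x hx
    simp only [hσ', hχ0 x hx, zero_smul, add_zero]
  have hσ's : ContDiffOn ℝ ∞ σ' (A ×ˢ W) := by
    rintro ⟨a, x⟩ ⟨ha, hx⟩
    by_cases hxB : x ∈ B
    · have h1 : ContDiffWithinAt ℝ ∞ σ' (A ×ˢ (W ∩ B)) (a, x) := by
        have h2 := hs₀snd.mono (Set.prod_mono (subset_refl A) (Set.inter_subset_left (t := B)))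
        exact (h2.add ((hχ.comp contDiff_snd).contDiffOn.smul (hσ.sub h2))) _ ⟨ha, hx, hxB⟩
      refine h1.mono_of_mem_nhdsWithin ?_
      have h3 : Prod.snd ⁻¹' B ∈ 𝓝[A ×ˢ W] (a, x) :=
        mem_nhdsWithin_of_mem_nhds ((hB.preimage continuous_snd).mem_nhds hxB)
      filter_upwards [h3, self_mem_nhdsWithin] with q hq hq' using ⟨hq'.1, hq'.2, hq⟩
    · have hxC₂ : x ∉ C₂ := fun h => hxB (hC₂B h)
      refine (hs₀snd _ ⟨ha, hx⟩).congr_of_eventuallyEq ?_ (hσ'off a x hxC₂)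
      have h3 : Prod.snd ⁻¹' C₂ᶜ ∈ 𝓝[A ×ˢ W] (a, x) :=
        mem_nhdsWithin_of_mem_nhds
          ((hC₂.isClosed.isOpen_compl.preimage continuous_snd).mem_nhds hxC₂)
      filter_upwards [h3] with q hq using hσ'off q.1 q.2 hq
  have hσ'₀ : ∀ x ∈ W, σ' (a₀, x) = s₀.toFun x := by
    intro x hx
    by_cases hxB : x ∈ B
    · simp only [hσ', hσ₀ x hx hxB, sub_self, smul_zero, add_zero]
    · exact hσ'off a₀ x fun h => hxB (hC₂B h)
  have hσ'N : ∀ a ∈ A, ∀ x ∈ W, (x, σ' (a, x)) ∈ normalBundle W := by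
    intro a ha x hx
    by_cases hxB : x ∈ B
    · have h1 := normalBundle_add_smul (hπ.subset_normalBundle (hσN a ha x hx hxB).1)
        (s₀.normal x hx) (-1)
      rw [neg_one_smul, ← sub_eq_add_neg] at h1
      exact normalBundle_add_smul (s₀.normal x hx) h1 (χ x)
    · rw [hσ'off a x fun h => hxB (hC₂B h)]
      exact s₀.normal x hx
  have hstrong : ∀ {V : Set (NormalSection W)}, IsOpen[strongTopology W] V → s₀ ∈ V →
      ∀ᶠ a in 𝓝 a₀, ∀ t : NormalSection W, (∀ x ∈ W, t.toFun x = σ' (a, x)) → t ∈ V :=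
    fun hV hs => hπ.eventually_mem_strong hW.1 hA ha₀ hσ's s₀ hσ'₀ hC₂
      (fun a _ x _ hx => hσ'off a x hx) hV hs
  obtain ⟨ε, hε, hεpos, hεN⟩ := hN.exists_radius s₀.smooth hs₀N
  have hsa : ∀ a ∈ A, ∃ t : NormalSection W, ∀ x ∈ W, t.toFun x = σ' (a, x) := by
    intro a ha
    exact ⟨s₀.modify hC₂ (fun x => σ' (a, x))
      (hσ's.comp (contDiff_prodMk_right a).contDiffOn fun x hx => ⟨ha, hx⟩) (hσ'N a ha)
      fun x _ hx => hσ'off a x hx, fun x hx => NormalSection.modify_apply _ _ _ _ _ _ hx⟩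
  have hevN : ∀ᶠ a in 𝓝 a₀, ∀ t : NormalSection W, (∀ x ∈ W, t.toFun x = σ' (a, x)) →
      ∀ x ∈ W, (x, t.toFun x) ∈ N := by
    filter_upwards [hstrong (isOpen_strong_norm_lt s₀ hε hεpos) (fun x hx => by
      simpa using hεpos x hx)] with a ha t ht x hx
    exact hεN x hx _ (t.normal x hx) (ha t ht x hx)
  have hclose : ∀ η > 0, ∀ᶠ a in 𝓝 a₀, a ∈ A → ∀ x ∈ W, ‖σ' (a, x) - s₀.toFun x‖ < η := by
    intro η hη
    filter_upwards [hstrong (isOpen_strong_norm_lt s₀ (continuousOn_const (c := η)) fun _ _ => hη)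
      (fun x hx => by simpa using hη)] with a ha haA x hx
    obtain ⟨t, ht⟩ := hsa a haA
    rw [← ht x hx]
    exact ha t ht x hx
  -- By compactness it suffices to argue near each point of `K'`. On the image of `s₀` this is local
  -- uniqueness of the section. Off it, `Γ` stays away by `hcl`, and the perturbed image by uniform
  -- closeness.
  have hevK : ∀ᶠ a in 𝓝 a₀, ∀ y ∈ K', (a, y) ∈ Γ ↔ y ∈ (fun x => x + σ' (a, x)) '' W := by
    refine hK'c.eventually_forall_of_forall_eventually fun y hy => ?_
    have hAev : ∀ᶠ q : X × Euc m in 𝓝 (a₀, y), q.1 ∈ A :=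
      (hA.preimage continuous_fst).mem_nhds ha₀
    by_cases hyΓ : y ∈ sectionImage s₀
    · obtain ⟨x, hx, rfl⟩ := hyΓ
      obtain ⟨hΩ, hπx⟩ := hπ.add_mem x _ (hs₀N x hx)
      have hxC : x ∈ C := ⟨x + s₀.toFun x, ⟨hy, x, hx, rfl⟩, hπx⟩
      have hπc : ContinuousAt (fun q : X × Euc m => π q.2) (a₀, x + s₀.toFun x) :=
        ContinuousAt.comp (g := π) (hπ.smooth.continuousOn.continuousAt (hπ.isOpen.mem_nhds hΩ))
          continuousAt_snd
      have e1 : ∀ᶠ q : X × Euc m in 𝓝 (a₀, x + s₀.toFun x), π q.2 ∈ C₁ :=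
        hπc.preimage_mem_nhds (by rw [hπx]; exact hC₁.mem_nhds (hCC₁ hxC))
      have e2 : ∀ᶠ q : X × Euc m in 𝓝 (a₀, x + s₀.toFun x), q.2 ∈ Ω :=
        (hπ.isOpen.preimage continuous_snd).mem_nhds hΩ
      have e3 := (continuous_fst.tendsto (a₀, x + s₀.toFun x)).eventually hevN
      filter_upwards [hAev, e1, e2, e3, hσu x hxC] with q hqA h1 h2 h3 h4
      have hσeq : ∀ x ∈ C₁, σ' (q.1, x) = σ (q.1, x) := by
        intro x hx
        simp only [hσ', hχ1 x hx, one_smul, add_sub_cancel]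
      constructor
      · intro hqΓ
        refine ⟨π q.2, hπ.proj_mem h2, ?_⟩
        simp only
        rw [hσeq _ h1]
        exact (h4 hqΓ).symm
      · rintro ⟨x', hx', hq⟩
        simp only at hq
        obtain ⟨t, ht⟩ := hsa q.1 hqA
        have h5 := h3 t ht x' hx'
        rw [ht x' hx'] at h5
        have h6 := (hπ.add_mem _ _ h5).2
        rw [hq] at h6
        rw [h6] at h1
        rw [hσeq x' h1] at hq
        have := (hσN q.1 hqA x' hx' (hC₁B h1)).2
        rwa [hq] at this
    · have hnΓ : (a₀, y) ∉ Γ := fun h => hyΓ ((hagree y (hδV₀ hy)).1 h)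
      obtain ⟨η, hη, hball⟩ := Metric.isOpen_iff.1 hclosed.isOpen_compl y hyΓ
      have e1 := (continuous_fst.tendsto (a₀, y)).eventually (hclose (η / 2) (by linarith))
      have e2 : ∀ᶠ q : X × Euc m in 𝓝 (a₀, y), q.2 ∈ Metric.ball y (η / 2) :=
        (Metric.isOpen_ball.preimage continuous_snd).mem_nhds (Metric.mem_ball_self (by linarith))
      filter_upwards [hAev, hcl y hnΓ, e1, e2] with q hqA h1 h2 h3
      refine iff_of_false h1 ?_
      rintro ⟨x, hx, hq⟩
      refine absurd (⟨x, hx, rfl⟩ : x + s₀.toFun x ∈ sectionImage s₀) (hball ?_)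
      have h4 := h2 hqA x hx
      rw [Metric.mem_ball, dist_eq_norm] at h3 ⊢
      simp only at hq
      have h5 : x + s₀.toFun x - y = (q.2 - y) - (σ' (q.1, x) - s₀.toFun x) := by
        rw [← hq]; abel
      rw [h5]
      linarith [norm_sub_le (q.2 - y) (σ' (q.1, x) - s₀.toFun x)]
  filter_upwards [hA.mem_nhds ha₀, hevN, hevK, hstrong hV hs₀V] with a haA h1 h2 h3
  obtain ⟨t, ht⟩ := hsa a haA
  refine ⟨t, h1 t ht, h3 t ht, Metric.thickening δ K, Metric.isOpen_thickening,
    Metric.self_subset_thickening hδ K, fun y hy => ?_⟩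
  rw [h2 y (Metric.thickening_subset_cthickening _ _ hy), sectionImage]
  have : (fun x => x + σ' (a, x)) '' W = (fun x => x + t.toFun x) '' W :=
    Set.image_congr fun x hx => by rw [ht x hx]
  rw [this]

/-- Continuity of plots, in terms of the charts of `ψ_d(ℝ^m)`. -/
theorem IsPlot.eventually_exists_section {d n : ℕ} {U : Type} [TopologicalSpace U]
    [ChartedSpace (Euc n) U] [IsManifold 𝓘(ℝ, Euc n) ∞ U] {p : U → Psi d m}
    (hp : IsPlot (n := n) p) (u₀ : U) {W : Psi d m} {N : Set (Euc m × Euc m)}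
    (hN : IsTubularNeighbourhood W.1 N) (s₀ : ChartDomain W N) {K : Set (Euc m)}
    (hK : IsCompact K) (hagree : germSetoid d m K (p u₀) (chartMap W N s₀))
    {V : Set (NormalSection W.1)} (hV : IsOpen[strongTopology W.1] V) (hs₀V : s₀.1 ∈ V) :
    ∀ᶠ u in 𝓝 u₀, ∃ s : ChartDomain W N, s.1 ∈ V ∧
      germSetoid d m K (p u) (chartMap W N s) := by
  obtain ⟨Ω, π, hπ⟩ := hN.exists_retraction
  obtain ⟨V₀, hV₀, hKV₀, hV₀eq⟩ := hagree
  set c := chartAt (Euc n) u₀ with hc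
  have hu₀ : u₀ ∈ c.source := mem_chart_source _ u₀
  have hΓ₀ : ∀ u ∈ c.source, ∀ y, (c u, y) ∈ chartGraph c p ↔ y ∈ (p u).1 := by
    intro u hu y
    change c u ∈ c.target ∧ y ∈ (p (c.symm (c u))).1 ↔ _
    rw [c.left_inv hu]
    exact and_iff_right (c.map_source hu)
  have h := hπ.eventually_exists_section hN W.2 s₀.1 s₀.2.1 (Γ := chartGraph c p) (a₀ := c u₀)
    ?_ ?_ hK hV₀ hKV₀ ?_ hV hs₀V
  · filter_upwards [(c.continuousAt hu₀).eventually h, c.open_source.mem_nhds hu₀] with u hu hus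
    obtain ⟨s, hsN, hsV, V', hV', hKV', heq⟩ := hu
    refine ⟨⟨s, hsN, isClosedSubmanifold_sectionImage hN W.2 s hsN⟩, hsV, V', hV', hKV', ?_⟩
    ext y
    constructor
    · rintro ⟨h1, h2⟩
      exact ⟨(heq y h2).1 ((hΓ₀ u hus y).2 h1), h2⟩
    · rintro ⟨h1, h2⟩
      exact ⟨(hΓ₀ u hus y).1 ((heq y h2).2 h1), h2⟩
  · intro y hy
    rw [hΓ₀ u₀ hu₀] at hy
    have hcont : ContinuousAt (fun q : Euc n × Euc m => (c.symm q.1, q.2)) (c u₀, y) :=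
      (ContinuousAt.comp (f := Prod.fst) (g := c.symm) (x := (c u₀, y))
        (c.continuousAt_symm (c.map_source hu₀)) continuousAt_fst).prodMk continuousAt_snd
    have hmem : (plotGraph p)ᶜ ∈ 𝓝 (c.symm (c u₀), y) := by
      rw [c.left_inv hu₀]
      exact hp.isClosed_graph.isOpen_compl.mem_nhds hy
    filter_upwards [hcont.preimage_mem_nhds hmem] with q hq hqΓ
    exact hq hqΓ.2
  · intro y hy
    exact hp.isFiberedAt u₀ ((hΓ₀ u₀ hu₀ y).1 hy)
  · intro y hy
    rw [hΓ₀ u₀ hu₀]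
    have := Set.ext_iff.1 hV₀eq y
    simpa [hy] using! this

end NearbySections

end

noncomputable section

/-! ### Termwise differentiation of series -/

section SmoothSeries

/-- Suppose that the derivatives of a family of sequences of functions are linear combinations of
sequences of the family, with smooth coefficients. If all sequences of the family have summable
bounds, then their sums are smooth. -/
theorem contDiffOn_tsum_of_hasFDerivAt {α ι Q F : Type*} [Fintype ι] [NormedAddCommGroup Q]
    [NormedSpace ℝ Q] [NormedAddCommGroup F] [NormedSpace ℝ F] [CompleteSpace F] {S : Set Q}
    (hS : IsOpen S) (next : α → ι → α) {G : α → ℕ → Q → F} {lam : ι → Q → Q →L[ℝ] ℝ}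
    (hlam : ∀ i, ContDiffOn ℝ ∞ (lam i) S)
    (hG : ∀ α n, ∀ q ∈ S,
      HasFDerivAt (G α n) (∑ i, (lam i q).smulRight (G (next α i) n q)) q)
    {u : α → ℕ → ℝ} (hu : ∀ α, Summable (u α)) (hGu : ∀ α n, ∀ q ∈ S, ‖G α n q‖ ≤ u α n)
    (α₀ : α) : ContDiffOn ℝ ∞ (fun q => ∑' n, G α₀ n q) S := by
  have hsum : ∀ α, ∀ q ∈ S, Summable fun n => G α n q := fun α q hq =>
    Summable.of_norm_bounded (hu α) fun n => hGu α n q hq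
  have hderiv : ∀ α, ∀ q ∈ S, HasFDerivAt (fun q => ∑' n, G α n q)
      (∑ i, (lam i q).smulRight (∑' n, G (next α i) n q)) q := by
    intro α q hq
    -- Termwise differentiation needs uniform bounds, but the coefficients are bounded only locally;
    -- hence the passage to a small ball.
    have hev : ∀ᶠ q' in 𝓝 q, ∀ i, ‖lam i q'‖ < ‖lam i q‖ + 1 := by
      rw [Filter.eventually_all]
      intro i
      exact ((hlam i).continuousOn.continuousAt (hS.mem_nhds hq)).norm.eventually_lt
        continuousAt_const (lt_add_one _)
    obtain ⟨r, hr, hball⟩ := Metric.eventually_nhds_iff_ball.1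
      (hev.and (hS.mem_nhds hq))
    have h := hasFDerivAt_tsum_of_isPreconnected (𝕜 := ℝ) (s := Metric.ball q r)
      (u := fun n => ∑ i, (‖lam i q‖ + 1) * u (next α i) n)
      (f := G α) (f' := fun n q => ∑ i, (lam i q).smulRight (G (next α i) n q))
      (summable_sum fun i _ => (hu _).mul_left _) Metric.isOpen_ball
      (convex_ball q r).isPreconnected (fun n q' hq' => hG α n q' (hball q' hq').2) ?_
      (Metric.mem_ball_self hr) (hsum α q hq) (Metric.mem_ball_self hr)
    · convert h using 1
      rw [Summable.tsum_finsetSum]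
      · refine Finset.sum_congr rfl fun i _ => ?_
        exact (ContinuousLinearMap.map_tsum (ContinuousLinearMap.smulRightL ℝ Q F (lam i q))
          (hsum (next α i) q hq))
      · intro i _
        exact (ContinuousLinearMap.summable (ContinuousLinearMap.smulRightL ℝ Q F (lam i q))
          (hsum (next α i) q hq))
    · intro n q' hq'
      refine (norm_sum_le _ _).trans (Finset.sum_le_sum fun i _ => ?_)
      rw [ContinuousLinearMap.norm_smulRight_apply]
      exact mul_le_mul ((hball q' hq').1 i).le (hGu _ _ _ (hball q' hq').2) (norm_nonneg _)
        (by positivity)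
  rw [contDiffOn_infty]
  intro k
  -- The derivative of one sum involves other members of the family, so the induction must treat all
  -- of them together.
  induction k generalizing α₀ with
  | zero =>
    exact contDiffOn_zero.2 fun q hq => (hderiv α₀ q hq).continuousAt.continuousWithinAt
  | succ k ih =>
    push_cast
    rw [contDiffOn_succ_iff_fderiv_of_isOpen hS]
    refine ⟨fun q hq => (hderiv α₀ q hq).differentiableAt.differentiableWithinAt, by simp, ?_⟩
    refine ContDiffOn.congr (f := fun q => ∑ i, (lam i q).smulRight (∑' n, G (next α₀ i) n q))
      (ContDiffOn.sum fun i _ => ?_) fun q hq => (hderiv α₀ q hq).fderiv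
    exact ContDiffOn.smulRight ((hlam i).of_le (by exact_mod_cast le_top)) (ih (next α₀ i))

end SmoothSeries

end

noncomputable section

/-! ### Bump functions at the dyadic points -/

section Bumps

theorem exists_bound_iteratedDeriv {β : ℝ → ℝ} (hβ : ContDiff ℝ ∞ β) (hc : HasCompactSupport β)
    (a : ℕ) : ∃ C, ∀ t, ‖iteratedDeriv a β t‖ ≤ C := by
  obtain ⟨C, hC⟩ := (hc.iteratedFDeriv (𝕜 := ℝ) a).exists_bound_of_continuous
    (hβ.continuous_iteratedFDeriv (m := a) (by exact_mod_cast le_top))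
  exact ⟨C, fun t => by rw [← norm_iteratedFDeriv_eq_norm_iteratedDeriv]; exact hC t⟩

/-- The support radius `1 / 4` makes the rescalings by powers of two disjoint. The plateau of radius
`1 / 8` leaves a full interval around each time `2⁻ⁿ` on which a section is constant. -/
theorem exists_dyadic_bump : ∃ β : ℝ → ℝ, ContDiff ℝ ∞ β ∧ HasCompactSupport β ∧
    (∀ τ, 0 ≤ β τ ∧ β τ ≤ 1) ∧ (∀ τ, |τ - 1| ≤ 1 / 8 → β τ = 1) ∧
    ∀ τ, 1 / 4 ≤ |τ - 1| → β τ = 0 := by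
  let f : ContDiffBump (1 : ℝ) := ⟨1 / 8, 1 / 4, by norm_num, by norm_num⟩
  refine ⟨f, f.contDiff, f.hasCompactSupport, fun τ => ⟨f.nonneg, f.le_one⟩, fun τ hτ => ?_,
    fun τ hτ => ?_⟩
  · exact f.one_of_mem_closedBall (by rw [Metric.mem_closedBall, Real.dist_eq]; exact hτ)
  · exact f.zero_of_le_dist (by rw [Real.dist_eq]; exact hτ)

/-- If `2 ^ n * t` exceeds `3/4`, every later doubling exceeds `3/2`, which is beyond `5/4`. -/
theorem eq_of_dyadic {t : ℝ} {n k : ℕ} (hn : |2 ^ n * t - 1| < 1 / 4)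
    (hk : |2 ^ k * t - 1| < 1 / 4) : n = k := by
  have key : ∀ {n k : ℕ}, |2 ^ n * t - 1| < 1 / 4 → |2 ^ k * t - 1| < 1 / 4 → ¬ n < k := by
    intro n k hn hk hlt
    rw [abs_lt] at hn hk
    obtain ⟨j, rfl⟩ := Nat.exists_eq_add_of_lt hlt
    have h1 : (2 : ℝ) ^ (n + j + 1) * t = 2 ^ j * (2 * (2 ^ n * t)) := by ring
    have h2 : (1 : ℝ) ≤ 2 ^ j := one_le_pow₀ (by norm_num)
    nlinarith
  exact le_antisymm (not_lt.1 (key hk hn)) (not_lt.1 (key hn hk))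

variable {F : Type*} [NormedAddCommGroup F] [NormedSpace ℝ F] {β : ℝ → ℝ}

theorem tsum_bump_eq (hβ : ∀ τ, 1 / 4 ≤ |τ - 1| → β τ = 0) (f : ℕ → F) {t : ℝ} {n : ℕ}
    (hn : |2 ^ n * t - 1| < 1 / 4) : ∑' k, β (2 ^ k * t) • f k = β (2 ^ n * t) • f n := by
  refine tsum_eq_single n fun k hk => ?_
  rw [hβ _ (not_lt.1 fun h => hk (eq_of_dyadic h hn)), zero_smul]

theorem tsum_bump_eq_zero (hβ : ∀ τ, 1 / 4 ≤ |τ - 1| → β τ = 0) (f : ℕ → F) {t : ℝ}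
    (hn : ∀ n : ℕ, 1 / 4 ≤ |2 ^ n * t - 1|) : ∑' k, β (2 ^ k * t) • f k = 0 := by
  exact (tsum_congr fun k => by rw [hβ _ (hn k), zero_smul]).trans tsum_zero

theorem dyadic_of_nonpos {t : ℝ} (ht : t ≤ 0) (n : ℕ) : 1 ≤ |2 ^ n * t - 1| := by
  have h2 : (0 : ℝ) ≤ 2 ^ n := by positivity
  rw [le_abs]
  right
  nlinarith

theorem hasDerivAt_dyadic_scale (hβ : ContDiff ℝ ∞ β) (a n : ℕ) (t : ℝ) :
    HasDerivAt (fun t => ((2 : ℝ) ^ n) ^ a * iteratedDeriv a β (2 ^ n * t))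
      (((2 : ℝ) ^ n) ^ (a + 1) * iteratedDeriv (a + 1) β (2 ^ n * t)) t := by
  have h1 : HasDerivAt (iteratedDeriv a β) (iteratedDeriv (a + 1) β (2 ^ n * t)) (2 ^ n * t) := by
    rw [iteratedDeriv_succ]
    exact (hβ.differentiable_iteratedDeriv a (by exact_mod_cast WithTop.coe_lt_top _)
      (2 ^ n * t)).hasDerivAt
  have h2 : HasDerivAt (fun t : ℝ => 2 ^ n * t) (2 ^ n) t := by
    simpa using (hasDerivAt_id t).const_mul ((2 : ℝ) ^ n)
  have h3 := (HasDerivAt.comp (h := fun t : ℝ => 2 ^ n * t) t h1 h2).const_mul (((2 : ℝ) ^ n) ^ a)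
  exact h3.congr_deriv (by ring)

/-- Each time derivative of a rescaled bump costs a factor `2 ^ n`; factorial decay absorbs any
fixed number of them. -/
theorem summable_pow_mul_inv_factorial (a : ℕ) :
    Summable fun n : ℕ => ((2 : ℝ) ^ n) ^ a * (1 / n.factorial) := by
  refine (Real.summable_pow_div_factorial (2 ^ a)).congr fun n => ?_
  rw [← pow_mul, ← pow_mul, mul_comm a n]
  ring

theorem contDiff_bump_series (hβ : ContDiff ℝ ∞ β) (hc : HasCompactSupport β) :
    ContDiff ℝ ∞ (fun t : ℝ => ∑' n : ℕ, β (2 ^ n * t) • (1 / n.factorial : ℝ)) := by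
  choose C hC using exists_bound_iteratedDeriv hβ hc
  rw [← contDiffOn_univ]
  have h := contDiffOn_tsum_of_hasFDerivAt (α := ℕ) (ι := Unit) (F := ℝ) (S := Set.univ)
    isOpen_univ (fun a _ => a + 1)
    (G := fun a n t => ((2 : ℝ) ^ n) ^ a * iteratedDeriv a β (2 ^ n * t) * (1 / n.factorial))
    (lam := fun _ _ => ContinuousLinearMap.id ℝ ℝ) (fun _ => contDiffOn_const) (fun a n t _ => ?_)
    (u := fun a n => C a * (((2 : ℝ) ^ n) ^ a * (1 / n.factorial)))
    (fun a => (summable_pow_mul_inv_factorial a).mul_left _) (fun a n t _ => ?_) 0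
  · simpa using h
  · have h1 := ((hasDerivAt_dyadic_scale hβ a n t).mul_const (1 / n.factorial : ℝ)).hasFDerivAt
    refine h1.congr_fderiv ?_
    ext
    simp
  · rw [norm_mul, norm_mul, norm_pow, norm_pow, Real.norm_ofNat,
      Real.norm_of_nonneg (by positivity : (0 : ℝ) ≤ 1 / n.factorial)]
    nlinarith [mul_le_mul_of_nonneg_right (hC a (2 ^ n * t))
      (by positivity : (0 : ℝ) ≤ ((2 : ℝ) ^ n) ^ a * (1 / n.factorial))]

end Bumps

/-! ### Smooth series of sections -/

section SectionSeries

variable {m : ℕ} {W : Set (Euc m)} {N : Set (Euc m × Euc m)} {Ω : Set (Euc m)}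
  {π : Euc m → Euc m}

/-- The tangential parts of the coordinate vector fields, for a list of coordinate directions. -/
def projFields (π : Euc m → Euc m) (w : List (Fin m)) : List (Euc m → Euc m) :=
  w.map fun i x => fderiv ℝ π x (EuclideanSpace.single i 1)

theorem IsTubularRetraction.isTangentField_of_mem_projFields (hπ : IsTubularRetraction W N Ω π)
    (w : List (Fin m)) : ∀ X ∈ projFields π w, IsTangentField W X := by
  intro X hX
  obtain ⟨i, -, rfl⟩ := List.mem_map.1 hX
  exact hπ.isTangentField_fderiv _

theorem IsTubularRetraction.fderiv_comp_proj (hπ : IsTubularRetraction W N Ω π)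
    {h : Euc m → Euc m} (hh : ContDiffOn ℝ ∞ h W) {y : Euc m} (hy : y ∈ Ω) (k : Euc m) :
    fderiv ℝ (fun y => h (π y)) y k = fderiv ℝ (fun y => h (π y)) (π y) (fderiv ℝ π y k) := by
  have hd : ∀ y ∈ Ω, DifferentiableAt ℝ (fun y => h (π y)) y := fun y hy =>
    ((hπ.contDiffOn_comp hh).contDiffAt (hπ.isOpen.mem_nhds hy)).differentiableAt (by simp)
  have h1 : HasFDerivAt (fun y => h (π (π y)))
      ((fderiv ℝ (fun y => h (π y)) (π y)).comp (fderiv ℝ π y)) y :=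
    HasFDerivAt.comp (g := fun y => h (π y)) y
      (hd _ (hπ.subset (hπ.proj_mem hy))).hasFDerivAt
      ((hπ.smooth.contDiffAt (hπ.isOpen.mem_nhds hy)).differentiableAt (by simp)).hasFDerivAt
  have h2 : HasFDerivAt (fun y => h (π y))
      ((fderiv ℝ (fun y => h (π y)) (π y)).comp (fderiv ℝ π y)) y := by
    refine h1.congr_of_eventuallyEq ?_
    filter_upwards [hπ.isOpen.mem_nhds hy] with z hz
    rw [hπ.proj_eq (hπ.proj_mem hz)]
  rw [h2.fderiv]
  rfl

/-- By idempotence of `π`, the differential of `h ∘ π` factors through that of `π`. Expanding in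
coordinates leaves only derivatives along the tangent fields of `projFields`, with coefficients
independent of `h`. This is the closure property that `contDiffOn_tsum_of_hasFDerivAt` requires. -/
theorem IsTubularRetraction.fderiv_comp_proj_eq_sum (hπ : IsTubularRetraction W N Ω π)
    {h : Euc m → Euc m} (hh : ContDiffOn ℝ ∞ h W) {y : Euc m} (hy : y ∈ Ω) (k : Euc m) :
    fderiv ℝ (fun y => h (π y)) y k = ∑ i, (fderiv ℝ π y k) i •
      fderivWithin ℝ h W (π y) (fderiv ℝ π (π y) (EuclideanSpace.single i 1)) := by
  have hx := hπ.proj_mem hy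
  have hi : ∀ i : Fin m,
      fderivWithin ℝ h W (π y) (fderiv ℝ π (π y) (EuclideanSpace.single i 1)) =
        fderiv ℝ (fun y => h (π y)) (π y) (EuclideanSpace.single i 1) := by
    intro i
    rw [hπ.fderivWithin_apply hh hx ((hπ.isTangentField_fderiv _).2 _ hx),
      hπ.fderiv_comp_proj hh (hπ.subset hx) (EuclideanSpace.single i 1), hπ.proj_eq hx]
  simp_rw [hi]
  rw [hπ.fderiv_comp_proj hh hy k]
  conv_lhs => rw [← (EuclideanSpace.basisFun (Fin m) ℝ).sum_repr (fderiv ℝ π y k)]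
  rw [map_sum]
  refine Finset.sum_congr rfl fun i _ => ?_
  rw [map_smul]
  simp

/-- A series of rapidly decreasing sections, switched on one after another, is smooth in time
and space. -/
theorem IsTubularRetraction.contDiffOn_bump_series (hπ : IsTubularRetraction W N Ω π)
    {β : ℝ → ℝ} (hβ : ContDiff ℝ ∞ β) (hc : HasCompactSupport β) {f : ℕ → Euc m → Euc m}
    (hf : ∀ n, ContDiffOn ℝ ∞ (f n) W)
    (hb : ∀ w : List (Fin m), ∃ b : ℕ → ℝ, (∀ n, ∀ x ∈ W,
      ‖iteratedFieldDeriv W (projFields π w) (f n) x‖ ≤ b n) ∧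
        ∀ a : ℕ, Summable fun n => ((2 : ℝ) ^ n) ^ a * b n) :
    ContDiffOn ℝ ∞ (fun q : ℝ × Euc m => ∑' n, β (2 ^ n * q.1) • f n q.2)
      (Set.univ ×ˢ W) := by
  choose C hC using exists_bound_iteratedDeriv hβ hc
  choose b hbn hbs using hb
  set D : List (Fin m) → ℕ → Euc m → Euc m :=
    fun w n => iteratedFieldDeriv W (projFields π w) (f n) with hD
  have hDs : ∀ w n, ContDiffOn ℝ ∞ (D w n) W := fun w n =>
    hπ.contDiffOn_iteratedFieldDeriv (hf n) (hπ.isTangentField_of_mem_projFields w)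
  -- An index `(a, w)` stands for `a` time derivatives and the field derivatives listed in `w`.
  -- `none` differentiates once more in time; `some i` prepends the `i`-th projected field.
  have h := contDiffOn_tsum_of_hasFDerivAt (α := ℕ × List (Fin m)) (ι := Option (Fin m))
    (Q := ℝ × Euc m) (F := Euc m) (S := Set.univ ×ˢ Ω) (isOpen_univ.prod hπ.isOpen)
    (fun α i => Option.elim i (α.1 + 1, α.2) fun i => (α.1, i :: α.2))
    (G := fun α n q => (((2 : ℝ) ^ n) ^ α.1 * iteratedDeriv α.1 β (2 ^ n * q.1)) •
      D α.2 n (π q.2))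
    (lam := fun i q => Option.elim i (ContinuousLinearMap.fst ℝ ℝ (Euc m)) fun i =>
      (EuclideanSpace.proj i).comp
        ((fderiv ℝ π q.2).comp (ContinuousLinearMap.snd ℝ ℝ (Euc m)))) ?_ ?_
    (u := fun α n => C α.1 * (((2 : ℝ) ^ n) ^ α.1 * b α.2 n))
    (fun α => (hbs _ _).mul_left _) ?_ (0, [])
  · refine (h.mono (Set.prod_mono subset_rfl hπ.subset)).congr fun q hq => ?_
    refine tsum_congr fun n => ?_
    simp only [pow_zero, iteratedDeriv_zero, one_mul]
    rw [hπ.proj_eq hq.2]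
    rfl
  · rintro (_ | i)
    · exact contDiffOn_const
    · simp only [Option.elim_some]
      have h1 : ContDiffOn ℝ ∞ (fun q : ℝ × Euc m => fderiv ℝ π q.2) (Set.univ ×ˢ Ω) :=
        (hπ.smooth.fderiv_of_isOpen hπ.isOpen (m := ∞) (by simp)).comp
          contDiff_snd.contDiffOn fun q hq => hq.2
      exact contDiffOn_const.clm_comp (h1.clm_comp contDiffOn_const)
  · rintro ⟨a, w⟩ n ⟨t, y⟩ ⟨-, hy⟩
    have h1 : HasFDerivAt (fun q : ℝ × Euc m =>
        ((2 : ℝ) ^ n) ^ a * iteratedDeriv a β (2 ^ n * q.1)) _ (t, y) :=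
      HasFDerivAt.comp (g := fun t => ((2 : ℝ) ^ n) ^ a * iteratedDeriv a β (2 ^ n * t)) (t, y)
        (hasDerivAt_dyadic_scale hβ a n t).hasFDerivAt hasFDerivAt_fst
    have h2 : HasFDerivAt (fun q : ℝ × Euc m => D w n (π q.2)) _ (t, y) :=
      HasFDerivAt.comp (g := fun y => D w n (π y)) (t, y)
        (((hπ.contDiffOn_comp (hDs w n)).contDiffAt
          (hπ.isOpen.mem_nhds hy)).differentiableAt (by simp)).hasFDerivAt hasFDerivAt_snd
    have h3 := h1.smul h2
    refine h3.congr_fderiv ?_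
    refine ContinuousLinearMap.ext fun ⟨τ, k⟩ => ?_
    simp
    rw [hπ.fderiv_comp_proj_eq_sum (hDs w n) hy, add_comm, mul_smul, Finset.smul_sum]
    congr 1
    exact Finset.sum_congr rfl fun i _ => smul_comm _ _ _
  · rintro ⟨a, w⟩ n ⟨t, y⟩ ⟨-, hy⟩
    simp only
    rw [norm_smul, norm_mul, norm_pow, norm_pow, Real.norm_ofNat]
    have h1 := hC a (2 ^ n * t)
    have h2 := hbn w n (π y) (hπ.proj_mem hy)
    calc (2 ^ n) ^ a * ‖iteratedDeriv a β (2 ^ n * t)‖ * ‖D w n (π y)‖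
        ≤ (2 ^ n) ^ a * C a * b w n := by
          refine mul_le_mul (mul_le_mul_of_nonneg_left h1 (by positivity)) h2 (norm_nonneg _) ?_
          exact mul_nonneg (by positivity) ((norm_nonneg _).trans h1)
      _ = _ := by ring

end SectionSeries

end

noncomputable section

/-! ### Shrinking space into balls -/

section Shrink

variable {X F : Type*} [NormedAddCommGroup X] [NormedSpace ℝ X] [NormedAddCommGroup F]
  [InnerProductSpace ℝ F]

/-- With `expand_aux`, this identity makes the two radial rescalings inverse to each other. -/
theorem shrink_aux (c : ℝ) (y : F) :
    1 - c ^ 2 * ‖(√(1 + c ^ 2 * ‖y‖ ^ 2))⁻¹ • y‖ ^ 2 = (1 + c ^ 2 * ‖y‖ ^ 2)⁻¹ := by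
  have h : 0 < 1 + c ^ 2 * ‖y‖ ^ 2 := by positivity
  rw [norm_smul, norm_inv, Real.norm_of_nonneg (Real.sqrt_nonneg _), mul_pow, inv_pow,
    Real.sq_sqrt h.le]
  field_simp
  ring

theorem expand_aux {c : ℝ} {z : F} (h : c ^ 2 * ‖z‖ ^ 2 < 1) :
    1 + c ^ 2 * ‖(√(1 - c ^ 2 * ‖z‖ ^ 2))⁻¹ • z‖ ^ 2 = (1 - c ^ 2 * ‖z‖ ^ 2)⁻¹ := by
  have h : 0 < 1 - c ^ 2 * ‖z‖ ^ 2 := by linarith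
  rw [norm_smul, norm_inv, Real.norm_of_nonneg (Real.sqrt_nonneg _), mul_pow, inv_pow,
    Real.sq_sqrt h.le]
  field_simp
  ring

theorem contDiffOn_shrink {c : X → ℝ} (hc : ContDiff ℝ ∞ c) :
    ContDiffOn ℝ ∞ (fun q : X × F => (q.1, (√(1 + c q.1 ^ 2 * ‖q.2‖ ^ 2))⁻¹ • q.2))
      Set.univ := by
  have h0 : ∀ q : X × F, 0 < 1 + c q.1 ^ 2 * ‖q.2‖ ^ 2 := fun q => by positivity
  have h1 : ContDiff ℝ ∞ (fun q : X × F => 1 + c q.1 ^ 2 * ‖q.2‖ ^ 2) :=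
    contDiff_const.add (((hc.comp contDiff_fst).pow 2).mul (contDiff_snd.norm_sq ℝ))
  exact (contDiff_fst.prodMk (((h1.sqrt fun q => (h0 q).ne').inv fun q =>
    (Real.sqrt_pos.2 (h0 q)).ne').smul contDiff_snd)).contDiffOn

theorem contDiffOn_expand {c : X → ℝ} (hc : ContDiff ℝ ∞ c) :
    ContDiffOn ℝ ∞ (fun q : X × F => (q.1, (√(1 - c q.1 ^ 2 * ‖q.2‖ ^ 2))⁻¹ • q.2))
      {q | c q.1 ^ 2 * ‖q.2‖ ^ 2 < 1} := by
  have h0 : ∀ q ∈ {q : X × F | c q.1 ^ 2 * ‖q.2‖ ^ 2 < 1},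
      0 < 1 - c q.1 ^ 2 * ‖q.2‖ ^ 2 := fun q hq => sub_pos.2 hq
  have h1 : ContDiff ℝ ∞ (fun q : X × F => 1 - c q.1 ^ 2 * ‖q.2‖ ^ 2) :=
    contDiff_const.sub (((hc.comp contDiff_fst).pow 2).mul (contDiff_snd.norm_sq ℝ))
  exact contDiff_fst.contDiffOn.prodMk (((h1.contDiffOn.sqrt fun q hq => (h0 q hq).ne').inv
    fun q hq => (Real.sqrt_pos.2 (h0 q hq)).ne').smul contDiff_snd.contDiffOn)

theorem isOpen_shrink_target {X F : Type*} [TopologicalSpace X] [SeminormedAddCommGroup F]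
    {c : X → ℝ} (hc : Continuous c) : IsOpen {q : X × F | c q.1 ^ 2 * ‖q.2‖ ^ 2 < 1} :=
  isOpen_lt (by fun_prop) continuous_const

/-- The diffeomorphism that maps each fibre `{a} × F` onto the ball of radius `1 / |c a|`. -/
def shrink (c : X → ℝ) (hc : ContDiff ℝ ∞ c) : OpenPartialHomeomorph (X × F) (X × F) where
  toFun q := (q.1, (√(1 + c q.1 ^ 2 * ‖q.2‖ ^ 2))⁻¹ • q.2)
  invFun q := (q.1, (√(1 - c q.1 ^ 2 * ‖q.2‖ ^ 2))⁻¹ • q.2)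
  source := Set.univ
  target := {q | c q.1 ^ 2 * ‖q.2‖ ^ 2 < 1}
  map_source' q _ := by
    have h : 0 < (1 + c q.1 ^ 2 * ‖q.2‖ ^ 2)⁻¹ := by positivity
    rw [← shrink_aux] at h
    exact sub_pos.1 h
  map_target' _ _ := trivial
  left_inv' q _ := by
    have h : 0 < 1 + c q.1 ^ 2 * ‖q.2‖ ^ 2 := by positivity
    refine Prod.ext rfl ?_
    simp only
    rw [shrink_aux, Real.sqrt_inv, inv_inv, smul_smul,
      mul_inv_cancel₀ (Real.sqrt_pos.2 h).ne', one_smul]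
  right_inv' q hq := by
    have h : 0 < 1 - c q.1 ^ 2 * ‖q.2‖ ^ 2 := sub_pos.2 hq
    refine Prod.ext rfl ?_
    simp only
    rw [expand_aux hq, Real.sqrt_inv, inv_inv, smul_smul,
      mul_inv_cancel₀ (Real.sqrt_pos.2 h).ne', one_smul]
  open_source := isOpen_univ
  open_target := isOpen_shrink_target hc.continuous
  continuousOn_toFun := (contDiffOn_shrink hc).continuousOn
  continuousOn_invFun := (contDiffOn_expand hc).continuousOn

theorem isLocalDiffeo_shrink (c : X → ℝ) (hc : ContDiff ℝ ∞ c) :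
    IsLocalDiffeo (shrink (F := F) c hc) :=
  ⟨contDiffOn_shrink hc, contDiffOn_expand hc⟩

theorem shrink_eq_self {c : X → ℝ} (hc : ContDiff ℝ ∞ c) {q : X × F} (h : c q.1 = 0) :
    shrink c hc q = q := by
  change (q.1, (√(1 + c q.1 ^ 2 * ‖q.2‖ ^ 2))⁻¹ • q.2) = q
  simp [h]

end Shrink

/-! ### Constant families and closedness of graphs -/

section Families

variable {m : ℕ} {W : Set (Euc m)}

theorem isFiberedAt_const {X : Type*} [NormedAddCommGroup X] [NormedSpace ℝ X] {d : ℕ}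
    (hW : IsSmoothSubmanifold 𝓘(ℝ, Euc m) d W) {q : X × Euc m}
    (hq : q.2 ∈ W) : IsFiberedAt d (Prod.snd ⁻¹' W) q := by
  obtain ⟨e, L, he, hx, hL⟩ := isSmoothSubmanifold_iff_slice.1 hW q.2 hq
  refine ⟨(OpenPartialHomeomorph.refl X).prod e, L, ⟨⟨?_, ?_⟩, fun _ _ => rfl, ?_⟩,
    ⟨trivial, hx⟩, hL⟩
  · exact contDiff_fst.contDiffOn.prodMk
      (he.smooth.comp contDiff_snd.contDiffOn fun q hq => hq.2)
  · exact contDiff_fst.contDiffOn.prodMk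
      (he.smooth_symm.comp contDiff_snd.contDiffOn fun q hq => hq.2)
  · exact fun q hq => he.mem_iff _ hq.2

/-- The graph of a bounded continuous family of sections over a closed set is closed. -/
theorem isClosed_family_graph {X : Type*} [TopologicalSpace X] (hW : IsClosed W) {σ : X × Euc m → Euc m}
    (hσ : ContinuousOn σ (Set.univ ×ˢ W)) {C : ℝ} (hC : ∀ a, ∀ x ∈ W, ‖σ (a, x)‖ ≤ C) :
    IsClosed {q : X × Euc m | q.2 ∈ (fun x => x + σ (q.1, x)) '' W} := by
  rw [← isOpen_compl_iff, isOpen_iff_mem_nhds]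
  intro q₀ hq₀
  -- Only base points in this ball can be displaced, by at most `C`, to within distance `1` of
  -- `q₀.2`.
  set R := ‖q₀.2‖ + 1 + C with hR
  have h1 : ∀ᶠ q in 𝓝 q₀, ∀ x ∈ Metric.closedBall (0 : Euc m) R, x ∈ W →
      x + σ (q.1, x) ≠ q.2 := by
    refine (isCompact_closedBall 0 R).eventually_forall_of_forall_eventually fun x _ => ?_
    by_cases hxW : x ∈ W
    · have hne : x + σ (q₀.1, x) - q₀.2 ≠ 0 := fun h => hq₀ ⟨x, hxW, sub_eq_zero.1 h⟩
      have hc : ContinuousWithinAt (fun z : (X × Euc m) × Euc m => z.2 + σ (z.1.1, z.2) - z.1.2)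
          (Prod.snd ⁻¹' W) (q₀, x) := by
        refine (continuousWithinAt_snd.add ?_).sub
          (continuous_snd.comp continuous_fst).continuousWithinAt
        exact ContinuousWithinAt.comp (g := σ) (t := Set.univ ×ˢ W) (hσ (q₀.1, x) ⟨trivial, hxW⟩)
          ((continuous_fst.comp continuous_fst).prodMk continuous_snd).continuousWithinAt
          fun z hz => ⟨trivial, hz⟩
      have h2 := hc.tendsto.eventually_ne hne
      rw [eventually_nhdsWithin_iff] at h2
      filter_upwards [h2] with z hz hzW h
      exact hz hzW (sub_eq_zero.2 h)
    · filter_upwards [(hW.isOpen_compl.preimage continuous_snd).mem_nhds (x := (q₀, x)) hxW]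
        with z hz hzW
      exact absurd hzW hz
  have h2 : ∀ᶠ q : X × Euc m in 𝓝 q₀, ‖q.2‖ < ‖q₀.2‖ + 1 :=
    continuous_snd.norm.continuousAt.eventually_lt continuousAt_const (lt_add_one _)
  filter_upwards [h1, h2] with q hq hq'
  rintro ⟨x, hx, hxq⟩
  refine hq x ?_ hx hxq
  rw [mem_closedBall_zero_iff]
  have h3 : x = q.2 - σ (q.1, x) := by rw [← hxq]; simp
  rw [h3]
  linarith [norm_sub_le q.2 (σ (q.1, x)), hC q.1 x hx]

end Families

end

noncomputable section

/-! ### Curves through a sequence of submanifolds -/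

section Gluing

variable {m : ℕ}

/-- The profile is the reciprocal radius of the ball into which space is shrunk. It vanishes at the
times `2⁻ⁿ` and `0`, where nothing may move. It is at least `1 / n!` on the intervals where the
curve changes over, and factorial decay keeps it smooth at `0`. -/
theorem exists_dyadic_profile : ∃ c : ℝ → ℝ, ContDiff ℝ ∞ c ∧ c 0 = 0 ∧
    (∀ n : ℕ, c (2 ^ n)⁻¹ = 0) ∧
    ∀ (n : ℕ) t, 1 / 16 ≤ |2 ^ n * t - 1| → |2 ^ n * t - 1| ≤ 1 / 8 → (1 / n.factorial : ℝ) ≤ c t := by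
  obtain ⟨β, hβ, hc, -, hβ1, hβ0⟩ := exists_dyadic_bump
  -- The factor `256 = 16 ^ 2` brings the square up to `1` at distance `1 / 16`; the square itself
  -- produces the zero at `1`.
  obtain ⟨κ, hκ⟩ : ∃ κ : ℝ → ℝ, κ = fun τ => 256 * (τ - 1) ^ 2 * β τ := ⟨_, rfl⟩
  have hκs : ContDiff ℝ ∞ κ := by rw [hκ]; fun_prop
  have hκc : HasCompactSupport κ := by rw [hκ]; exact hc.mul_left
  have hκ0 : ∀ τ, 1 / 4 ≤ |τ - 1| → κ τ = 0 := fun τ hτ => by simp only [hκ, hβ0 τ hτ, mul_zero]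
  have hκ1 : ∀ τ, 1 / 16 ≤ |τ - 1| → |τ - 1| ≤ 1 / 8 → 1 ≤ κ τ := by
    intro τ h1 h2
    have h3 : (1 / 16 : ℝ) ^ 2 ≤ (τ - 1) ^ 2 := by
      rw [← sq_abs (τ - 1)]
      exact pow_le_pow_left₀ (by norm_num) h1 2
    simp only [hκ, hβ1 τ h2]
    linarith
  have hκ2 : κ 1 = 0 := by simp [hκ]
  clear hκ
  refine ⟨_, contDiff_bump_series hκs hκc, ?_, fun n => ?_, fun n t h1 h2 => ?_⟩
  · exact tsum_bump_eq_zero hκ0 _ fun n => by norm_num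
  · have h : (2 : ℝ) ^ n * (2 ^ n)⁻¹ = 1 := mul_inv_cancel₀ (by positivity)
    rw [tsum_bump_eq hκ0 _ (n := n) (by rw [h]; norm_num), h, hκ2, zero_smul]
  · rw [tsum_bump_eq hκ0 _ (n := n) (by linarith), smul_eq_mul]
    exact le_mul_of_one_le_left (by positivity) (hκ1 _ h1 h2)

/-- The set over `X` which follows `D`, except that near the times `2⁻ⁿ` it is equal
to `W n`. -/
def dyadicGlue {X : Type*} (T : X → ℝ) (W : ℕ → Set (Euc m)) (D : Set (X × Euc m)) :
    Set (X × Euc m) :=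
  {q | (∃ n : ℕ, |2 ^ n * T q.1 - 1| ≤ 1 / 16 ∧ q.2 ∈ W n) ∨
    ((∀ n : ℕ, 1 / 16 < |2 ^ n * T q.1 - 1|) ∧ q ∈ D)}

variable {X : Type*} {T : X → ℝ} {W : ℕ → Set (Euc m)} {D : Set (X × Euc m)}

theorem mem_dyadicGlue_iff {q : X × Euc m} {n : ℕ} (hn : |2 ^ n * T q.1 - 1| < 1 / 4) :
    q ∈ dyadicGlue T W D ↔ (|2 ^ n * T q.1 - 1| ≤ 1 / 16 ∧ q.2 ∈ W n) ∨
      (1 / 16 < |2 ^ n * T q.1 - 1| ∧ q ∈ D) := by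
  constructor
  · rintro (⟨k, hk, hq⟩ | ⟨h, hq⟩)
    · obtain rfl := eq_of_dyadic (k := k) hn (by linarith)
      exact Or.inl ⟨hk, hq⟩
    · exact Or.inr ⟨h n, hq⟩
  · rintro (⟨h, hq⟩ | ⟨h, hq⟩)
    · exact Or.inl ⟨n, h, hq⟩
    · refine Or.inr ⟨fun k => ?_, hq⟩
      by_contra hk
      obtain rfl := eq_of_dyadic (k := k) hn (by linarith)
      exact hk h

theorem mem_dyadicGlue_of_eq {q : X × Euc m} {n : ℕ} (hq : T q.1 = (2 ^ n)⁻¹) :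
    q ∈ dyadicGlue T W D ↔ q.2 ∈ W n := by
  have h : (2 : ℝ) ^ n * T q.1 - 1 = 0 := by
    rw [hq, mul_inv_cancel₀ (by positivity), sub_self]
  rw [mem_dyadicGlue_iff (n := n) (by rw [h]; norm_num), h]
  norm_num

theorem mem_dyadicGlue_of_nonpos {q : X × Euc m} (hq : T q.1 ≤ 0) :
    q ∈ dyadicGlue T W D ↔ q ∈ D := by
  have h : ∀ n : ℕ, 1 / 16 < |2 ^ n * T q.1 - 1| := fun n => by
    linarith [dyadic_of_nonpos hq n]
  constructor
  · rintro (⟨n, hn, -⟩ | h)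
    · exact absurd hn (not_le.2 (h n))
    · exact h.2
  · exact fun hD => Or.inr ⟨h, hD⟩

variable [TopologicalSpace X]

/-- At a time `≤ 0`, nearby times can be close to `2⁻ⁿ` only for large `n`, whose balls contain a
neighbourhood of the point. At a positive time the condition on `n` is never met nearby: continuity
excludes finitely many `n`, and for the others `2⁻ⁿ` is too small. -/
theorem eventually_mem_of_dyadic (hT : Continuous T) {V : ℕ → Set (Euc m)}
    (hV : ∀ n : ℕ, Metric.closedBall 0 n.factorial ⊆ V n) (q₀ : X × Euc m)
    (h0 : ∀ n : ℕ, 1 / 8 ≤ |2 ^ n * T q₀.1 - 1|) :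
    ∀ᶠ q in 𝓝 q₀, ∀ n : ℕ, |2 ^ n * T q.1 - 1| ≤ 1 / 16 → q.2 ∈ V n := by
  have hTc : Continuous fun q : X × Euc m => T q.1 := hT.comp continuous_fst
  rcases le_or_gt (T q₀.1) 0 with ht | ht
  · obtain ⟨k, hk⟩ := exists_nat_ge (‖q₀.2‖ + 1)
    have h1 : ∀ᶠ q : X × Euc m in 𝓝 q₀, 2 ^ k * T q.1 < 15 / 16 := by
      refine ContinuousAt.eventually_lt (by fun_prop) continuousAt_const ?_
      have : (0 : ℝ) ≤ 2 ^ k := by positivity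
      nlinarith
    have h2 : ∀ᶠ q : X × Euc m in 𝓝 q₀, ‖q.2‖ < ‖q₀.2‖ + 1 :=
      continuous_snd.norm.continuousAt.eventually_lt continuousAt_const (lt_add_one _)
    filter_upwards [h1, h2] with q hq hq' n hn
    refine hV n ?_
    rw [mem_closedBall_zero_iff]
    have hkn : k ≤ n := by
      by_contra hlt
      have h3 : (2 : ℝ) ^ n ≤ 2 ^ k := pow_le_pow_right₀ (by norm_num) (not_le.1 hlt).le
      have h4 : (0 : ℝ) < 2 ^ n := by positivity
      rw [abs_le] at hn
      have h5 : 0 < T q.1 := by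
        by_contra h
        nlinarith
      nlinarith
    have h6 : (k : ℝ) ≤ n.factorial := by
      exact_mod_cast (Nat.self_le_factorial k).trans (Nat.factorial_le hkn)
    linarith
  · obtain ⟨k, hk⟩ := pow_unbounded_of_one_lt (4 / T q₀.1) (by norm_num : (1 : ℝ) < 2)
    have h1 : ∀ᶠ q : X × Euc m in 𝓝 q₀, T q₀.1 / 2 < T q.1 :=
      continuousAt_const.eventually_lt hTc.continuousAt (by linarith)
    have h2 : ∀ᶠ q : X × Euc m in 𝓝 q₀, ∀ n ∈ Finset.range k, 1 / 16 < |2 ^ n * T q.1 - 1| := by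
      rw [Filter.eventually_all_finset]
      intro n _
      refine continuousAt_const.eventually_lt (by fun_prop) ?_
      linarith [h0 n]
    filter_upwards [h1, h2] with q hq hq' n hn
    exfalso
    rcases lt_or_ge n k with hnk | hnk
    · exact absurd hn (not_le.2 (hq' n (Finset.mem_range.2 hnk)))
    · have h3 : (2 : ℝ) ^ k ≤ 2 ^ n := pow_le_pow_right₀ (by norm_num) hnk
      rw [div_lt_iff₀ ht] at hk
      rw [abs_le] at hn
      have h4 : (0 : ℝ) < 2 ^ k := by positivity
      nlinarith

/-- The definition jumps at distance `1 / 16` from a dyadic time. There the bound on `c` confines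
the point to the ball of radius `n!`, on which `D` and `W n` agree, so the jump is invisible. -/
theorem dyadicGlue_eventually_eq (hT : Continuous T) {V : ℕ → Set (Euc m)}
    (hVo : ∀ n, IsOpen (V n)) (hV : ∀ n : ℕ, Metric.closedBall 0 n.factorial ⊆ V n)
    (hD : ∀ n, ∀ q : X × Euc m, |2 ^ n * T q.1 - 1| ≤ 1 / 8 → q.2 ∈ V n →
      (q ∈ D ↔ q.2 ∈ W n)) {c : ℝ → ℝ}
    (hc : ∀ (n : ℕ) t, 1 / 16 ≤ |2 ^ n * t - 1| → |2 ^ n * t - 1| ≤ 1 / 8 →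
      (1 / n.factorial : ℝ) ≤ c t) {q₀ : X × Euc m} (hq₀ : c (T q₀.1) ^ 2 * ‖q₀.2‖ ^ 2 < 1) :
    (∃ n, ∀ᶠ q in 𝓝 q₀, q ∈ dyadicGlue T W D ↔ q ∈ Prod.snd ⁻¹' W n) ∨
      ∀ᶠ q in 𝓝 q₀, q ∈ dyadicGlue T W D ↔ q ∈ D := by
  have hTc : Continuous fun q : X × Euc m => T q.1 := hT.comp continuous_fst
  by_cases h : ∃ n : ℕ, |2 ^ n * T q₀.1 - 1| < 1 / 8
  · obtain ⟨n, hn⟩ := h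
    have h1 : ∀ᶠ q : X × Euc m in 𝓝 q₀, |2 ^ n * T q.1 - 1| < 1 / 8 :=
      ContinuousAt.eventually_lt (by fun_prop) continuousAt_const hn
    refine Or.inl ⟨n, ?_⟩
    rcases lt_or_ge (|2 ^ n * T q₀.1 - 1|) (1 / 16) with hn' | hn'
    · have h2 : ∀ᶠ q : X × Euc m in 𝓝 q₀, |2 ^ n * T q.1 - 1| < 1 / 16 :=
        ContinuousAt.eventually_lt (by fun_prop) continuousAt_const hn'
      filter_upwards [h2] with q hq
      rw [mem_dyadicGlue_iff (n := n) (by linarith)]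
      exact ⟨fun h => h.elim And.right fun h => absurd h.1 (not_lt.2 hq.le),
        fun h => Or.inl ⟨hq.le, h⟩⟩
    · have h2 : q₀.2 ∈ V n := by
        refine hV n ?_
        rw [mem_closedBall_zero_iff]
        have h3 := hc n _ hn' hn.le
        have hf : (0 : ℝ) < n.factorial := by exact_mod_cast n.factorial_pos
        have h5 : (1 / n.factorial : ℝ) * ‖q₀.2‖ ≤ 1 := by
          rw [← abs_of_nonneg (by positivity : 0 ≤ (1 / n.factorial : ℝ) * ‖q₀.2‖),
            ← sq_le_one_iff_abs_le_one]
          rw [mul_pow]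
          refine le_trans (mul_le_mul_of_nonneg_right ?_ (by positivity)) hq₀.le
          exact pow_le_pow_left₀ (by positivity) h3 2
        rwa [one_div, inv_mul_le_iff₀ hf, mul_one] at h5
      filter_upwards [h1, continuous_snd.continuousAt.preimage_mem_nhds ((hVo n).mem_nhds h2)]
        with q hq hqV
      rw [mem_dyadicGlue_iff (n := n) (by linarith), hD n q hq.le hqV, Set.mem_preimage,
        ← or_and_right]
      exact and_iff_right (le_or_gt _ _)
  · push Not at h
    refine Or.inr ?_
    filter_upwards [eventually_mem_of_dyadic hT hV q₀ h] with q hq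
    by_cases hn : ∃ n : ℕ, |2 ^ n * T q.1 - 1| ≤ 1 / 16
    · obtain ⟨n, hn⟩ := hn
      rw [mem_dyadicGlue_iff (n := n) (by linarith), hD n q (by linarith) (hq n hn)]
      exact ⟨fun h => h.elim And.right And.right, fun h => Or.inl ⟨hn, h⟩⟩
    · push Not at hn
      constructor
      · rintro (⟨n, hn', -⟩ | h)
        · exact absurd hn' (not_le.2 (hn n))
        · exact h.2
      · exact fun hD => Or.inr ⟨hn, hD⟩

end Gluing

/-! ### Smooth curves of sections -/

section Families

variable {m : ℕ} {W : Set (Euc m)} {N : Set (Euc m × Euc m)} {Ω : Set (Euc m)}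
  {π : Euc m → Euc m}

theorem iteratedFieldDeriv_zero (W : Set (Euc m)) (Xs : List (Euc m → Euc m)) :
    iteratedFieldDeriv W Xs (fun _ => 0) = fun _ => 0 := by
  induction Xs with
  | nil => rfl
  | cons X Xs ih =>
    funext x
    change fderivWithin ℝ (iteratedFieldDeriv W Xs fun _ => 0) W x (X x) = 0
    rw [ih]
    simp

/-- The difference is supported in a compact set and its derivatives are continuous along `W`. -/
theorem IsTubularRetraction.exists_bound_iteratedFieldDeriv (hπ : IsTubularRetraction W N Ω π)
    (hW : IsClosed W) (s t : NormalSection W) {Xs : List (Euc m → Euc m)}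
    (hXs : ∀ X ∈ Xs, IsTangentField W X) : ∃ C, ∀ x ∈ W,
      ‖iteratedFieldDeriv W Xs (fun y => t.toFun y - s.toFun y) x‖ ≤ C := by
  have hK : IsCompact (W ∩ (tsupport t.toFun ∪ tsupport s.toFun)) :=
    (t.compact_support.isCompact.union s.compact_support.isCompact).inter_left hW
  have hc := (hπ.contDiffOn_iteratedFieldDeriv (t.smooth.sub s.smooth) hXs).continuousOn
  obtain ⟨C, hC⟩ := hK.exists_bound_of_continuousOn (hc.mono Set.inter_subset_left)
  refine ⟨max C 0, fun x hx => ?_⟩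
  by_cases h : x ∈ tsupport t.toFun ∪ tsupport s.toFun
  · exact (hC x ⟨hx, h⟩).trans (le_max_left _ _)
  · have hU : IsOpen (tsupport t.toFun ∪ tsupport s.toFun)ᶜ :=
      ((isClosed_tsupport _).union (isClosed_tsupport _)).isOpen_compl
    rw [iteratedFieldDeriv_congr hU (g := fun _ => 0) (fun y _ hy => ?_) Xs x hx h,
      iteratedFieldDeriv_zero, norm_zero]
    · exact le_max_right _ _
    · rw [image_eq_zero_of_notMem_tsupport fun h => hy (Or.inl h),
        image_eq_zero_of_notMem_tsupport fun h => hy (Or.inr h), sub_zero]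

/-- A smooth family of sections that is equal to the section `s` at time `0`, and to `t n`
near the time `2⁻ⁿ`. -/
theorem IsTubularRetraction.exists_section_curve (hπ : IsTubularRetraction W N Ω π)
    (hW : IsClosed W) (s : NormalSection W) (t : ℕ → NormalSection W) {ε : Euc m → ℝ}
    (hεpos : ∀ x ∈ W, 0 < ε x)
    (hε : ∀ x ∈ W, ∀ v, (x, v) ∈ normalBundle W → ‖v - s.toFun x‖ < ε x → (x, v) ∈ N)
    (htε : ∀ n, ∀ x ∈ W, ‖(t n).toFun x - s.toFun x‖ < ε x)
    (ht : ∀ n, ∀ w : List (Fin m), w.length ≤ n → ∀ x ∈ W,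
      ‖iteratedFieldDeriv W (projFields π w) (fun y => (t n).toFun y - s.toFun y) x‖ <
        1 / n.factorial) :
    ∃ σ : ℝ × Euc m → Euc m, ContDiffOn ℝ ∞ σ (Set.univ ×ˢ W) ∧
      (∀ τ, ∀ x ∈ W, (x, σ (τ, x)) ∈ N) ∧
      (∀ n : ℕ, ∀ τ, |2 ^ n * τ - 1| ≤ 1 / 8 → ∀ x, σ (τ, x) = (t n).toFun x) ∧
      (∀ τ ≤ 0, ∀ x, σ (τ, x) = s.toFun x) ∧ ∃ C, ∀ τ, ∀ x ∈ W, ‖σ (τ, x)‖ ≤ C := by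
  obtain ⟨β, hβ, hc, hβ01, hβ1, hβ0⟩ := exists_dyadic_bump
  set f : ℕ → Euc m → Euc m := fun n y => (t n).toFun y - s.toFun y with hf
  -- At most one bump is active at any time, so the curve is always on a segment from `s` to some `t
  -- n`. This keeps it in the `ε`-ball and hence in `N`.
  have hcase : ∀ τ : ℝ, (∀ x, s.toFun x + ∑' n, β (2 ^ n * τ) • f n x = s.toFun x) ∨
      ∃ n, ∃ a : ℝ, 0 ≤ a ∧ a ≤ 1 ∧
        ∀ x, s.toFun x + ∑' n, β (2 ^ n * τ) • f n x = s.toFun x + a • f n x := by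
    intro τ
    by_cases h : ∃ n : ℕ, |2 ^ n * τ - 1| < 1 / 4
    · obtain ⟨n, hn⟩ := h
      exact Or.inr ⟨n, β (2 ^ n * τ), (hβ01 _).1, (hβ01 _).2, fun x => by
        rw [tsum_bump_eq hβ0 (fun n => f n x) hn]⟩
    · push Not at h
      exact Or.inl fun x => by rw [tsum_bump_eq_zero hβ0 (fun n => f n x) h, add_zero]
  have hsmall : ∀ n, ∀ a : ℝ, 0 ≤ a → a ≤ 1 → ∀ x, ‖a • f n x‖ ≤ ‖f n x‖ := by
    intro n a h0 h1 x
    rw [norm_smul, Real.norm_of_nonneg h0]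
    exact mul_le_of_le_one_left (norm_nonneg _) h1
  refine ⟨fun q => s.toFun q.2 + ∑' n, β (2 ^ n * q.1) • f n q.2, ?_, ?_, ?_, ?_, ?_⟩
  · refine (s.smooth.comp contDiff_snd.contDiffOn fun q hq => hq.2).add
      (hπ.contDiffOn_bump_series hβ hc (fun n => (t n).smooth.sub s.smooth) fun w => ?_)
    choose C hC using fun n => hπ.exists_bound_iteratedFieldDeriv hW s (t n)
      (hπ.isTangentField_of_mem_projFields w)
    -- For fixed `w` the factorial bound fails for only finitely many `n`; any bound does for those.
    refine ⟨fun n => if w.length ≤ n then 1 / n.factorial else C n, fun n x hx => ?_, fun a => ?_⟩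
    · simp only
      split_ifs with h
      · exact (ht n w h x hx).le
      · exact hC n x hx
    · refine (summable_congr_cofinite ?_).1 (summable_pow_mul_inv_factorial a)
      rw [Nat.cofinite_eq_atTop]
      filter_upwards [Filter.eventually_ge_atTop w.length] with n hn
      rw [if_pos hn]
  · intro τ x hx
    rcases hcase τ with h | ⟨n, a, h0, h1, h⟩
    · simp only
      rw [h x]
      exact hε x hx _ (s.normal x hx) (by simpa using hεpos x hx)
    · simp only
      rw [h x]
      refine hε x hx _ ?_ ?_
      · have h2 := normalBundle_add_smul (s.normal x hx)
          (normalBundle_add_smul ((t n).normal x hx) (s.normal x hx) (-1)) a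
        simpa [hf, sub_eq_add_neg] using h2
      · rw [add_sub_cancel_left]
        exact (hsmall n a h0 h1 x).trans_lt (htε n x hx)
  · intro n τ hτ x
    simp only
    rw [tsum_bump_eq hβ0 (fun n => f n x) (n := n) (by linarith), hβ1 _ hτ, one_smul,
      add_sub_cancel]
  · intro τ hτ x
    simp only
    rw [tsum_bump_eq_zero hβ0 (fun n => f n x) fun n => ?_, add_zero]
    linarith [dyadic_of_nonpos hτ n]
  · obtain ⟨C, hC⟩ := (s.compact_support.isCompact.inter_left hW).exists_bound_of_continuousOn
      (s.smooth.continuousOn.mono Set.inter_subset_left)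
    have hC' : ∀ x ∈ W, ‖s.toFun x‖ ≤ max C 0 := by
      intro x hx
      by_cases h : x ∈ tsupport s.toFun
      · exact (hC x ⟨hx, h⟩).trans (le_max_left _ _)
      · rw [image_eq_zero_of_notMem_tsupport h, norm_zero]
        exact le_max_right _ _
    refine ⟨max C 0 + 1, fun τ x hx => ?_⟩
    rcases hcase τ with h | ⟨n, a, h0, h1, h⟩
    · simp only
      rw [h x]
      linarith [hC' x hx]
    · simp only
      rw [h x]
      have h2 : ‖f n x‖ < 1 / n.factorial := ht n [] (Nat.zero_le _) x hx
      have h3 : (1 / n.factorial : ℝ) ≤ 1 := by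
        rw [div_le_one (by exact_mod_cast n.factorial_pos)]
        exact_mod_cast n.factorial_pos
      linarith [norm_add_le (s.toFun x) (a • f n x), hC' x hx, hsmall n a h0 h1 x]

end Families

end

noncomputable section

/-! ### Plots through a sequence and neighbourhoods of germs -/

section Curves

variable {d m : ℕ} {N : Set (Euc m × Euc m)}

/-- A sequence of submanifolds which, near larger and larger balls, agree with the images of
sections rapidly converging to `s`, lies on a smooth curve through the image of `s`. -/
theorem exists_isPlot_dyadic {W : Psi d m} (hN : IsTubularNeighbourhood W.1 N) {Ω : Set (Euc m)}
    {π : Euc m → Euc m} (hπ : IsTubularRetraction W.1 N Ω π) (s : ChartDomain W N)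
    (t : ℕ → ChartDomain W N) (W' : ℕ → Psi d m) {ε : Euc m → ℝ} (hεpos : ∀ x ∈ W.1, 0 < ε x)
    (hε : ∀ x ∈ W.1, ∀ v, (x, v) ∈ normalBundle W.1 → ‖v - s.1.toFun x‖ < ε x → (x, v) ∈ N)
    (htε : ∀ n, ∀ x ∈ W.1, ‖(t n).1.toFun x - s.1.toFun x‖ < ε x)
    (ht : ∀ n, ∀ w : List (Fin m), w.length ≤ n → ∀ x ∈ W.1,
      ‖iteratedFieldDeriv W.1 (projFields π w) (fun y => (t n).1.toFun y - s.1.toFun y) x‖ <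
        1 / n.factorial)
    (hW' : ∀ n : ℕ, germSetoid d m (Metric.closedBall 0 n.factorial) (W' n)
      (chartMap W N (t n))) :
    ∃ p : Euc 1 → Psi d m, IsPlot (n := 1) p ∧ p 0 = chartMap W N s ∧
      ∀ n : ℕ, p (EuclideanSpace.single 0 (2 ^ n)⁻¹) = W' n := by
  obtain ⟨σ, hσ, hσN, hσt, hσ0, C, hC⟩ := hπ.exists_section_curve W.2.1 s.1 (fun n => (t n).1)
    hεpos hε htε ht
  obtain ⟨c, hc, hc0, hcn, hcle⟩ := exists_dyadic_profile
  choose V hVo hV hVeq using hW'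
  set T : Euc 1 → ℝ := fun u => u 0 with hT
  have hTs : ContDiff ℝ ∞ T := by fun_prop
  set D : Set (Euc 1 × Euc m) := {q | q.2 ∈ (fun x => x + σ (T q.1, x)) '' W.1} with hD
  have hσT : ContDiffOn ℝ ∞ (fun q : Euc 1 × Euc m => σ (T q.1, q.2)) (Set.univ ×ˢ W.1) :=
    hσ.comp ((hTs.comp contDiff_fst).prodMk contDiff_snd).contDiffOn fun q hq => hq
  have hDcl : IsClosed D := isClosed_family_graph (σ := fun q => σ (T q.1, q.2)) W.2.1
    hσT.continuousOn fun u => hC (T u)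
  have hDfib : ∀ q ∈ D, IsFiberedAt d D q := by
    intro q hq
    have h := hπ.isFiberedAt_family (σ := fun q => σ (T q.1, q.2)) hN W.2.2 isOpen_univ hσT
      (fun u _ => hσN (T u)) (q := q) ⟨trivial, hq⟩
    exact h.congr (Filter.Eventually.of_forall fun q => (and_iff_right trivial).symm)
  set G := dyadicGlue T (fun n => (W' n).1) D with hG
  have hcT : ContDiff ℝ ∞ fun u => c (T u) := hc.comp hTs
  set Φ := shrink (F := Euc m) _ hcT with hΦ
  -- The image of `shrink` is precisely where the glued set is locally either a constant family or
  -- the family of sections. The pullback therefore inherits closedness and smoothness from those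
  -- two.
  have key : ∀ q₀, (∃ n, ∀ᶠ q in 𝓝 (Φ q₀), q ∈ G ↔ q ∈ Prod.snd ⁻¹' (W' n).1) ∨
      ∀ᶠ q in 𝓝 (Φ q₀), q ∈ G ↔ q ∈ D := by
    intro q₀
    refine dyadicGlue_eventually_eq hTs.continuous hVo hV (fun n q hq hqV => ?_) hcle
      (Φ.map_source (x := q₀) trivial)
    have h1 : q ∈ D ↔ q.2 ∈ (chartMap W N (t n)).1 := by
      have h2 : (fun x => x + σ (T q.1, x)) = fun x => x + (t n).1.toFun x :=
        funext fun x => by rw [hσt n _ hq]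
      change q.2 ∈ (fun x => x + σ (T q.1, x)) '' W.1 ↔ _
      rw [h2]
      rfl
    have h3 := Set.ext_iff.1 (hVeq n) q.2
    rw [h1]
    simpa [hqV] using h3.symm
  have hΦc : Continuous Φ := continuousOn_univ.1 Φ.continuousOn_toFun
  have hcl : IsClosed (Φ ⁻¹' G) := by
    rw [← isOpen_compl_iff, isOpen_iff_mem_nhds]
    intro q₀ hq₀
    refine hΦc.continuousAt.preimage_mem_nhds (t := Gᶜ) ?_
    obtain ⟨n, hn⟩ | hn := key q₀
    · have h := mt hn.self_of_nhds.2 hq₀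
      filter_upwards [hn, (((W' n).2.1.preimage continuous_snd).isOpen_compl).mem_nhds h]
        with q hq hq' hqG using hq' (hq.1 hqG)
    · have h := mt hn.self_of_nhds.2 hq₀
      filter_upwards [hn, hDcl.isOpen_compl.mem_nhds h] with q hq hq' hqG using hq' (hq.1 hqG)
  have hfib : ∀ q ∈ Φ ⁻¹' G, IsFiberedAt d (Φ ⁻¹' G) q := by
    intro q₀ hq₀
    refine IsFiberedAt.comp (isLocalDiffeo_shrink _ hcT) (fun _ _ => rfl) trivial ?_
    obtain ⟨n, hn⟩ | hn := key q₀
    · exact (isFiberedAt_const (W' n).2.2 (hn.self_of_nhds.1 hq₀)).congr hn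
    · exact (hDfib _ (hn.self_of_nhds.1 hq₀)).congr hn
  have hfst : ∀ u y, c (T u) = 0 → Φ (u, y) = (u, y) := fun u y h => shrink_eq_self hcT h
  refine ⟨fun u => ⟨{y | (u, y) ∈ Φ ⁻¹' G}, hcl.preimage (Continuous.prodMk_right u),
    isSmoothSubmanifold_fiber fun y hy => hfib _ hy⟩, isPlot_of_isFiberedAt hcl hfib, ?_, ?_⟩
  · refine Subtype.ext (Set.ext fun y => ?_)
    have hT0 : T 0 = 0 := rfl
    change Φ (0, y) ∈ G ↔ _
    rw [hfst 0 y (by rw [hT0, hc0]), mem_dyadicGlue_of_nonpos hT0.le]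
    have h2 : (fun x => x + σ (T 0, x)) = fun x => x + s.1.toFun x :=
      funext fun x => by rw [hσ0 _ hT0.le]
    change y ∈ (fun x => x + σ (T 0, x)) '' W.1 ↔ _
    rw [h2]
    rfl
  · intro n
    refine Subtype.ext (Set.ext fun y => ?_)
    have hTn : T (EuclideanSpace.single 0 (2 ^ n)⁻¹) = (2 ^ n)⁻¹ := by simp [hT]
    change Φ (_, y) ∈ G ↔ _
    rw [hfst _ y (by rw [hTn, hcn]), mem_dyadicGlue_of_eq (n := n) hTn]

/-- Otherwise, counterexamples for ever smaller strong neighbourhoods and ever larger balls would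
lie on one plot at times tending to `0`. Its value at `0` lies in `O`, so almost all of them would
too. -/
theorem exists_strong_nhds_germ_subset {W : Psi d m} (hN : IsTubularNeighbourhood W.1 N)
    (s : ChartDomain W N) {O : Set (Psi d m)} (hO : IsOpen[plotTopology d m] O)
    (hs : chartMap W N s ∈ O) :
    ∃ V : Set (NormalSection W.1), IsOpen[strongTopology W.1] V ∧ s.1 ∈ V ∧
      ∃ K : Set (Euc m), IsCompact K ∧ ∀ t : ChartDomain W N, t.1 ∈ V →
        ∀ W', germSetoid d m K W' (chartMap W N t) → W' ∈ O := by
  by_contra! hcon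
  obtain ⟨Ω, π, hπ⟩ := hN.exists_retraction
  obtain ⟨ε, hεc, hεpos, hε⟩ := hN.exists_radius s.1.smooth s.2.1
  set B : ℕ → List (Fin m) → Set (NormalSection W.1) := fun n w => {t | ∀ x ∈ W.1,
    ‖iteratedFieldDeriv W.1 (projFields π w) (fun y => t.toFun y - s.1.toFun y) x‖ <
      1 / n.factorial} with hB
  have hpos : ∀ n : ℕ, (0 : ℝ) < 1 / n.factorial := fun n => by positivity
  -- There are only finitely many lists of length at most `n`, so this is a finite intersection of
  -- subbasic sets.
  have hV : ∀ n : ℕ, IsOpen[strongTopology W.1] ({t : NormalSection W.1 | ∀ x ∈ W.1,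
      ‖t.toFun x - s.1.toFun x‖ < ε x} ∩ ⋂ w ∈ {w : List (Fin m) | w.length ≤ n}, B n w) := by
    intro n
    let _ := strongTopology W.1
    refine (isOpen_strong_norm_lt s.1 hεc hεpos).inter
      ((List.finite_length_le (Fin m) n).isOpen_biInter fun w _ => ?_)
    exact isOpen_strong_basic s.1 (hπ.isTangentField_of_mem_projFields w) continuousOn_const
      fun _ _ => hpos n
  have h := fun n : ℕ => hcon _ (hV n) ⟨fun x hx => by simpa using hεpos x hx, by
    simp only [Set.mem_iInter]
    intro w _ x _
    simp only [sub_self]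
    rw [iteratedFieldDeriv_zero, norm_zero]
    exact hpos n⟩ (Metric.closedBall 0 n.factorial) (isCompact_closedBall _ _)
  choose t ht W' hW' hW'O using h
  obtain ⟨p, hp, hp0, hpn⟩ := exists_isPlot_dyadic hN hπ s t W' hεpos hε
    (fun n => (ht n).1) (fun n w hw => Set.mem_iInter₂.1 (ht n).2 w hw) hW'
  have hopen : IsOpen (p ⁻¹' O) := hO 1 (Euc 1) p hp
  have hlim : Filter.Tendsto (fun n : ℕ => (EuclideanSpace.single 0 ((2 : ℝ) ^ n)⁻¹ : Euc 1))
      Filter.atTop (𝓝 0) := by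
    rw [tendsto_zero_iff_norm_tendsto_zero]
    simpa using tendsto_pow_atTop_nhds_zero_of_lt_one (r := (2 : ℝ)⁻¹) (by norm_num) (by norm_num)
  obtain ⟨n, hn⟩ := (hlim.eventually (hopen.mem_nhds (by
    change p 0 ∈ O
    rwa [hp0]))).exists
  have hn' : p (EuclideanSpace.single 0 (2 ^ n)⁻¹) ∈ O := hn
  rw [hpn] at hn'
  exact hW'O n hn'

end Curves

/-! ### Comparison of the topologies -/

section Comparison

variable {d m : ℕ}

theorem isOpen_compactSupportTopology_iff {O : Set (Psi d m)} :
    IsOpen[compactSupportTopology d m] O ↔ ∀ (W : Psi d m) (N : Set (Euc m × Euc m)),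
      IsTubularNeighbourhood W.1 N → ∃ V, IsOpen[strongTopology W.1] V ∧
        ∀ s : ChartDomain W N, s.1 ∈ V ↔ chartMap W N s ∈ O := by
  rw [compactSupportTopology, isOpen_iSup_iff]
  refine forall_congr' fun W => ?_
  rw [isOpen_iSup_iff]
  refine forall_congr' fun N => ?_
  rw [isOpen_iSup_iff]
  refine forall_congr' fun _ => ?_
  exact exists_congr fun V => and_congr_right fun _ => Set.ext_iff

theorem isOpen_germTopology_iff {K : Set (Euc m)} {O : Set (Psi d m)} :
    IsOpen[germTopology d m K] O ↔ ∃ S : Set (PsiGerm d m K),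
      IsOpen[compactSupportTopology d m] (toGerm d m K ⁻¹' S) ∧ toGerm d m K ⁻¹' S = O :=
  Iff.rfl

/-- The zero section. -/
def zeroSection (W : Set (Euc m)) : NormalSection W where
  toFun _ := 0
  eq_zero_off _ _ := rfl
  smooth := contDiffOn_const
  normal _ hx := zero_mem_normalBundle hx
  compact_support := HasCompactSupport.zero

/-- The zero section as a point of the domain of a chart. -/
def zeroChart (W : Psi d m) {N : Set (Euc m × Euc m)} (hN : IsTubularNeighbourhood W.1 N) :
    ChartDomain W N :=
  ⟨zeroSection W.1, hN.zero_section,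
    isClosedSubmanifold_sectionImage hN W.2 (zeroSection W.1) hN.zero_section⟩

theorem chartMap_zeroChart (W : Psi d m) {N : Set (Euc m × Euc m)}
    (hN : IsTubularNeighbourhood W.1 N) : chartMap W N (zeroChart W hN) = W := by
  refine Subtype.ext ?_
  change (fun x => x + (0 : Euc m)) '' W.1 = W.1
  simp

/-- Near `u₀` the values of the plot have the same germ at `K` as small sections over `p u₀` itself,
and membership in a `K`-open set depends only on that germ. -/
theorem isOpen_plotTopology_of_isOpen_germTopology {K : Set (Euc m)} (hK : IsCompact K)
    {O : Set (Psi d m)} (hO : IsOpen[germTopology d m K] O) : IsOpen[plotTopology d m] O := by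
  obtain ⟨S, hS, rfl⟩ := isOpen_germTopology_iff.1 hO
  rw [isOpen_compactSupportTopology_iff] at hS
  intro n U _ _ _ _ _ p hp
  rw [isOpen_iff_mem_nhds]
  intro u₀ hu₀
  obtain ⟨N, hN⟩ := exists_isTubularNeighbourhood (p u₀).2.2
  obtain ⟨V, hV, hVS⟩ := hS (p u₀) N hN
  have hz := chartMap_zeroChart (p u₀) hN
  have h := hp.eventually_exists_section u₀ hN (zeroChart (p u₀) hN) hK
    (by rw [hz]) hV ((hVS _).2 (by rw [hz]; exact hu₀))
  filter_upwards [h] with u ⟨s, hsV, hs⟩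
  have h1 : toGerm d m K (p u) = toGerm d m K (chartMap (p u₀) N s) := Quotient.sound hs
  change toGerm d m K (p u) ∈ S
  rw [h1]
  exact (hVS s).1 hsV

/-- Applying the neighbourhood statement to the images of the sections themselves shows that the
preimage under each chart is a neighbourhood of each of its points. -/
theorem isOpen_compactSupportTopology_of_isOpen_plotTopology {O : Set (Psi d m)}
    (hO : IsOpen[plotTopology d m] O) : IsOpen[compactSupportTopology d m] O := by
  rw [isOpen_compactSupportTopology_iff]
  intro W N hN
  let _ := strongTopology W.1
  refine ⟨⋃₀ {V | IsOpen V ∧ ∀ t : ChartDomain W N, t.1 ∈ V → chartMap W N t ∈ O},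
    isOpen_sUnion fun V hV => hV.1, fun s => ⟨?_, fun hs => ?_⟩⟩
  · rintro ⟨V, hV, hs⟩
    exact hV.2 s hs
  · obtain ⟨V, hV, hsV, K, -, h⟩ := exists_strong_nhds_germ_subset hN s hO hs
    exact ⟨V, ⟨hV, fun t ht => h t ht _ ((germSetoid d m K).refl _)⟩, hsV⟩

theorem isOpen_grwTopology_of_isOpen_plotTopology {O : Set (Psi d m)}
    (hO : IsOpen[plotTopology d m] O) : IsOpen[grwTopology d m] O := by
  let _ := grwTopology d m
  rw [isOpen_iff_forall_mem_open]
  intro W hW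
  obtain ⟨N, hN⟩ := exists_isTubularNeighbourhood W.2.2
  have hz := chartMap_zeroChart W hN
  obtain ⟨V, hV, hzV, K, hK, hVK⟩ := exists_strong_nhds_germ_subset hN (zeroChart W hN) hO
    (by rwa [hz])
  set A : Set (Psi d m) := {W' | ∃ t : ChartDomain W N, t.1 ∈ V ∧
    germSetoid d m K W' (chartMap W N t)} with hA
  have hAplot : IsOpen[plotTopology d m] A := by
    intro n U _ _ _ _ _ p hp
    rw [isOpen_iff_mem_nhds]
    rintro u₀ ⟨t, htV, ht⟩
    exact hp.eventually_exists_section u₀ hN t hK ht hV htV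
  -- Saturation under germs at `K` is what upgrades openness of `A` from the compactly supported
  -- topology to the germ topology.
  have hAK : toGerm d m K ⁻¹' (toGerm d m K '' A) = A := by
    refine Set.Subset.antisymm ?_ (Set.subset_preimage_image _ _)
    rintro W' ⟨W'', ⟨t, htV, ht⟩, h⟩
    exact ⟨t, htV, (germSetoid d m K).trans (Quotient.exact h.symm) ht⟩
  have hAgerm : IsOpen[germTopology d m K] A := by
    refine isOpen_germTopology_iff.2 ⟨toGerm d m K '' A, ?_, hAK⟩
    rw [hAK]
    exact isOpen_compactSupportTopology_of_isOpen_plotTopology hAplot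
  have hle : grwTopology d m ≤ germTopology d m K := iInf₂_le K hK
  refine ⟨A, ?_, hle _ hAgerm, zeroChart W hN, hzV, ?_⟩
  · rintro W' ⟨t, htV, ht⟩
    exact hVK t htV W' ht
  · rw [hz]

theorem plotTopology_eq_grwTopology (d m : ℕ) : plotTopology d m = grwTopology d m := by
  refine le_antisymm ?_ fun O hO => isOpen_grwTopology_of_isOpen_plotTopology hO
  exact le_iInf₂ fun K hK O hO => isOpen_plotTopology_of_isOpen_germTopology hK hO

end Comparison

theorem mainTheorem8 (d m : ℕ) :
    @IsHomeomorph (Psi d m) (Psi d m) (plotTopology d m) (grwTopology d m) id := by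
  rw [plotTopology_eq_grwTopology]
  let _ := grwTopology d m
  exact IsHomeomorph.id

end
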